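/- Let $M$ be a free abelian group of finite rank with dual $N=\operatorname{Hom}(M,\mathbb Z)$, put $N_{\mathbb R}=N\otimes\mathbb R=\operatorname{Hom}(M,\mathbb R)$ with the pairing $\langle\cdot,\cdot\rangle$, and let $\mathbb T_N=\operatorname{Spec}\mathbb C[M]$ be the torus with character lattice $M$. Let $X\subset\mathbb T_N$ be the closed subscheme (for instance a subvariety) defined by an ideal $I\subset\mathbb C[M]$. For $w\in N_{\mathbb R}$ the initial form $\operatorname{in}_wf$ of $f=\sum c_m\xi^m$ is the sum of those terms $c_m\xi^m$, $c_m\neq0$, for which $\langle m,w\rangle$ is minimal; $\operatorname{in}_wI$ is the ideal generated by all $\operatorname{in}_wf$, $f\in I$, and $\operatorname{in}_wX\subset\mathbb T_N$ is the closed subscheme it defines. Let $\Sigma$ be a rational polyhedral fan in $N_{\mathbb R}$ (closed under taking faces, any two cones meeting in a common face, containing the cone $\{0\}$, so that all its cones are strongly convex) such that $\operatorname{in}_uI=\operatorname{in}_wI$ whenever $u,w$ lie in the relative interior of the same cone of $\Sigma$; for instance, such a fan structure on the tropical variety of $X$. For $\sigma\in\Sigma$ let $\operatorname{in}_\sigma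 X$ be the common scheme $\operatorname{in}_wX$ for $w$ in the relative interior of $\sigma$. Let $\sigma^\vee$ and $\sigma^\perp$ be the sets of $m\in M$ with $\langle m,\cdot\rangle\ge0$, respectively $\langle m,\cdot\rangle=0$, on $\sigma$; let $Y_\Sigma$ be the toric variety glued from the affine charts $V_\sigma=\operatorname{Spec}\mathbb C[\sigma^\vee]$, and let $\mathcal O_\sigma=\operatorname{Spec}\mathbb C[\sigma^\perp]\hookrightarrow V_\sigma\subset Y_\Sigma$ be the torus orbit of $\sigma$, embedded by the map $\mathbb C[\sigma^\vee]\to\mathbb C[\sigma^\perp]$ that is the identity on $\sigma^\perp$ and sends $\xi^m$ to $0$ for $m\in\sigma^\vee\setminus\sigma^\perp$. Let $\overline X$ be the (scheme-theoretic) closure of $X\subset\mathbb T_N=V_{\{0\}}$ in $Y_\Sigma$. Finally let $\langle\sigma\rangle\subset N$ be the subgroup generated by $\sigma\cap N$ and $\mathbb T_{\langle\sigma\rangle}=\operatorname{Spec}\mathbb C[\operatorname{Hom}(\langle\sigma\rangle,\mathbb Z)]$, which maps to $\mathbb T_N$. Then for every cone $\sigma\in\Sigma$ the group $\mathbb T_{\langle\sigma\rangle}$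 acts on $\operatorname{in}_\sigma X$ by translation, the action is free (the morphism $\mathbb T_{\langle\sigma\rangle}\times\operatorname{in}_\sigma X\to\operatorname{in}_\sigma X\times\operatorname{in}_\sigma X$, $(t,x)\mapsto(tx,x)$, is a closed immersion), and its quotient is the scheme-theoretic intersection of $\overline X$ with the orbit: \[ \operatorname{in}_\sigma X/\mathbb T_{\langle\sigma\rangle}\;=\;\overline X\cap\mathcal O_\sigma . \] That is, the projection $\mathbb T_N\to\mathcal O_\sigma=\mathbb T_N/\mathbb T_{\langle\sigma\rangle}$ induced by $\sigma^\perp\subset M$ restricts to a morphism $\operatorname{in}_\sigma X\to\overline X\cap\mathcal O_\sigma$ which is a principal $\mathbb T_{\langle\sigma\rangle}$-bundle (faithfully flat and quasi-compact, with $\mathbb T_{\langle\sigma\rangle}\times\operatorname{in}_\sigma X\cong\operatorname{in}_\sigma X\times_{\overline X\cap\mathcal O_\sigma}\operatorname{in}_\sigma X$) and the categorical quotient by the action. -/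

import Mathlib

open AlgebraicGeometry CategoryTheory Limits MonoidalCategory CartesianMonoidalCategory

noncomputable section

namespace TropicalToric

/-! ### Cones and fans

`M` is a lattice, `N = Hom(M, ℤ)` is its dual lattice `M →+ ℤ`, and the real vector space
`N ⊗ ℝ = Hom(M, ℝ)` is `M →+ ℝ`. The pairing `⟨m, w⟩` is the evaluation `w m`. -/

section Cones

variable {M : Type} [AddCommGroup M]

/-- The inclusion of the lattice `N = Hom(M, ℤ)` into `N ⊗ ℝ = Hom(M, ℝ)`. -/
def latticeToReal (n : M →+ ℤ) : M →+ ℝ := (Int.castAddHom ℝ).comp n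

/-- A rational polyhedral cone: the set of non-negative real combinations of finitely many
lattice vectors. -/
def IsRationalPolyhedral (σ : PointedCone ℝ (M →+ ℝ)) : Prop :=
  ∃ s : Finset (M →+ ℤ), σ = PointedCone.hull ℝ (latticeToReal '' (s : Set (M →+ ℤ)))

/-- `σ^∨`, the monoid of lattice points `m ∈ M` that are non-negative on `σ`. -/
def dualMonoid (σ : PointedCone ℝ (M →+ ℝ)) : AddSubmonoid M where
  carrier := {m | ∀ w ∈ σ, 0 ≤ w m}
  zero_mem' := fun w _ => by simp
  add_mem' := fun ha hb w hw => by
    rw [map_add]; exact add_nonneg (ha w hw) (hb w hw)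

/-- `σ^⊥`, the group of lattice points `m ∈ M` that vanish on `σ`. -/
def perp (σ : PointedCone ℝ (M →+ ℝ)) : AddSubgroup M where
  carrier := {m | ∀ w ∈ σ, w m = 0}
  zero_mem' := fun w _ => by simp
  add_mem' := fun ha hb w hw => by rw [map_add, ha w hw, hb w hw, add_zero]
  neg_mem' := fun ha w hw => by rw [map_neg, ha w hw, neg_zero]

/-- `τ` is a face of `σ` (possibly `σ` itself): `τ = σ ∩ m^⊥` for some `m ∈ σ^∨`. -/
def IsFace (τ σ : PointedCone ℝ (M →+ ℝ)) : Prop :=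
  ∃ m ∈ dualMonoid σ, ∀ w, w ∈ τ ↔ w ∈ σ ∧ w m = 0

/-- The relative interior of a cone: its points that lie in no proper face. -/
def relInterior (σ : PointedCone ℝ (M →+ ℝ)) : Set (M →+ ℝ) :=
  {w | w ∈ σ ∧ ∀ τ, IsFace τ σ → w ∈ τ → τ = σ}

variable (M) in
/-- A rational polyhedral fan in `N ⊗ ℝ`. As the zero cone belongs to the fan, it is a face of every
cone of the fan by `inter_isFace`, so that all the cones are strongly convex. -/
structure Fan where
  cones : Set (PointedCone ℝ (M →+ ℝ))
  rational : ∀ σ ∈ cones, IsRationalPolyhedral σ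
  zero_mem : ⊥ ∈ cones
  face_mem : ∀ σ ∈ cones, ∀ τ, IsFace τ σ → τ ∈ cones
  inter_isFace : ∀ σ ∈ cones, ∀ τ ∈ cones, IsFace (σ ⊓ τ) σ

/-- `⟨σ⟩`, the subgroup of `N` generated by the lattice points of `σ`. -/
def latticeSpan (σ : PointedCone ℝ (M →+ ℝ)) : AddSubgroup (M →+ ℤ) :=
  AddSubgroup.closure {n | latticeToReal n ∈ σ}

/-- The restriction map `M → Hom(⟨σ⟩, ℤ)`, `m ↦ (n ↦ ⟨m, n⟩)`. -/
def restrictSpan (σ : PointedCone ℝ (M →+ ℝ)) : M →+ (latticeSpan σ →+ ℤ) where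
  toFun m := (AddMonoidHom.eval m).comp (latticeSpan σ).subtype
  map_zero' := by ext n; simp
  map_add' a b := by ext n; simp

end Cones

/-! ### Initial ideals -/

section Initial

variable {M : Type} [AddCommGroup M]

open Classical in
/-- The initial form `in_w f`: the sum of the terms of `f` on which `⟨·, w⟩` is minimal among the
exponents of `f`. -/
def initialForm (w : M →+ ℝ) (f : AddMonoidAlgebra ℂ M) : AddMonoidAlgebra ℂ M :=
  .ofCoeff (f.coeff.filter fun m => ∀ m' ∈ f.coeff.support, w m ≤ w m')

/-- The initial ideal `in_w I`, generated by the initial forms of all the elements of `I`. -/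
def initialIdeal (w : M →+ ℝ) (I : Ideal (AddMonoidAlgebra ℂ M)) :
    Ideal (AddMonoidAlgebra ℂ M) :=
  Ideal.span (initialForm w '' (I : Set (AddMonoidAlgebra ℂ M)))

end Initial

/-! ### The affine toric charts, and their gluing -/

section Toric

variable {M : Type} [AddCommGroup M]

lemma dualMonoid_anti {σ τ : PointedCone ℝ (M →+ ℝ)} (h : σ ≤ τ) :
    dualMonoid τ ≤ dualMonoid σ := fun _ hm w hw => hm w (h hw)

/-- The inclusion `ℂ[τ^∨] → ℂ[σ^∨]` for `σ ⊆ τ`. -/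
def chartRingMap {σ τ : PointedCone ℝ (M →+ ℝ)} (h : σ ≤ τ) :
    AddMonoidAlgebra ℂ (dualMonoid τ) →ₐ[ℂ] AddMonoidAlgebra ℂ (dualMonoid σ) :=
  AddMonoidAlgebra.mapDomainAlgHom ℂ ℂ (AddSubmonoid.inclusion (dualMonoid_anti h))

/-- The affine toric variety `V_σ = Spec ℂ[σ^∨]`. -/
abbrev chart (σ : PointedCone ℝ (M →+ ℝ)) : Scheme.{0} :=
  Spec (.of (AddMonoidAlgebra ℂ (dualMonoid σ)))

/-- The morphism `V_σ → V_τ` for `σ ⊆ τ`. -/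
def chartMap {σ τ : PointedCone ℝ (M →+ ℝ)} (h : σ ≤ τ) : chart σ ⟶ chart τ :=
  Spec.map (CommRingCat.ofHom (chartRingMap h).toRingHom)

lemma chartRingMap_single {σ τ : PointedCone ℝ (M →+ ℝ)} (h : σ ≤ τ) (m : dualMonoid τ) (c : ℂ) :
    chartRingMap h (.single m c) = .single (AddSubmonoid.inclusion (dualMonoid_anti h) m) c := by
  simp [chartRingMap]

lemma chartRingMap_injective {σ τ : PointedCone ℝ (M →+ ℝ)} (h : σ ≤ τ) :
    Function.Injective (chartRingMap h) := by
  have := AddMonoidAlgebra.mapDomain_injective (R := ℂ)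
    (AddSubmonoid.inclusion_injective (dualMonoid_anti h))
  exact this

lemma mem_dualMonoid_hull (s : Set (M →+ ℤ)) (m : M) (hm : ∀ n ∈ s, 0 ≤ n m) :
    m ∈ dualMonoid (PointedCone.hull ℝ (latticeToReal '' s)) := by
  intro w hw
  refine Submodule.span_induction (p := fun w _ => 0 ≤ w m) ?_ ?_ ?_ ?_ hw
  · rintro _ ⟨n, hn, rfl⟩
    simpa [latticeToReal] using hm n hn
  · simp
  · intro x y _ _ hx hy
    simpa using add_nonneg hx hy
  · intro a x _ hx
    exact mul_nonneg a.2 hx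

/-- If `τ = σ ∩ m^⊥` with `m ∈ σ^∨`, then `τ^∨ = σ^∨ + ℕ(-m)`. -/
lemma exists_nsmul_add_mem {σ τ : PointedCone ℝ (M →+ ℝ)} (hσ : IsRationalPolyhedral σ) {m : M}
    (hm : m ∈ dualMonoid σ) (hτ : ∀ w, w ∈ τ ↔ w ∈ σ ∧ w m = 0) {a : M} (ha : a ∈ dualMonoid τ) :
    ∃ k₀ : ℕ, ∀ k ≥ k₀, k • m + a ∈ dualMonoid σ := by
  obtain ⟨s, rfl⟩ := hσ
  refine ⟨∑ n ∈ s, (n a).natAbs, fun k hk => mem_dualMonoid_hull _ _ fun n hn => ?_⟩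
  have hns : latticeToReal n ∈ PointedCone.hull ℝ (latticeToReal '' (s : Set (M →+ ℤ))) :=
    Submodule.subset_span ⟨n, hn, rfl⟩
  have h0 : 0 ≤ n m := by simpa [latticeToReal] using hm _ hns
  have hk' : (n a).natAbs ≤ k :=
    (Finset.single_le_sum (f := fun n : M →+ ℤ => (n a).natAbs) (fun _ _ => Nat.zero_le _) hn).trans
      hk
  rcases h0.eq_or_lt with h | h
  · have : latticeToReal n ∈ τ := (hτ _).2 ⟨hns, by simp [latticeToReal, ← h]⟩
    have := ha _ this
    simpa [latticeToReal, ← h] using this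
  · have h1 : (k : ℤ) * 1 ≤ k * n m := by gcongr; omega
    simp only [map_add, map_nsmul, nsmul_eq_mul]
    omega

lemma isLocalization_chartRingMap {σ τ : PointedCone ℝ (M →+ ℝ)} (hσ : IsRationalPolyhedral σ)
    {m : M} (hm : m ∈ dualMonoid σ) (hτ : ∀ w, w ∈ τ ↔ w ∈ σ ∧ w m = 0) (h : τ ≤ σ) :
    letI := (chartRingMap h).toRingHom.toAlgebra
    IsLocalization.Away (AddMonoidAlgebra.single (⟨m, hm⟩ : dualMonoid σ) (1 : ℂ))
      (AddMonoidAlgebra ℂ (dualMonoid τ)) := by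
  let _ := (chartRingMap h).toRingHom.toAlgebra
  have halg : ∀ x, algebraMap (AddMonoidAlgebra ℂ (dualMonoid σ))
      (AddMonoidAlgebra ℂ (dualMonoid τ)) x = chartRingMap h x := fun x => rfl
  have hneg : -m ∈ dualMonoid τ := fun w hw => by simp [((hτ w).1 hw).2]
  have hpow : ∀ k : ℕ, algebraMap (AddMonoidAlgebra ℂ (dualMonoid σ))
      (AddMonoidAlgebra ℂ (dualMonoid τ)) (.single (⟨m, hm⟩ : dualMonoid σ) (1 : ℂ)) ^ k =
      .single (k • (⟨m, dualMonoid_anti h hm⟩ : dualMonoid τ)) 1 := fun k => by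
    rw [halg, chartRingMap_single, AddMonoidAlgebra.single_pow, one_pow]; rfl
  have hsurj : ∀ x : AddMonoidAlgebra ℂ (dualMonoid τ), ∃ k₀ : ℕ, ∀ k ≥ k₀, ∃ a,
      x * algebraMap (AddMonoidAlgebra ℂ (dualMonoid σ)) (AddMonoidAlgebra ℂ (dualMonoid τ))
        (.single (⟨m, hm⟩ : dualMonoid σ) (1 : ℂ)) ^ k =
      algebraMap (AddMonoidAlgebra ℂ (dualMonoid σ)) (AddMonoidAlgebra ℂ (dualMonoid τ)) a := by
    intro x
    induction x using AddMonoidAlgebra.induction_linear with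
    | zero => exact ⟨0, fun k _ => ⟨0, by simp⟩⟩
    | add f g hf hg =>
      obtain ⟨k, hk⟩ := hf
      obtain ⟨l, hl⟩ := hg
      refine ⟨max k l, fun j hj => ?_⟩
      obtain ⟨a, ha⟩ := hk j (le_trans (le_max_left _ _) hj)
      obtain ⟨b, hb⟩ := hl j (le_trans (le_max_right _ _) hj)
      exact ⟨a + b, by rw [add_mul, ha, hb, map_add]⟩
    | single a c =>
      obtain ⟨k₀, hk₀⟩ := exists_nsmul_add_mem hσ hm hτ a.2
      refine ⟨k₀, fun k hk => ⟨.single ⟨_, hk₀ k hk⟩ c, ?_⟩⟩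
      rw [hpow, halg, chartRingMap_single, AddMonoidAlgebra.single_mul_single, mul_one]
      congr 1
      ext
      simp [add_comm]
  refine IsLocalization.Away.mk _ ?_ ?_ ?_
  · rw [halg, chartRingMap_single]
    refine IsUnit.of_mul_eq_one (.single ⟨-m, hneg⟩ 1) ?_
    rw [AddMonoidAlgebra.single_mul_single, AddMonoidAlgebra.one_def, mul_one]
    congr 1
    ext
    simp
  · intro x
    obtain ⟨k, hk⟩ := hsurj x
    obtain ⟨a, ha⟩ := hk k le_rfl
    exact ⟨k, a, ha⟩
  · intro a b hab
    exact ⟨0, by rw [chartRingMap_injective h hab]⟩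

lemma isOpenImmersion_chartMap {σ τ : PointedCone ℝ (M →+ ℝ)} (hσ : IsRationalPolyhedral σ)
    (hτ : IsFace τ σ) (h : τ ≤ σ) : IsOpenImmersion (chartMap h) := by
  obtain ⟨m, hm, hτ⟩ := hτ
  let _ := (chartRingMap h).toRingHom.toAlgebra
  have := isLocalization_chartRingMap hσ hm hτ h
  exact IsOpenImmersion.of_isLocalization
    (AddMonoidAlgebra.single (⟨m, hm⟩ : dualMonoid σ) (1 : ℂ))

lemma range_chartMap {σ τ : PointedCone ℝ (M →+ ℝ)} (hσ : IsRationalPolyhedral σ)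
    {m : M} (hm : m ∈ dualMonoid σ) (hτ : ∀ w, w ∈ τ ↔ w ∈ σ ∧ w m = 0) (h : τ ≤ σ) :
    Set.range (chartMap h) =
      (PrimeSpectrum.basicOpen (AddMonoidAlgebra.single (⟨m, hm⟩ : dualMonoid σ) (1 : ℂ)) :
        Set (PrimeSpectrum (AddMonoidAlgebra ℂ (dualMonoid σ)))) := by
  let _ := (chartRingMap h).toRingHom.toAlgebra
  have := isLocalization_chartRingMap hσ hm hτ h
  exact PrimeSpectrum.localization_away_comap_range (AddMonoidAlgebra ℂ (dualMonoid τ))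
    (AddMonoidAlgebra.single (⟨m, hm⟩ : dualMonoid σ) (1 : ℂ))

lemma chartMap_refl (σ : PointedCone ℝ (M →+ ℝ)) : chartMap (le_refl σ) = 𝟙 (chart σ) := by
  have : chartRingMap (le_refl σ) = AlgHom.id ℂ _ := AddMonoidAlgebra.mapDomainAlgHom_id ..
  rw [chartMap, this]
  exact Spec.map_id _

lemma chartMap_comp {σ τ ρ : PointedCone ℝ (M →+ ℝ)} (h : σ ≤ τ) (h' : τ ≤ ρ) :
    chartMap h ≫ chartMap h' = chartMap (h.trans h') := by
  have : chartRingMap (h.trans h') = (chartRingMap h).comp (chartRingMap h') :=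
    AddMonoidAlgebra.mapDomainAlgHom_comp (R := ℂ) (A := ℂ)
      (AddSubmonoid.inclusion (dualMonoid_anti h')) (AddSubmonoid.inclusion (dualMonoid_anti h))
  rw [chartMap, chartMap, chartMap, this, ← Spec.map_comp, ← CommRingCat.ofHom_comp]
  rfl

/-- The diagram of the affine toric varieties `V_σ`, `σ ∈ Σ`, with the morphisms `V_σ → V_τ` for
`σ ⊆ τ`. -/
def chartDiagram (F : Fan M) : F.cones ⥤ Scheme.{0} where
  obj σ := chart σ.1
  map f := chartMap (leOfHom f)
  map_id σ := chartMap_refl σ.1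
  map_comp f g := (chartMap_comp (leOfHom f) (leOfHom g)).symm

lemma Fan.isFace_of_le (F : Fan M) {σ τ : F.cones} (h : τ ≤ σ) : IsFace τ.1 σ.1 := by
  have := F.inter_isFace σ σ.2 τ τ.2
  rwa [inf_eq_right.2 (show τ.1 ≤ σ.1 from h)] at this

instance (F : Fan M) {σ τ : F.cones} (f : σ ⟶ τ) : IsOpenImmersion ((chartDiagram F).map f) :=
  isOpenImmersion_chartMap (F.rational _ τ.2) (F.isFace_of_le (leOfHom f)) _

instance (F : Fan M) : (chartDiagram F ⋙ Scheme.forget).IsLocallyDirected where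
  cond := by
    intro σ σ' τ f f' x x' hx
    obtain ⟨m, hm, h⟩ := F.isFace_of_le (leOfHom f)
    obtain ⟨m', hm', h'⟩ := F.isFace_of_le (leOfHom f')
    have hmem : σ.1 ⊓ σ'.1 ∈ F.cones := F.face_mem σ σ.2 _ (F.inter_isFace σ σ.2 σ' σ'.2)
    let ρ : F.cones := ⟨σ.1 ⊓ σ'.1, hmem⟩
    have hρσ : ρ ≤ σ := show σ.1 ⊓ σ'.1 ≤ σ.1 from inf_le_left
    have hρσ' : ρ ≤ σ' := show σ.1 ⊓ σ'.1 ≤ σ'.1 from inf_le_right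
    have hρ : ∀ w, w ∈ ρ.1 ↔ w ∈ τ.1 ∧ w (m + m') = 0 := by
      intro w
      rw [show w ∈ ρ.1 ↔ w ∈ σ.1 ∧ w ∈ σ'.1 from Submodule.mem_inf, h, h', map_add]
      constructor
      · rintro ⟨⟨h1, h2⟩, -, h3⟩
        exact ⟨h1, by rw [h2, h3, add_zero]⟩
      · rintro ⟨h1, h2⟩
        have h3 := hm w h1
        have h4 := hm' w h1
        exact ⟨⟨h1, by linarith⟩, h1, by linarith⟩
    have hy : (chartMap (leOfHom f)) x ∈ Set.range (chartMap (hρσ.trans (leOfHom f))) := by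
      rw [range_chartMap (F.rational _ τ.2) (add_mem hm hm') hρ]
      have h1 : (chartMap (leOfHom f)) x ∈ Set.range (chartMap (leOfHom f)) := ⟨x, rfl⟩
      have h2 : (chartMap (leOfHom f)) x ∈ Set.range (chartMap (leOfHom f')) := ⟨x', hx.symm⟩
      rw [range_chartMap (F.rational _ τ.2) hm h] at h1
      rw [range_chartMap (F.rational _ τ.2) hm' h'] at h2
      have h3 : (AddMonoidAlgebra.single (⟨m + m', add_mem hm hm'⟩ : dualMonoid τ.1) (1 : ℂ)) =
          .single (⟨m, hm⟩ : dualMonoid τ.1) 1 * .single (⟨m', hm'⟩ : dualMonoid τ.1) 1 := by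
        rw [AddMonoidAlgebra.single_mul_single, mul_one]; rfl
      rw [h3, PrimeSpectrum.basicOpen_mul]
      exact ⟨h1, h2⟩
    obtain ⟨y, hy⟩ := hy
    refine ⟨ρ, homOfLE hρσ, homOfLE hρσ', y, ?_, ?_⟩
    · apply ((chartDiagram F).map f).isOpenEmbedding.injective
      refine Eq.trans ?_ hy
      rw [← chartMap_comp hρσ (leOfHom f)]
      rfl
    · apply ((chartDiagram F).map f').isOpenEmbedding.injective
      refine Eq.trans ?_ hx
      refine Eq.trans ?_ hy
      rw [← chartMap_comp hρσ' (leOfHom f')]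
      rfl

/-- The toric variety `Y_Σ`: the affine toric varieties `V_σ`, `σ ∈ Σ`, glued along the open
immersions `V_σ → V_τ` for `σ ⊆ τ`. -/
def toricVariety (F : Fan M) : Scheme.{0} := colimit (chartDiagram F)

/-- The open immersion `V_σ → Y_Σ`. -/
def chartToToric (F : Fan M) (σ : F.cones) : chart σ.1 ⟶ toricVariety F :=
  colimit.ι (chartDiagram F) σ

end Toric

/-! ### Tori, orbits, and subschemes -/

section Schemes

/-- `Spec ℂ`. -/
abbrev base : Scheme.{0} := Spec (.of ℂ)

/-- `Spec A` as a scheme over `ℂ`. -/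
abbrev affine (A : Type) [CommRing A] [Algebra ℂ A] : Over base := (Spec (.of A)).asOver base

/-- The morphism `Spec B → Spec A` over `ℂ` given by a homomorphism of `ℂ`-algebras `A → B`. -/
def affineMap {A B : Type} [CommRing A] [Algebra ℂ A] [CommRing B] [Algebra ℂ B] (f : A →ₐ[ℂ] B) :
    affine B ⟶ affine A :=
  (Spec.map (CommRingCat.ofHom f.toRingHom)).asOver base

/-- The group scheme `Spec ℂ[L]` for an abelian group `L`; its group structure over `ℂ`
comes from the Hopf algebra structure of `ℂ[L]`, in which the elements of `L` are group-like. -/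
abbrev torus (L : Type) [AddCommGroup L] : Over base := affine (AddMonoidAlgebra ℂ L)

/-- The homomorphism `Spec ℂ[L'] → Spec ℂ[L]` given by `L → L'`. -/
def torusMap {L L' : Type} [AddCommGroup L] [AddCommGroup L'] (f : L →+ L') : torus L' ⟶ torus L :=
  affineMap (AddMonoidAlgebra.mapDomainAlgHom ℂ ℂ f)

variable {M : Type} [AddCommGroup M]

/-- The torus `T_⟨σ⟩`, with character lattice `Hom(⟨σ⟩, ℤ)`. -/
abbrev subtorus (σ : PointedCone ℝ (M →+ ℝ)) : Over base := torus (latticeSpan σ →+ ℤ)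

/-- The homomorphism `T_⟨σ⟩ → T_N`, where `T_N = Spec ℂ[M]`, induced by `⟨σ⟩ ⊆ N`. -/
def subtorusι (σ : PointedCone ℝ (M →+ ℝ)) : subtorus σ ⟶ torus M := torusMap (restrictSpan σ)

/-- The torus orbit `O_σ = Spec ℂ[σ^⊥]`. -/
abbrev orbit (σ : PointedCone ℝ (M →+ ℝ)) : Over base := torus (perp σ)

/-- The quotient homomorphism `T_N → O_σ = T_N / T_⟨σ⟩`, induced by `σ^⊥ ⊆ M`. -/
def torusToOrbit (σ : PointedCone ℝ (M →+ ℝ)) : torus M ⟶ orbit σ := torusMap (perp σ).subtype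

open Classical in
/-- The map `ℂ[σ^∨] → ℂ[σ^⊥]` that sends `m` to `m` if `m ∈ σ^⊥` and to `0` otherwise. -/
def orbitRingMap (σ : PointedCone ℝ (M →+ ℝ)) :
    AddMonoidAlgebra ℂ (dualMonoid σ) →ₐ[ℂ] AddMonoidAlgebra ℂ (perp σ) :=
  AddMonoidAlgebra.lift ℂ _ _
    { toFun := fun m => if h : (m.toAdd : M) ∈ perp σ then .single ⟨m.toAdd, h⟩ 1 else 0
      map_one' := by
        rw [dif_pos (by simp)]
        rfl
      map_mul' := by
        intro a b
        have key : ((a * b).toAdd : M) ∈ perp σ ↔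
            (a.toAdd : M) ∈ perp σ ∧ (b.toAdd : M) ∈ perp σ := by
          constructor
          · intro h
            refine ⟨fun w hw => ?_, fun w hw => ?_⟩ <;>
            · have h1 := h w hw
              have h2 := a.toAdd.2 w hw
              have h3 := b.toAdd.2 w hw
              simp only [toAdd_mul, AddSubmonoid.coe_add, map_add] at h1
              linarith
          · rintro ⟨h1, h2⟩
            exact add_mem h1 h2
        by_cases ha : (a.toAdd : M) ∈ perp σ
        · by_cases hb : (b.toAdd : M) ∈ perp σ
          · rw [dif_pos (key.2 ⟨ha, hb⟩), dif_pos ha, dif_pos hb,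
              AddMonoidAlgebra.single_mul_single, mul_one]
            rfl
          · rw [dif_neg (fun h => hb (key.1 h).2), dif_neg hb, mul_zero]
        · rw [dif_neg (fun h => ha (key.1 h).1), dif_neg ha, zero_mul] }

/-- The inclusion `O_σ → V_σ → Y_Σ`. -/
def orbitToToric (F : Fan M) (σ : F.cones) : (orbit σ.1).left ⟶ toricVariety F :=
  Spec.map (CommRingCat.ofHom (orbitRingMap σ.1).toRingHom) ≫ chartToToric F σ

/-- The inclusion `T_N = V_0 → Y_Σ`. -/
def torusToToric (F : Fan M) : (torus M).left ⟶ toricVariety F :=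
  Spec.map (CommRingCat.ofHom
    (AddMonoidAlgebra.mapDomainAlgHom ℂ ℂ
      (dualMonoid (⊥ : PointedCone ℝ (M →+ ℝ))).subtype).toRingHom) ≫
    chartToToric F ⟨⊥, F.zero_mem⟩

/-- The closed subscheme of `T_N` defined by an ideal of `ℂ[M]`. -/
abbrev subscheme (I : Ideal (AddMonoidAlgebra ℂ M)) : Over base := affine (AddMonoidAlgebra ℂ M ⧸ I)

/-- The inclusion into `T_N` of the closed subscheme defined by an ideal. -/
def subschemeι (I : Ideal (AddMonoidAlgebra ℂ M)) : subscheme I ⟶ torus M :=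
  affineMap (Ideal.Quotient.mkₐ ℂ I)

/-- The initial scheme `in_w X ⊆ T_N` of the subscheme `X` of `T_N` defined by `I`. -/
abbrev initialScheme (w : M →+ ℝ) (I : Ideal (AddMonoidAlgebra ℂ M)) : Over base :=
  subscheme (initialIdeal w I)

/-- The inclusion of `X` into `Y_Σ`, where `X` is the subscheme of `T_N` defined by `I`. -/
def subschemeToToric (F : Fan M) (I : Ideal (AddMonoidAlgebra ℂ M)) :
    (subscheme I).left ⟶ toricVariety F :=
  (subschemeι I).left ≫ torusToToric F

/-- The closure `X̄` of `X` in `Y_Σ`, that is, the scheme-theoretic image of `X → Y_Σ`. -/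
def toricClosure (F : Fan M) (I : Ideal (AddMonoidAlgebra ℂ M)) : Scheme.{0} :=
  (subschemeToToric F I).image

/-- The closed immersion `X̄ → Y_Σ`. -/
def toricClosureι (F : Fan M) (I : Ideal (AddMonoidAlgebra ℂ M)) :
    toricClosure F I ⟶ toricVariety F :=
  (subschemeToToric F I).imageι

/-- The scheme-theoretic intersection `X̄ ∩ O_σ = X̄ ×_{Y_Σ} O_σ`. -/
def closureInterOrbit (F : Fan M) (I : Ideal (AddMonoidAlgebra ℂ M)) (σ : F.cones) : Over base :=
  Over.mk (pullback.snd (toricClosureι F I) (orbitToToric F σ) ≫ (orbit σ.1).hom)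

/-- The inclusion `X̄ ∩ O_σ → O_σ`. -/
def closureInterOrbitι (F : Fan M) (I : Ideal (AddMonoidAlgebra ℂ M)) (σ : F.cones) :
    closureInterOrbit F I σ ⟶ orbit σ.1 :=
  Over.homMk (pullback.snd (toricClosureι F I) (orbitToToric F σ))

end Schemes

/-! ### Free actions and quotients -/

section Quotients

variable (G X : Over base) [GrpObj G] [ModObj G X]

/-- The action morphism `G × X → X`. -/
abbrev actionMap : G ⊗ X ⟶ X := ModObj.smul (M := G) (X := X)

/-- A group scheme acts freely if `G × X → X × X`, `(g, x) ↦ (g x, x)`, is a closed immersion; in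
particular, it is then a monomorphism, that is, `G(S)` acts freely on `X(S)` for all `S`. -/
def IsFreeAction : Prop := IsClosedImmersion (lift (actionMap G X) (snd G X)).left

variable {X} {Q : Over base}

/-- `q : X → Q` exhibits `Q` as the quotient `X / G` by a free action: `q` is a principal
`G`-bundle (it is faithfully flat and quasi-compact, and `G × X → X ×_Q X`, `(g, x) ↦ (g x, x)` is
an isomorphism), and it is the categorical quotient (the coequalizer of the action and the
projection). -/
structure IsFreeQuotient (q : X ⟶ Q) : Prop where
  flat : Flat q.left
  surjective : Surjective q.left
  quasiCompact : QuasiCompact q.left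
  isPullback : IsPullback (actionMap G X) (snd G X) q q
  isCoequalizer : Nonempty (IsColimit (Cofork.ofπ q isPullback.w))

end Quotients

end TropicalToric

end

open TropicalToric

open AlgebraicGeometry CategoryTheory Limits MonoidalCategory CartesianMonoidalCategory

noncomputable section

namespace TropicalToric

/-! Write J for the common initial ideal along σ. The geometry reduces to one algebraic fact,
`initialIdeal_eq_span_part`: J is generated by the parts on σ^⊥ of the elements of I ∩ ℂ[σ^∨]. These
parts are the restrictions to O_σ of the equations of X̄ in V_σ, so in_σ X is the preimage of X̄ ∩
O_σ under T_N → O_σ (`initialIdeal_eq_map`, `exists_isPullback_closureInterOrbit`). Since σ^⊥ is a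
direct summand of M with complement Hom(⟨σ⟩, ℤ), the extension of tori splits and this preimage is a
trivial bundle (`exists_splitting`, `exists_isFreeQuotient`).

That such parts lie in J is immediate. For the converse, J has generators g_i with exponents in σ^⊥,
and one needs f_i ∈ I such that all exponents of f_i - g_i are non-negative and not identically zero
on σ (`HasLifts`). A finite universal basis U provides them over any cone on which no difference of
exponents of an element of U changes sign (`hasLifts_of_constSign`). Finitely many hyperplane cuts
lead to such cones, and `hasLifts_of_list` undoes the cuts one at a time.

Undoing a cut of a cone C along a section H is `HasLifts.of_cut`. Lifts over the two halves are
first corrected so that they are also lifts along H (`exists_lifts_upperCut`). The difference p = f₁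
- f₂ of two such lifts is of arbitrarily high order along H, modulo the module L of sums of elements
of I positive on one of the halves (`exists_reduction`). The image of I ∩ ℂ[H^∨] modulo L is
finitely generated over ℂ[C^∨] (`exists_finite_middleIdeal_le`). By Artin–Rees and Krull there is an
r, positive on C, with (1 - r)p = a + b in L. Then (1 - r)f₁ - a = (1 - r)f₂ + b is a lift over both
halves, hence over C.

The universal basis (`exists_universal_basis`) comes from compactness of the space of total group
orders on M: each order has a finite basis by Dickson's lemma, a dimension count shows that it still
works for all nearby orders, and every weight is refined by an order. -/

/-! ### Supports of Laurent polynomials -/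

section Support

variable {M : Type}

/-- The Laurent polynomials all of whose exponents lie in `S`. -/
def suppIn (S : Set M) : Submodule ℂ (AddMonoidAlgebra ℂ M) where
  carrier := {f | ∀ m, f.coeff m ≠ 0 → m ∈ S}
  zero_mem' := by simp
  add_mem' := by
    intro f g hf hg m hm
    by_cases h : f.coeff m = 0
    · exact hg m fun h' => hm (by simp [h, h'])
    · exact hf m h
  smul_mem' := by
    intro c f hf m hm
    exact hf m fun h => hm (by simp [h])

lemma suppIn_mono {S T : Set M} (h : S ⊆ T) : suppIn S ≤ suppIn T := fun _ hf m hm => h (hf m hm)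

lemma mem_suppIn_of_subset {S T : Set M} {f : AddMonoidAlgebra ℂ M} (hf : f ∈ suppIn S)
    (h : ∀ m ∈ S, m ∈ T) : f ∈ suppIn T := fun m hm => h m (hf m hm)

lemma single_mem_suppIn {S : Set M} {m : M} (hm : m ∈ S) (c : ℂ) :
    AddMonoidAlgebra.single m c ∈ suppIn S := by
  classical
  intro m' hm'
  rw [AddMonoidAlgebra.coeff_single, Finsupp.single_apply] at hm'
  split_ifs at hm' with h
  · exact h ▸ hm
  · exact absurd rfl hm'

open Classical in
/-- The sum of the terms of a Laurent polynomial whose exponents lie in `S`. -/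
def part (S : Set M) : AddMonoidAlgebra ℂ M →ₗ[ℂ] AddMonoidAlgebra ℂ M where
  toFun f := .ofCoeff (f.coeff.filter (· ∈ S))
  map_add' f g := by
    ext m
    simp [Finsupp.filter_add]
  map_smul' c f := by
    ext m
    simp [Finsupp.filter_smul]

open Classical in
lemma coeff_part (S : Set M) (f : AddMonoidAlgebra ℂ M) (m : M) :
    (part S f).coeff m = if m ∈ S then f.coeff m else 0 :=
  Finsupp.filter_apply _ _ _

lemma coeff_part_ne_zero {S : Set M} {f : AddMonoidAlgebra ℂ M} {m : M} :
    (part S f).coeff m ≠ 0 ↔ m ∈ S ∧ f.coeff m ≠ 0 := by simp [coeff_part]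

lemma part_eq_self {S : Set M} {f : AddMonoidAlgebra ℂ M} (h : f ∈ suppIn S) : part S f = f := by
  ext m
  rw [coeff_part]
  split_ifs with hm
  · rfl
  · by_contra h'
    exact hm (h m (Ne.symm h'))

lemma part_congr {S T : Set M} {f : AddMonoidAlgebra ℂ M}
    (h : ∀ m, f.coeff m ≠ 0 → (m ∈ S ↔ m ∈ T)) : part S f = part T f := by
  ext m
  by_cases hm : f.coeff m = 0
  · simp [coeff_part, hm]
  · by_cases hS : m ∈ S
    · simp [coeff_part, hS, (h m hm).1 hS]
    · have hT : m ∉ T := fun h' => hS ((h m hm).2 h')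
      simp [coeff_part, hS, hT]

lemma part_eq_zero {S T : Set M} {f : AddMonoidAlgebra ℂ M} (h : f ∈ suppIn T)
    (hST : ∀ m ∈ T, m ∉ S) : part S f = 0 := by
  ext m
  by_contra h'
  obtain ⟨h1, h2⟩ := coeff_part_ne_zero.1 h'
  exact hST m (h m h2) h1

lemma part_mem_suppIn {S T : Set M} {f : AddMonoidAlgebra ℂ M} (h : f ∈ suppIn T) :
    part S f ∈ suppIn (T ∩ S) := fun m hm =>
  ⟨h m (coeff_part_ne_zero.1 hm).2, (coeff_part_ne_zero.1 hm).1⟩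

lemma sub_part_mem_suppIn {S T : Set M} {f : AddMonoidAlgebra ℂ M} (h : f ∈ suppIn T) :
    f - part S f ∈ suppIn (T \ S) := by
  classical
  intro m hm
  rw [AddMonoidAlgebra.coeff_sub, Finsupp.sub_apply, coeff_part] at hm
  split_ifs at hm with hS
  · simp at hm
  · exact ⟨h m (by simpa using hm), hS⟩

lemma mem_suppIn_univ (f : AddMonoidAlgebra ℂ M) : f ∈ suppIn Set.univ := fun _ _ => trivial

lemma eq_sum_single (f : AddMonoidAlgebra ℂ M) :
    f = ∑ m ∈ f.coeff.support, AddMonoidAlgebra.single m (f.coeff m) := by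
  ext a
  conv_lhs => rw [← f.coeff.sum_single]
  simp [Finsupp.sum, AddMonoidAlgebra.coeff_sum]

variable [AddCommGroup M]

lemma exists_add_of_coeff_mul_ne_zero {f g : AddMonoidAlgebra ℂ M} {m : M}
    (h : (f * g).coeff m ≠ 0) : ∃ a b, f.coeff a ≠ 0 ∧ g.coeff b ≠ 0 ∧ a + b = m := by
  classical
  have := AddMonoidAlgebra.support_coeff_mul_subset f g (Finsupp.mem_support_iff.2 h)
  obtain ⟨a, ha, b, hb, hab⟩ := Finset.mem_add.1 this
  exact ⟨a, b, Finsupp.mem_support_iff.1 ha, Finsupp.mem_support_iff.1 hb, hab⟩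

lemma mul_mem_suppIn {S T W : Set M} {f g : AddMonoidAlgebra ℂ M} (hf : f ∈ suppIn S)
    (hg : g ∈ suppIn T) (h : ∀ a ∈ S, ∀ b ∈ T, a + b ∈ W) : f * g ∈ suppIn W := by
  intro m hm
  obtain ⟨a, b, ha, hb, rfl⟩ := exists_add_of_coeff_mul_ne_zero hm
  exact h a (hf a ha) b (hg b hb)

lemma coeff_single_mul (m a : M) (c : ℂ) (f : AddMonoidAlgebra ℂ M) :
    (AddMonoidAlgebra.single m c * f).coeff a = c * f.coeff (a - m) := by
  rw [AddMonoidAlgebra.coeff_single_mul_apply, neg_add_eq_sub]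

/-- Translation by exponents in `P` preserves `S` and its complement, so multiplication by `g` does
not mix the two parts of `c`. -/
lemma part_mul {S P : Set M} {c g : AddMonoidAlgebra ℂ M} (hg : g ∈ suppIn P)
    (hS : ∀ m, ∀ p ∈ P, m + p ∈ S ↔ m ∈ S) : part S (c * g) = part S c * g := by
  have h1 : part S (part S c * g) = part S c * g :=
    part_eq_self (mul_mem_suppIn (part_mem_suppIn (mem_suppIn_univ c)) hg
      fun a ha b hb => (hS a b hb).2 ha.2)
  have h2 : part S ((c - part S c) * g) = 0 :=
    part_eq_zero (T := Sᶜ) (mul_mem_suppIn (sub_part_mem_suppIn (mem_suppIn_univ c)) hg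
      fun a ha b hb h => ha.2 ((hS a b hb).1 h)) fun _ h => h
  calc part S (c * g) = part S (part S c * g + (c - part S c) * g) := by ring_nf
    _ = part S c * g := by rw [map_add, h1, h2, add_zero]

/-! ### Initial forms -/

lemma initialForm_eq_part {w : M →+ ℝ} {f : AddMonoidAlgebra ℂ M} {m₀ : M}
    (h0 : f.coeff m₀ ≠ 0) (h : ∀ m, f.coeff m ≠ 0 → w m₀ ≤ w m) :
    initialForm w f = part {m | w m = w m₀} f := by
  classical
  ext m
  rw [coeff_part, initialForm, AddMonoidAlgebra.coeff_ofCoeff, Finsupp.filter_apply]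
  by_cases hm : f.coeff m = 0
  · simp [hm]
  · refine if_congr ⟨fun H => le_antisymm (H m₀ (by simpa using h0)) (h m hm), fun H m' hm' => ?_⟩
      rfl rfl
    rw [show w m = w m₀ from H]
    exact h m' (by simpa using hm')

lemma exists_initialForm_eq_part (w : M →+ ℝ) {f : AddMonoidAlgebra ℂ M} (hf : f ≠ 0) :
    ∃ m₀, f.coeff m₀ ≠ 0 ∧ (∀ m, f.coeff m ≠ 0 → w m₀ ≤ w m) ∧
      initialForm w f = part {m | w m = w m₀} f := by
  have hne : f.coeff.support.Nonempty := by
    rw [Finsupp.support_nonempty_iff]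
    exact fun h => hf (AddMonoidAlgebra.coeff_eq_zero.1 h)
  obtain ⟨m₀, hm₀, h⟩ := Finset.exists_min_image _ w hne
  have h0 : f.coeff m₀ ≠ 0 := by simpa using hm₀
  have h1 : ∀ m, f.coeff m ≠ 0 → w m₀ ≤ w m := fun m hm => h m (by simpa using hm)
  exact ⟨m₀, h0, h1, initialForm_eq_part h0 h1⟩

/-- If all the weights of the exponents of `f` are at least `c`, then the sum of the terms of weight
`c` is either zero or the initial form. -/
lemma part_level_eq {w : M →+ ℝ} {f : AddMonoidAlgebra ℂ M} {c : ℝ}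
    (h : ∀ m, f.coeff m ≠ 0 → c ≤ w m) :
    part {m | w m = c} f = 0 ∨ part {m | w m = c} f = initialForm w f := by
  by_cases hc : ∃ m, f.coeff m ≠ 0 ∧ w m = c
  · obtain ⟨m, hm, rfl⟩ := hc
    exact Or.inr (initialForm_eq_part hm h).symm
  · push Not at hc
    exact Or.inl (part_eq_zero (T := {m | f.coeff m ≠ 0}) (fun m hm => hm) hc)

lemma part_level_mem_initialIdeal {w : M →+ ℝ} {I : Ideal (AddMonoidAlgebra ℂ M)}
    {f : AddMonoidAlgebra ℂ M} (hf : f ∈ I) {c : ℝ} (h : ∀ m, f.coeff m ≠ 0 → c ≤ w m) :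
    part {m | w m = c} f ∈ initialIdeal w I := by
  rcases part_level_eq h with h | h
  · rw [h]
    exact zero_mem _
  · rw [h]
    exact Ideal.subset_span ⟨f, hf, rfl⟩

lemma initialForm_zero (w : M →+ ℝ) : initialForm w (0 : AddMonoidAlgebra ℂ M) = 0 := by
  ext; simp [initialForm]

end Support

/-! ### Finite universal bases

An ideal `I` of `ℂ[M]` has a finite subset whose initial forms generate `in_w I` for all the weights
`w` simultaneously. -/

section Orders

variable {M : Type} [AddCommGroup M]

/-- `p` is the indicator function of the set of positive elements of a total group order. -/
structure IsPositiveCone (p : M → Bool) : Prop where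
  not_zero : p 0 = false
  add : ∀ a b, p a = true → p b = true → p (a + b) = true
  total : ∀ a, a = 0 ∨ p a = true ∨ p (-a) = true

/-- `m` is the smallest exponent of `f` for the order with positive cone `p`. -/
def IsLeading (p : M → Bool) (f : AddMonoidAlgebra ℂ M) (m : M) : Prop :=
  f.coeff m ≠ 0 ∧ ∀ m', f.coeff m' ≠ 0 → m' = m ∨ p (m' - m) = true

/-- Each axiom involves finitely many coordinates, so it is a closed condition in a product of
two-point spaces, which is compact by Tychonoff. -/
lemma isCompact_isPositiveCone : IsCompact {p : M → Bool | IsPositiveCone p} := by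
  have h : {p : M → Bool | IsPositiveCone p} =
      {p | p 0 = false} ∩ (⋂ a, ⋂ b, {p | p a = true → p b = true → p (a + b) = true}) ∩
        ⋂ a, {p | a = 0 ∨ p a = true ∨ p (-a) = true} := by
    ext p
    simp only [Set.mem_inter_iff, Set.mem_iInter, Set.mem_ofPred_eq]
    exact ⟨fun h => ⟨⟨h.1, h.2⟩, h.3⟩, fun h => ⟨h.1.1, h.1.2, h.2⟩⟩
  rw [h]
  refine IsClosed.isCompact (IsClosed.inter (IsClosed.inter ?_ ?_) ?_)
  · exact (isClosed_discrete {b : Bool | b = false}).preimage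
      (f := fun p : M → Bool => p 0) (by fun_prop)
  · refine isClosed_iInter fun a => isClosed_iInter fun b => ?_
    exact (isClosed_discrete
      {x : Bool × Bool × Bool | x.1 = true → x.2.1 = true → x.2.2 = true}).preimage
      (f := fun p : M → Bool => (p a, p b, p (a + b))) (by fun_prop)
  · refine isClosed_iInter fun a => ?_
    exact (isClosed_discrete {x : Bool × Bool | a = 0 ∨ x.1 = true ∨ x.2 = true}).preimage
      (f := fun p : M → Bool => (p a, p (-a))) (by fun_prop)

lemma IsPositiveCone.asymm {p : M → Bool} (hp : IsPositiveCone p) {a b : M}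
    (h : p (a - b) = true) (h' : p (b - a) = true) : False := by
  have := hp.add _ _ h h'
  rw [sub_add_sub_cancel, sub_self, hp.not_zero] at this
  exact Bool.false_ne_true this

lemma IsPositiveCone.trans {p : M → Bool} (hp : IsPositiveCone p) {a b c : M}
    (h : p (a - b) = true) (h' : p (b - c) = true) : p (a - c) = true := by
  rw [← sub_add_sub_cancel a b c]
  exact hp.add _ _ h h'

lemma IsPositiveCone.exists_min {p : M → Bool} (hp : IsPositiveCone p) {s : Finset M}
    (hs : s.Nonempty) : ∃ m ∈ s, ∀ m' ∈ s, m' = m ∨ p (m' - m) = true := by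
  classical
  induction hs using Finset.Nonempty.cons_induction with
  | singleton a => exact ⟨a, by simp, by simp⟩
  | cons a s ha hs ih =>
    obtain ⟨m, hm, h⟩ := ih
    rcases hp.total (a - m) with h0 | h0 | h0
    · exact absurd (sub_eq_zero.1 h0 ▸ hm) ha
    · refine ⟨m, by simp [hm], fun m' hm' => ?_⟩
      rcases Finset.mem_cons.1 hm' with rfl | hm'
      · exact Or.inr h0
      · exact h m' hm'
    · rw [neg_sub] at h0
      refine ⟨a, by simp, fun m' hm' => ?_⟩
      rcases Finset.mem_cons.1 hm' with rfl | hm'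
      · exact Or.inl rfl
      · rcases h m' hm' with rfl | h1
        · exact Or.inr h0
        · exact Or.inr (hp.trans h1 h0)

lemma IsPositiveCone.exists_isLeading {p : M → Bool} (hp : IsPositiveCone p)
    {f : AddMonoidAlgebra ℂ M} (hf : f ≠ 0) : ∃ m, IsLeading p f m := by
  have hne : f.coeff.support.Nonempty := by
    rw [Finsupp.support_nonempty_iff]
    exact fun h => hf (AddMonoidAlgebra.coeff_eq_zero.1 h)
  obtain ⟨m, hm, h⟩ := hp.exists_min hne
  exact ⟨m, by simpa using hm, fun m' hm' => h m' (by simpa using hm')⟩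

lemma IsLeading.single_mul {p : M → Bool} {f : AddMonoidAlgebra ℂ M} {m : M}
    (h : IsLeading p f m) (a : M) {c : ℂ} (hc : c ≠ 0) :
    IsLeading p (AddMonoidAlgebra.single a c * f) (a + m) := by
  refine ⟨by simpa [hc] using h.1, fun m' hm' => ?_⟩
  rw [coeff_single_mul] at hm'
  rcases h.2 (m' - a) (right_ne_zero_of_mul hm') with h1 | h1
  · exact Or.inl (by rw [← h1, add_sub_cancel])
  · exact Or.inr (by rwa [← sub_sub])

/-- The smallest exponents of the non-zero elements of a subspace. -/
def leadingSet (p : M → Bool) (V : Submodule ℂ (AddMonoidAlgebra ℂ M)) : Set M :=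
  {m | ∃ f ∈ V, IsLeading p f m}

lemma leadingSet_subset {p : M → Bool} {V : Submodule ℂ (AddMonoidAlgebra ℂ M)} {S : Set M}
    (hV : V ≤ suppIn S) : leadingSet p V ⊆ S := by
  rintro m ⟨f, hf, h⟩
  exact hV hf m h.1

/-- Two orders for which the smallest exponents of the elements of a finite-dimensional space are
comparable have the same smallest exponents: their number is the dimension. -/
lemma leadingSet_eq_of_subset {p p' : M → Bool} (hp : IsPositiveCone p) (hp' : IsPositiveCone p')
    {V : Submodule ℂ (AddMonoidAlgebra ℂ M)} {S : Set M} (hS : S.Finite) (hV : V ≤ suppIn S)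
    (h : leadingSet p V ⊆ leadingSet p' V) : leadingSet p V = leadingSet p' V := by
  classical
  have hfin : (leadingSet p V).Finite := hS.subset (leadingSet_subset hV)
  have hfin' : (leadingSet p' V).Finite := hS.subset (leadingSet_subset hV)
  have : Fintype (leadingSet p V) := hfin.fintype
  have : Fintype (leadingSet p' V) := hfin'.fintype
  -- A nonzero element of `V` has a nonzero coefficient at its own leading exponent, so `φ` is
  -- injective and dim `V` is at most the number of leading exponents for `p`.
  let φ : V →ₗ[ℂ] (leadingSet p V → ℂ) :=
    { toFun := fun f m => f.1.coeff m.1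
      map_add' := fun f g => by ext; simp
      map_smul' := fun c f => by ext; simp }
  have hφ : Function.Injective φ := by
    rw [← LinearMap.ker_eq_bot, LinearMap.ker_eq_bot']
    intro f hf
    by_contra hne
    obtain ⟨m, hm⟩ := hp.exists_isLeading (f := f.1) (fun h => hne (Subtype.ext h))
    exact hm.1 (congrFun hf ⟨m, f.1, f.2, hm⟩)
  have hfd : FiniteDimensional ℂ V := FiniteDimensional.of_injective φ hφ
  choose F hFV hF using fun m : leadingSet p' V => m.2
  -- Conversely, elements with distinct leading exponents for `p'` are independent: in a relation,
  -- the smallest leading exponent that occurs with nonzero coefficient cannot be cancelled.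
  have hli : LinearIndependent ℂ fun m => (⟨F m, hFV m⟩ : V) := by
    rw [Fintype.linearIndependent_iff]
    intro c hc
    by_contra! hne
    obtain ⟨m₁, hm₁⟩ := hne
    obtain ⟨m, hm, hmin⟩ := hp'.exists_min
      (s := (Finset.univ.filter fun m => c m ≠ 0).image Subtype.val) ⟨m₁.1, by simpa using hm₁⟩
    obtain ⟨m, hm', rfl⟩ := Finset.mem_image.1 hm
    have h0 := congrArg (fun f : V => f.1.coeff m.1) hc
    simp only [Submodule.coe_sum, Submodule.coe_smul, AddMonoidAlgebra.coeff_sum,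
      Finsupp.finsetSum_apply, AddMonoidAlgebra.coeff_smul, Finsupp.smul_apply,
      ZeroMemClass.coe_zero, AddMonoidAlgebra.coeff_zero, Finsupp.coe_zero, Pi.zero_apply] at h0
    rw [Finset.sum_eq_single m] at h0
    · simp only [Finset.mem_filter, Finset.mem_univ, true_and] at hm'
      exact (smul_ne_zero hm' (hF m).1) h0
    · intro k _ hk
      by_contra hne
      have hck : c k ≠ 0 := left_ne_zero_of_smul hne
      rcases hmin k.1 (Finset.mem_image.2 ⟨k, by simpa using hck, rfl⟩) with h1 | h1
      · exact hk (Subtype.ext h1)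
      · rcases (hF k).2 m.1 (right_ne_zero_of_smul hne) with h2 | h2
        · exact hk (Subtype.ext h2.symm)
        · exact hp'.asymm h1 h2
    · simp
  have h1 : Fintype.card (leadingSet p' V) ≤ Module.finrank ℂ V := hli.fintype_card_le_finrank
  have h2 : Module.finrank ℂ V ≤ Fintype.card (leadingSet p V) := by
    simpa using LinearMap.finrank_le_finrank_of_injective hφ
  refine Set.eq_of_subset_of_ncard_le h ?_ hfin'
  rw [Set.ncard_eq_toFinset_card', Set.ncard_eq_toFinset_card', Set.toFinset_card,
    Set.toFinset_card]
  exact h1.trans h2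

end Orders

/-! ### Degree-bounded subspaces, division, and the universal basis -/

section UniversalBasis

variable {M : Type} [AddCommGroup M] {ι : Type} [Fintype ι]

/-- The sum of the generators `e i`, each taken `a i` times. -/
def combination (e : ι → M) (a : ι → ℕ) : M := ∑ i, a i • e i

lemma combination_add (e : ι → M) (a b : ι → ℕ) :
    combination e (a + b) = combination e a + combination e b := by
  simp [combination, add_smul, Finset.sum_add_distrib]

/-- The sums of `d` of the generators `e i`. -/
def sumsOf (e : ι → M) (d : ℕ) : Set M := {m | ∃ a : ι → ℕ, ∑ i, a i = d ∧ combination e a = m}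

lemma sumsOf_finite (e : ι → M) (d : ℕ) : (sumsOf e d).Finite := by
  classical
  have : ((Set.Iic (fun _ : ι => d)).image (combination e)).Finite := (Set.finite_Iic _).image _
  refine this.subset ?_
  rintro _ ⟨a, rfl, rfl⟩
  exact ⟨a, fun i => Finset.single_le_sum (fun _ _ => Nat.zero_le _) (Finset.mem_univ i), rfl⟩

lemma add_mem_sumsOf {e : ι → M} {d d' : ℕ} {m m' : M} (h : m ∈ sumsOf e d)
    (h' : m' ∈ sumsOf e d') : m + m' ∈ sumsOf e (d + d') := by
  obtain ⟨a, rfl, rfl⟩ := h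
  obtain ⟨b, rfl, rfl⟩ := h'
  exact ⟨a + b, by simp [Finset.sum_add_distrib], combination_add e a b⟩

/-- The elements of `I` whose exponents are sums of `d` of the generators `e i`. -/
def bounded (e : ι → M) (I : Ideal (AddMonoidAlgebra ℂ M)) (d : ℕ) :
    Submodule ℂ (AddMonoidAlgebra ℂ M) := suppIn (sumsOf e d) ⊓ I.restrictScalars ℂ

lemma single_mul_mem_bounded {e : ι → M} {I : Ideal (AddMonoidAlgebra ℂ M)} {d d' : ℕ}
    {f : AddMonoidAlgebra ℂ M} (hf : f ∈ bounded e I d) {m : M} (hm : m ∈ sumsOf e d') (c : ℂ) :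
    AddMonoidAlgebra.single m c * f ∈ bounded e I (d' + d) :=
  ⟨mul_mem_suppIn (single_mem_suppIn hm c) hf.1 fun _ h _ h' => add_mem_sumsOf h h',
    I.mul_mem_left _ hf.2⟩

/-- `G` consists of elements of `I` whose smallest exponents for the order `p` generate all the
smallest exponents of elements of `I`, compatibly with the degrees. -/
def IsOrderBasis (e : ι → M) (I : Ideal (AddMonoidAlgebra ℂ M)) (p : M → Bool)
    (G : Set (AddMonoidAlgebra ℂ M)) : Prop :=
  ∀ d, ∀ m ∈ leadingSet p (bounded e I d), ∃ f ∈ G, ∃ d₁ d₂ m₁ m₂, f ∈ bounded e I d₁ ∧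
    IsLeading p f m₁ ∧ m₂ ∈ sumsOf e d₂ ∧ d₂ + d₁ = d ∧ m₂ + m₁ = m

lemma IsOrderBasis.mono {e : ι → M} {I : Ideal (AddMonoidAlgebra ℂ M)} {p : M → Bool}
    {G G' : Set (AddMonoidAlgebra ℂ M)} (h : IsOrderBasis e I p G) (hG : G ⊆ G') :
    IsOrderBasis e I p G' := by
  intro d m hm
  obtain ⟨f, hf, h⟩ := h d m hm
  exact ⟨f, hG hf, h⟩

/-- Dickson's lemma in ℕ^ι: the minimal vectors representing leading exponents form an antichain,
hence are finitely many. A vector also records its degree, as the sum of its entries, so subtracting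
a minimal vector respects degrees. -/
lemma exists_finset_isOrderBasis (e : ι → M) (I : Ideal (AddMonoidAlgebra ℂ M)) (p : M → Bool) :
    ∃ G : Finset (AddMonoidAlgebra ℂ M), (G : Set (AddMonoidAlgebra ℂ M)) ⊆ I ∧
      IsOrderBasis e I p G := by
  classical
  let L : Set (ι → ℕ) := {a | combination e a ∈ leadingSet p (bounded e I (∑ i, a i))}
  have hfin : {a | Minimal (· ∈ L) a}.Finite :=
    (setOfPred_minimal_antichain _).finite_of_partiallyWellOrderedOn
      (Set.isPWO_of_wellQuasiOrderedLE _)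
  have hex : ∀ a : {a | Minimal (· ∈ L) a}, ∃ f ∈ bounded e I (∑ i, a.1 i),
      IsLeading p f (combination e a.1) := fun a => a.2.1
  choose F hFV hF using hex
  have : Fintype {a | Minimal (· ∈ L) a} := hfin.fintype
  refine ⟨Finset.univ.image F, ?_, ?_⟩
  · intro f hf
    obtain ⟨a, -, rfl⟩ := Finset.mem_image.1 (Finset.mem_coe.1 hf)
    exact (hFV a).2
  · rintro d m ⟨f, hf, hm⟩
    obtain ⟨a, rfl, rfl⟩ := hf.1 m hm.1
    have haL : a ∈ L := ⟨f, hf, hm⟩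
    obtain ⟨b, hba, hb⟩ := exists_minimal_le_of_wellFoundedLT (· ∈ L) a haL
    refine ⟨F ⟨b, hb⟩, by simp, ∑ i, b i, ∑ i, (a - b) i, _, combination e (a - b), hFV ⟨b, hb⟩,
      hF ⟨b, hb⟩, ⟨_, rfl, rfl⟩, ?_, ?_⟩
    · rw [← Finset.sum_add_distrib]
      exact Finset.sum_congr rfl fun i _ => Nat.sub_add_cancel (hba i)
    · rw [← combination_add, tsub_add_cancel_of_le hba]

/-- Elements of `G` keep their leading exponents, so their monomial multiples show that every
leading exponent for `p` is one for `p'`. In each degree the spaces are finite-dimensional, so the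
inclusion is an equality by `leadingSet_eq_of_subset`. -/
lemma IsOrderBasis.of_agree {e : ι → M} {I : Ideal (AddMonoidAlgebra ℂ M)} {p p' : M → Bool}
    (hp : IsPositiveCone p) (hp' : IsPositiveCone p') {G : Set (AddMonoidAlgebra ℂ M)}
    (h : IsOrderBasis e I p G) (hG : ∀ f ∈ G, ∀ m m', f.coeff m ≠ 0 → f.coeff m' ≠ 0 →
      p (m' - m) = p' (m' - m)) : IsOrderBasis e I p' G := by
  have hlead : ∀ f ∈ G, ∀ m, IsLeading p f m → IsLeading p' f m := fun f hf m hm =>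
    ⟨hm.1, fun m' hm' => (hm.2 m' hm').imp_right fun h => by rw [← hG f hf m m' hm.1 hm', h]⟩
  have hsub : ∀ d, leadingSet p (bounded e I d) ⊆ leadingSet p' (bounded e I d) := by
    intro d m hm
    obtain ⟨f, hf, d₁, d₂, m₁, m₂, h1, h2, h3, rfl, rfl⟩ := h d m hm
    exact ⟨_, single_mul_mem_bounded h1 h3 1, (hlead f hf _ h2).single_mul _ one_ne_zero⟩
  intro d m hm
  rw [← leadingSet_eq_of_subset hp hp' (sumsOf_finite e d)
    (V := bounded e I d) inf_le_left (hsub d)] at hm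
  obtain ⟨f, hf, d₁, d₂, m₁, m₂, h1, h2, h3⟩ := h d m hm
  exact ⟨f, hf, d₁, d₂, m₁, m₂, h1, hlead f hf _ h2, h3⟩

/-- To agree with `p` on the differences of exponents of the finite set `G p` is an open condition.
Compactness leaves finitely many `p` to consider, and the union of their bases serves all orders. -/
lemma exists_finset_forall_isOrderBasis (e : ι → M) (I : Ideal (AddMonoidAlgebra ℂ M)) :
    ∃ U : Finset (AddMonoidAlgebra ℂ M), (U : Set (AddMonoidAlgebra ℂ M)) ⊆ I ∧
      ∀ p, IsPositiveCone p → IsOrderBasis e I p U := by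
  classical
  choose G hGI hG using exists_finset_isOrderBasis e I
  let N : (M → Bool) → Set (M → Bool) := fun p =>
    ⋂ f ∈ G p, ⋂ m ∈ f.coeff.support, ⋂ m' ∈ f.coeff.support, {p' | p (m' - m) = p' (m' - m)}
  have hN : ∀ p, N p ∈ nhds p := by
    intro p
    refine (Filter.biInter_finset_mem _).2 fun f _ => (Filter.biInter_finset_mem _).2 fun m _ =>
      (Filter.biInter_finset_mem _).2 fun m' _ => ?_
    exact ((isOpen_discrete {b | p (m' - m) = b}).preimage
      (continuous_apply (m' - m))).mem_nhds rfl
  obtain ⟨t, ht, hcov⟩ := isCompact_isPositiveCone.elim_nhds_subcover N fun p _ => hN p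
  refine ⟨t.biUnion G, ?_, fun p' hp' => ?_⟩
  · intro f hf
    obtain ⟨p, -, hf⟩ := Finset.mem_biUnion.1 (Finset.mem_coe.1 hf)
    exact hGI p hf
  · obtain ⟨p, hpt, hp⟩ := Set.mem_iUnion₂.1 (hcov hp')
    refine ((hG p).of_agree (ht p hpt) hp' fun f hf m m' hm hm' => ?_).mono ?_
    · simp only [N, Set.mem_iInter] at hp
      exact hp f hf m (by simpa using hm) m' (by simpa using hm')
    · intro f hf
      exact Finset.mem_coe.2 (Finset.mem_biUnion.2 ⟨p, hpt, hf⟩)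

/-- Division with respect to an order that refines a weight. -/
lemma IsOrderBasis.initialForm_mem {e : ι → M} {I : Ideal (AddMonoidAlgebra ℂ M)} {p : M → Bool}
    (hp : IsPositiveCone p) {G : Set (AddMonoidAlgebra ℂ M)} (hG : IsOrderBasis e I p G)
    {w : M →+ ℝ} (hw : ∀ m, p m = true → 0 ≤ w m) {d : ℕ} {f : AddMonoidAlgebra ℂ M}
    (hf : f ∈ bounded e I d) : initialForm w f ∈ Ideal.span (initialForm w '' G) := by
  classical
  -- The order is not a well-order on `M`, so termination of the division comes from the degree
  -- bound: `T f` is the finite set of exponents of degree `d` not below the leading one, and it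
  -- shrinks at each step.
  let T : AddMonoidAlgebra ℂ M → Set M := fun f =>
    {m | m ∈ sumsOf e d ∧ ∃ m₀, IsLeading p f m₀ ∧ (m = m₀ ∨ p (m - m₀) = true)}
  have hTfin : ∀ f, (T f).Finite := fun f => (sumsOf_finite e d).subset fun m hm => hm.1
  induction hn : (T f).ncard using Nat.strong_induction_on generalizing f with
  | _ n ih =>
    subst hn
    by_cases hf0 : f = 0
    · rw [hf0, initialForm_zero]
      exact zero_mem _
    obtain ⟨m₀, hm₀⟩ := hp.exists_isLeading hf0
    obtain ⟨g, hg, d₁, d₂, m₁, m₂, h1, h2, h3, hd, hm⟩ := hG d m₀ ⟨f, hf, hm₀⟩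
    have hle : ∀ {h : AddMonoidAlgebra ℂ M} {a : M}, IsLeading p h a →
        ∀ m, h.coeff m ≠ 0 → w a ≤ w m := by
      intro h a ha m hm
      rcases ha.2 m hm with rfl | h'
      · exact le_rfl
      · have := hw _ h'
        rw [map_sub] at this
        linarith
    set c : ℂ := f.coeff m₀ / g.coeff m₁ with hc
    have hc0 : c ≠ 0 := div_ne_zero hm₀.1 h2.1
    set g' := AddMonoidAlgebra.single m₂ c * g with hg'
    have hg'lead : IsLeading p g' m₀ := hm ▸ h2.single_mul m₂ hc0
    have hg'V : g' ∈ bounded e I d := hd ▸ single_mul_mem_bounded h1 h3 c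
    have hf'V : f - g' ∈ bounded e I d := sub_mem hf hg'V
    have hcoeff : (f - g').coeff m₀ = 0 := by
      rw [AddMonoidAlgebra.coeff_sub, Finsupp.sub_apply, hg', coeff_single_mul, ← hm,
        add_sub_cancel_left, hm, hc, div_mul_cancel₀ _ h2.1, sub_self]
    have hsupp : ∀ m, (f - g').coeff m ≠ 0 → p (m - m₀) = true := by
      intro m hm
      have hne : m ≠ m₀ := fun h => hm (h ▸ hcoeff)
      by_cases h : f.coeff m = 0
      · refine (hg'lead.2 m fun h' => hm ?_).resolve_left hne
        simp [h, h']
      · exact (hm₀.2 m h).resolve_left hne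
    have hwf' : ∀ m, (f - g').coeff m ≠ 0 → w m₀ ≤ w m := fun m hm => by
      have := hw _ (hsupp m hm)
      rw [map_sub] at this
      linarith
    have hlt : (T (f - g')).ncard < (T f).ncard := by
      refine Set.ncard_lt_ncard ⟨?_, ?_⟩ (hTfin f)
      · rintro m ⟨hm, a, ha, h⟩
        have ha' := hsupp a ha.1
        refine ⟨hm, m₀, hm₀, Or.inr ?_⟩
        rcases h with rfl | h
        · exact ha'
        · exact hp.trans h ha'
      · intro hsub
        obtain ⟨-, a, ha, h⟩ := hsub ⟨hf.1 m₀ hm₀.1, m₀, hm₀, Or.inl rfl⟩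
        have ha' := hsupp a ha.1
        rcases h with rfl | h
        · exact ha.1 hcoeff
        · exact hp.asymm ha' h
    have hgpart : part {m | w m = w m₀} g' = AddMonoidAlgebra.single m₂ c * initialForm w g := by
      rw [initialForm_eq_part h2.1 (hle h2)]
      ext m
      simp only [hg', coeff_single_mul, coeff_part, Set.mem_ofPred_eq, map_sub, mul_ite, mul_zero,
        ← hm, map_add]
      refine if_congr ⟨fun h => by linarith, fun h => by linarith⟩ rfl rfl
    have hdecomp : initialForm w f =
        part {m | w m = w m₀} (f - g') + AddMonoidAlgebra.single m₂ c * initialForm w g := by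
      rw [initialForm_eq_part hm₀.1 (hle hm₀), ← hgpart, ← map_add, sub_add_cancel]
    rw [hdecomp]
    refine add_mem ?_ (Ideal.mul_mem_left _ _ (Ideal.subset_span ⟨g, hg, rfl⟩))
    -- The remainder may have larger `w`-order, in which case it contributes nothing; otherwise its
    -- contribution is its own initial form and the induction applies.
    rcases part_level_eq hwf' with h | h
    · rw [h]
      exact zero_mem _
    · rw [h]
      exact ih _ hlt hf'V rfl

/-- The extra generator `0`, with index `none`, makes the sets `sumsOf e d` increase with `d`, so a
finite set of exponents fits in a single degree. -/
lemma exists_generators (M : Type) [AddCommGroup M] [Module.Finite ℤ M] :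
    ∃ (ι : Type) (_ : Fintype ι) (e : ι → M), ∀ f : AddMonoidAlgebra ℂ M,
      ∃ d, f ∈ suppIn (sumsOf e d) := by
  classical
  have hfg : AddMonoid.FG M := AddGroup.fg_iff_addMonoid_fg.1 (Module.Finite.iff_addGroup_fg.1 ‹_›)
  obtain ⟨S, hS⟩ := AddMonoid.fg_def.1 hfg
  let e : Option S → M := fun i => i.elim 0 Subtype.val
  have h0 : (0 : M) ∈ sumsOf e 1 := ⟨Pi.single none 1, by simp [Finset.sum_pi_single'], by
    simp [combination, Pi.single_apply, e]⟩
  have hmono : ∀ {d d' : ℕ}, d ≤ d' → sumsOf e d ⊆ sumsOf e d' := by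
    intro d d' h
    induction h with
    | refl => exact subset_rfl
    | step _ ih => exact fun m hm => by simpa using add_mem_sumsOf (ih hm) h0
  have hmem : ∀ m : M, ∃ d, m ∈ sumsOf e d := by
    intro m
    have hm : m ∈ AddSubmonoid.closure (S : Set M) := hS ▸ AddSubmonoid.mem_top m
    induction hm using AddSubmonoid.closure_induction with
    | mem x hx =>
      exact ⟨1, Pi.single (some ⟨x, hx⟩) 1, by simp [Finset.sum_pi_single'], by
        simp [combination, Pi.single_apply, e]⟩
    | zero => exact ⟨1, h0⟩
    | add x y _ _ hx hy =>
      obtain ⟨d, hd⟩ := hx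
      obtain ⟨d', hd'⟩ := hy
      exact ⟨_, add_mem_sumsOf hd hd'⟩
  choose D hD using hmem
  refine ⟨Option S, inferInstance, e, fun f => ⟨∑ m ∈ f.coeff.support, D m, fun m hm => ?_⟩⟩
  exact hmono (Finset.single_le_sum (fun _ _ => Nat.zero_le _) (by simpa using hm)) (hD m)

/-- For finitely many lattice vectors there is a combination with positive coefficients that
vanishes only where all the vectors do. -/
lemma exists_generic_combination (s : Finset (M →+ ℤ)) : ∃ c : (M →+ ℤ) → ℝ, (∀ n, 0 < c n) ∧
    ∀ m, ∑ n ∈ s, c n * n m = 0 → ∀ n ∈ s, n m = 0 := by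
  -- Distinct powers of a positive transcendental number serve as coefficients: an integral linear
  -- relation between them is a polynomial relation, hence trivial.
  obtain ⟨x, hx0, hx⟩ : ∃ x : ℝ, 0 < x ∧ Transcendental ℤ x := by
    refine ⟨|liouvilleNumber (2 : ℕ)|, ?_, ?_⟩
    · rw [abs_pos]
      exact fun h => transcendental_liouvilleNumber (m := 2) le_rfl (h ▸ isAlgebraic_zero)
    · rcases abs_choice (liouvilleNumber (2 : ℕ)) with h | h <;> rw [h]
      · exact transcendental_liouvilleNumber le_rfl
      · exact fun h => transcendental_liouvilleNumber (m := 2) le_rfl (by simpa using h.neg)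
  obtain ⟨idx, hidx⟩ := Set.countable_iff_exists_injOn.1 s.countable_toSet
  refine ⟨fun n => x ^ idx n, fun n => pow_pos hx0 _, fun m hm n hn => ?_⟩
  have hpoly : (∑ n ∈ s, Polynomial.monomial (idx n) (n m) : Polynomial ℤ) = 0 := by
    by_contra hne
    refine hx ⟨_, hne, ?_⟩
    rw [map_sum, ← hm]
    refine Finset.sum_congr rfl fun n _ => ?_
    rw [Polynomial.aeval_monomial, mul_comm]
    simp
  have := congrArg (fun q => Polynomial.coeff q (idx n)) hpoly
  simp only [Polynomial.finsetSum_coeff, Polynomial.coeff_monomial, Polynomial.coeff_zero] at this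
  rw [Finset.sum_eq_single n] at this
  · simpa using this
  · intro k hk hkn
    rw [if_neg fun h => hkn (hidx hk hn h)]
  · exact fun h => absurd hn h

/-- A generic positive combination of the coordinate functions of a basis vanishes only where all of
them do. -/
lemma exists_injective_weight (M : Type) [AddCommGroup M] [Module.Free ℤ M] [Module.Finite ℤ M] :
    ∃ u : M →+ ℝ, Function.Injective u := by
  classical
  let b := Module.Free.chooseBasis ℤ M
  let s : Finset (M →+ ℤ) := Finset.univ.image fun i => (b.coord i).toAddMonoidHom
  obtain ⟨c, -, hc⟩ := exists_generic_combination s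
  refine ⟨∑ n ∈ s, (AddMonoidHom.mulLeft (c n)).comp (latticeToReal n), ?_⟩
  rw [injective_iff_map_eq_zero]
  intro m hm
  have h := hc m (by simpa [latticeToReal] using hm)
  refine b.ext_elem fun i => ?_
  simpa using h _ (Finset.mem_image_of_mem _ (Finset.mem_univ i))

/-- Compare by `w` first and break ties by an injective weight. -/
lemma exists_isPositiveCone_of_weight [Module.Free ℤ M] [Module.Finite ℤ M] (w : M →+ ℝ) :
    ∃ p : M → Bool, IsPositiveCone p ∧ ∀ m, p m = true → 0 ≤ w m := by
  classical
  obtain ⟨u, hu⟩ := exists_injective_weight M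
  refine ⟨fun m => decide (0 < w m ∨ w m = 0 ∧ 0 < u m), ⟨by simp, ?_, ?_⟩, ?_⟩
  · intro a b ha hb
    simp only [decide_eq_true_eq, map_add] at ha hb ⊢
    rcases ha with ha | ⟨ha, ha'⟩ <;> rcases hb with hb | ⟨hb, hb'⟩
    · exact Or.inl (by linarith)
    · exact Or.inl (by linarith)
    · exact Or.inl (by linarith)
    · exact Or.inr ⟨by linarith, by linarith⟩
  · intro a
    simp only [decide_eq_true_eq, map_neg, Left.neg_pos_iff, neg_eq_zero]
    rcases lt_trichotomy (w a) 0 with h | h | h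
    · exact Or.inr (Or.inr (Or.inl h))
    · rcases lt_trichotomy (u a) 0 with h' | h' | h'
      · exact Or.inr (Or.inr (Or.inr ⟨h, h'⟩))
      · exact Or.inl (hu (by rw [h', map_zero]))
      · exact Or.inr (Or.inl (Or.inr ⟨h, h'⟩))
    · exact Or.inr (Or.inl (Or.inl h))
  · intro m hm
    simp only [decide_eq_true_eq] at hm
    rcases hm with h | h
    · exact h.le
    · exact h.1.ge

/-- A finite universal basis of an ideal of Laurent polynomials. -/
theorem exists_universal_basis [Module.Free ℤ M] [Module.Finite ℤ M]
    (I : Ideal (AddMonoidAlgebra ℂ M)) :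
    ∃ U : Finset (AddMonoidAlgebra ℂ M), (U : Set (AddMonoidAlgebra ℂ M)) ⊆ I ∧
      ∀ w : M →+ ℝ, initialIdeal w I =
        Ideal.span (initialForm w '' (U : Set (AddMonoidAlgebra ℂ M))) := by
  obtain ⟨κ, _, e, he⟩ := exists_generators M
  obtain ⟨U, hUI, hU⟩ := exists_finset_forall_isOrderBasis e I
  refine ⟨U, hUI, fun w => le_antisymm (Ideal.span_le.2 ?_) (Ideal.span_mono (Set.image_mono hUI))⟩
  rintro _ ⟨f, hf, rfl⟩
  obtain ⟨p, hp, hpw⟩ := exists_isPositiveCone_of_weight w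
  obtain ⟨d, hd⟩ := he f
  exact (hU p hp).initialForm_mem hp hpw (d := d) ⟨hd, hf⟩

end UniversalBasis

/-! ### Cutting a finitely generated cone by a hyperplane

Cones are represented by finite sets `s` of lattice vectors that generate them. -/

section Cut

variable {M : Type} [AddCommGroup M]

/-- The exponents that are non-negative on all the vectors of `s`. -/
def nonnegOn (s : Finset (M →+ ℤ)) : AddSubmonoid M where
  carrier := {m | ∀ n ∈ s, 0 ≤ n m}
  zero_mem' := by simp
  add_mem' := fun ha hb n hn => by
    rw [map_add]; exact add_nonneg (ha n hn) (hb n hn)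

/-- The exponents that vanish on all the vectors of `s`. -/
def zeroOn (s : Finset (M →+ ℤ)) : AddSubgroup M where
  carrier := {m | ∀ n ∈ s, n m = 0}
  zero_mem' := by simp
  add_mem' := fun ha hb n hn => by rw [map_add, ha n hn, hb n hn, add_zero]
  neg_mem' := fun ha n hn => by rw [map_neg, ha n hn, neg_zero]

/-- The exponents that are non-negative but not identically zero on `s`. -/
def posOn (s : Finset (M →+ ℤ)) : Set M := {m | m ∈ nonnegOn s ∧ m ∉ zeroOn s}

lemma mem_nonnegOn {s : Finset (M →+ ℤ)} {m : M} : m ∈ nonnegOn s ↔ ∀ n ∈ s, 0 ≤ n m := Iff.rfl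

lemma zeroOn_le_nonnegOn {s : Finset (M →+ ℤ)} {m : M} (h : m ∈ zeroOn s) : m ∈ nonnegOn s :=
  fun n hn => (h n hn).ge

/-- The sum of the generators is an interior lattice point of the cone. It grades `nonnegOn s` by
natural numbers, with `zeroOn s` in degree zero. -/
lemma sum_apply_eq_zero_iff {s : Finset (M →+ ℤ)} {m : M} (h : m ∈ nonnegOn s) :
    (∑ n ∈ s, n) m = 0 ↔ m ∈ zeroOn s := by
  rw [AddMonoidHom.finsetSum_apply, Finset.sum_eq_zero_iff_of_nonneg h]
  rfl

lemma sum_apply_nonneg {s : Finset (M →+ ℤ)} {m : M} (h : m ∈ nonnegOn s) :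
    0 ≤ (∑ n ∈ s, n) m := by
  rw [AddMonoidHom.finsetSum_apply]
  exact Finset.sum_nonneg h

lemma posOn_iff {s : Finset (M →+ ℤ)} {m : M} (h : m ∈ nonnegOn s) :
    m ∉ zeroOn s ↔ 0 < (∑ n ∈ s, n) m := by
  rw [← sum_apply_eq_zero_iff h]
  exact ⟨fun h' => lt_of_le_of_ne (sum_apply_nonneg h) (Ne.symm h'), fun h' => h'.ne'⟩

lemma add_mem_posOn {s : Finset (M →+ ℤ)} {a b : M} (ha : a ∈ nonnegOn s) (hb : b ∈ posOn s) :
    a + b ∈ posOn s := by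
  refine ⟨add_mem ha hb.1, ?_⟩
  rw [posOn_iff (add_mem ha hb.1), map_add]
  have := (posOn_iff hb.1).1 hb.2
  have := sum_apply_nonneg ha
  omega

open Classical in
/-- The vectors in the hyperplane `m₀ = 0` on the segments between vectors of `s` on its two
sides. -/
def crossings (s : Finset (M →+ ℤ)) (m₀ : M) : Finset (M →+ ℤ) :=
  ((s.filter fun n => 0 < n m₀) ×ˢ s.filter fun n => n m₀ < 0).image
    fun x => x.1 m₀ • x.2 - x.2 m₀ • x.1

open Classical in
/-- Generators of the part of the cone on which `m₀ ≥ 0`. -/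
def upperCut (s : Finset (M →+ ℤ)) (m₀ : M) : Finset (M →+ ℤ) :=
  s.filter (fun n => 0 ≤ n m₀) ∪ crossings s m₀

open Classical in
/-- Generators of the part of the cone on which `m₀ = 0`. -/
def middleCut (s : Finset (M →+ ℤ)) (m₀ : M) : Finset (M →+ ℤ) :=
  s.filter (fun n => n m₀ = 0) ∪ crossings s m₀

variable {s : Finset (M →+ ℤ)} {m₀ : M}

lemma mem_crossings {n : M →+ ℤ} : n ∈ crossings s m₀ ↔ ∃ a ∈ s, ∃ b ∈ s, 0 < a m₀ ∧ b m₀ < 0 ∧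
    a m₀ • b - b m₀ • a = n := by
  simp only [crossings, Finset.mem_image, Finset.mem_product, Finset.mem_filter, Prod.exists]
  constructor
  · rintro ⟨a, b, ⟨⟨h1, h2⟩, h3, h4⟩, h5⟩
    exact ⟨a, h1, b, h3, h2, h4, h5⟩
  · rintro ⟨a, h1, b, h3, h2, h4, h5⟩
    exact ⟨a, b, ⟨⟨h1, h2⟩, h3, h4⟩, h5⟩

lemma mem_upperCut {n : M →+ ℤ} :
    n ∈ upperCut s m₀ ↔ (n ∈ s ∧ 0 ≤ n m₀) ∨ n ∈ crossings s m₀ := by simp [upperCut]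

lemma mem_middleCut {n : M →+ ℤ} :
    n ∈ middleCut s m₀ ↔ (n ∈ s ∧ n m₀ = 0) ∨ n ∈ crossings s m₀ := by simp [middleCut]

lemma crossings_neg : crossings s (-m₀) = crossings s m₀ := by
  ext n
  simp only [mem_crossings, map_neg]
  constructor
  · rintro ⟨a, ha, b, hb, h1, h2, rfl⟩
    exact ⟨b, hb, a, ha, by omega, by omega, by rw [neg_smul, neg_smul]; abel⟩
  · rintro ⟨a, ha, b, hb, h1, h2, rfl⟩
    exact ⟨b, hb, a, ha, by omega, by omega, by rw [neg_smul, neg_smul]; abel⟩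

lemma middleCut_neg : middleCut s (-m₀) = middleCut s m₀ := by
  ext n
  simp [mem_middleCut, crossings_neg]

lemma crossings_apply_nonneg {m : M} (hm : m ∈ nonnegOn s) {n : M →+ ℤ} (hn : n ∈ crossings s m₀) :
    0 ≤ n m := by
  obtain ⟨a, ha, b, hb, h1, h2, rfl⟩ := mem_crossings.1 hn
  have := mul_nonneg h1.le (hm b hb)
  have := mul_nonneg (neg_nonneg.2 h2.le) (hm a ha)
  simp only [AddMonoidHom.sub_apply, AddMonoidHom.smul_apply, smul_eq_mul]
  linarith

lemma nonnegOn_upperCut {m : M} (hm : m ∈ nonnegOn s) : m ∈ nonnegOn (upperCut s m₀) := by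
  intro n hn
  rcases mem_upperCut.1 hn with h | h
  · exact hm n h.1
  · exact crossings_apply_nonneg hm h

lemma nonnegOn_middleCut {m : M} (hm : m ∈ nonnegOn (upperCut s m₀)) :
    m ∈ nonnegOn (middleCut s m₀) := by
  intro n hn
  refine hm n (mem_upperCut.2 ?_)
  rcases mem_middleCut.1 hn with h | h
  · exact Or.inl ⟨h.1, h.2.ge⟩
  · exact Or.inr h

lemma nonnegOn_of_upperCut {m : M} (h : m ∈ nonnegOn (upperCut s m₀))
    (h' : m ∈ nonnegOn (upperCut s (-m₀))) : m ∈ nonnegOn s := by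
  intro n hn
  rcases le_total 0 (n m₀) with h0 | h0
  · exact h n (mem_upperCut.2 (Or.inl ⟨hn, h0⟩))
  · exact h' n (mem_upperCut.2 (Or.inl ⟨hn, by simpa using h0⟩))

/-- If `m` were negative on a generator on each side, it would be negative on the point where the
segment between them crosses the hyperplane. -/
lemma nonnegOn_upperCut_or {m : M} (h : m ∈ nonnegOn (middleCut s m₀)) :
    m ∈ nonnegOn (upperCut s m₀) ∨ m ∈ nonnegOn (upperCut s (-m₀)) := by
  have hc : ∀ n ∈ crossings s m₀, 0 ≤ n m := fun n hn => h n (mem_middleCut.2 (Or.inr hn))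
  by_contra! hcon
  simp only [mem_nonnegOn, not_forall] at hcon
  obtain ⟨⟨a, ha, ha'⟩, b, hb, hb'⟩ := hcon
  rcases mem_upperCut.1 ha with ha | ha
  swap
  · exact ha' (hc a ha)
  rcases mem_upperCut.1 hb with hb | hb
  swap
  · exact hb' (hc b (crossings_neg (s := s) ▸ hb))
  rcases ha.2.eq_or_lt with h0 | h0
  · exact ha' (h a (mem_middleCut.2 (Or.inl ⟨ha.1, h0.symm⟩)))
  have hb2 : b m₀ ≤ 0 := by simpa using hb.2
  rcases hb2.eq_or_lt with h1 | h1
  · exact hb' (h b (mem_middleCut.2 (Or.inl ⟨hb.1, h1⟩)))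
  have := hc _ (mem_crossings.2 ⟨a, ha.1, b, hb.1, h0, h1, rfl⟩)
  simp only [AddMonoidHom.sub_apply, AddMonoidHom.smul_apply, smul_eq_mul] at this
  nlinarith

lemma zeroOn_le_crossings {m : M} (hm : m ∈ zeroOn s) {n : M →+ ℤ} (hn : n ∈ crossings s m₀) :
    n m = 0 := by
  obtain ⟨a, ha, b, hb, h1, h2, rfl⟩ := mem_crossings.1 hn
  simp [hm a ha, hm b hb]

lemma zeroOn_upperCut {m : M} (hm : m ∈ zeroOn s) : m ∈ zeroOn (upperCut s m₀) := by
  intro n hn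
  rcases mem_upperCut.1 hn with h | h
  · exact hm n h.1
  · exact zeroOn_le_crossings hm h

lemma zeroOn_middleCut {m : M} (hm : m ∈ zeroOn s) : m ∈ zeroOn (middleCut s m₀) := by
  intro n hn
  rcases mem_middleCut.1 hn with h | h
  · exact hm n h.1
  · exact zeroOn_le_crossings hm h

lemma self_mem_zeroOn_middleCut : m₀ ∈ zeroOn (middleCut s m₀) := by
  intro n hn
  rcases mem_middleCut.1 hn with h | h
  · exact h.2
  · obtain ⟨a, ha, b, hb, h1, h2, rfl⟩ := mem_crossings.1 h
    simp [mul_comm]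

/-- On the exponents that vanish on the hyperplane section, any two vectors of `s` on different
sides are proportional. -/
lemma mul_eq_mul_of_mem_zeroOn_middleCut {m : M} (hm : m ∈ zeroOn (middleCut s m₀))
    {a b : M →+ ℤ} (ha : a ∈ s) (hb : b ∈ s) (ha0 : 0 < a m₀) (hb0 : b m₀ < 0) :
    a m₀ * b m = b m₀ * a m := by
  have := hm _ (mem_middleCut.2 (Or.inr (mem_crossings.2 ⟨a, ha, b, hb, ha0, hb0, rfl⟩)))
  simp only [AddMonoidHom.sub_apply, AddMonoidHom.smul_apply, smul_eq_mul] at this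
  linarith

lemma mul_eq_mul_of_mem_zeroOn_middleCut' {m : M} (hm : m ∈ zeroOn (middleCut s m₀))
    (hneg : ∃ n ∈ s, n m₀ < 0) {a b : M →+ ℤ} (ha : a ∈ s) (hb : b ∈ s) (ha0 : 0 < a m₀)
    (hb0 : 0 < b m₀) : a m₀ * b m = b m₀ * a m := by
  obtain ⟨c, hc, hc0⟩ := hneg
  have h1 := mul_eq_mul_of_mem_zeroOn_middleCut hm ha hc ha0 hc0
  have h2 := mul_eq_mul_of_mem_zeroOn_middleCut hm hb hc hb0 hc0
  refine mul_left_cancel₀ hc0.ne ?_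
  calc c m₀ * (a m₀ * b m) = a m₀ * (c m₀ * b m) := by ring
    _ = b m₀ * (a m₀ * c m) := by rw [← h2]; ring
    _ = c m₀ * (b m₀ * a m) := by rw [h1]; ring

/-- By proportionality, the values of `m` on the generators off the hyperplane are all determined by
its value on `ν`. -/
lemma zeroOn_of_middleCut {m : M} (hm : m ∈ zeroOn (middleCut s m₀)) (hneg : ∃ n ∈ s, n m₀ < 0)
    {ν : M →+ ℤ} (hν : ν ∈ s) (hν0 : 0 < ν m₀) (h : ν m = 0) : m ∈ zeroOn s := by
  intro n hn
  rcases lt_trichotomy (n m₀) 0 with h0 | h0 | h0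
  · have := mul_eq_mul_of_mem_zeroOn_middleCut hm hν hn hν0 h0
    rw [h, mul_zero] at this
    exact (mul_eq_zero.1 this).resolve_left hν0.ne'
  · exact hm n (mem_middleCut.2 (Or.inl ⟨hn, h0⟩))
  · have := mul_eq_mul_of_mem_zeroOn_middleCut' hm hneg hν hn hν0 h0
    rw [h, mul_zero] at this
    exact (mul_eq_zero.1 this).resolve_left hν0.ne'

lemma zeroOn_of_upperCut {m : M} (hm : m ∈ zeroOn (upperCut s m₀)) (hpos : ∃ n ∈ s, 0 < n m₀)
    (hneg : ∃ n ∈ s, n m₀ < 0) : m ∈ zeroOn s := by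
  obtain ⟨ν, hν, hν0⟩ := hpos
  refine zeroOn_of_middleCut (m₀ := m₀) (fun n hn => hm n (mem_upperCut.2 ?_)) hneg hν hν0
    (hm ν (mem_upperCut.2 (Or.inl ⟨hν, hν0.le⟩)))
  rcases mem_middleCut.1 hn with h | h
  · exact Or.inl ⟨h.1, h.2.ge⟩
  · exact Or.inr h

/-- Proportionality gives `m` opposite signs on the two sides of the hyperplane, so non-negativity
leaves only zero. Geometrically, a section with generators on both sides lies in no proper face. -/
lemma zeroOn_of_nonnegOn_of_middleCut {m : M} (hm : m ∈ nonnegOn s)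
    (hm0 : m ∈ zeroOn (middleCut s m₀)) (hpos : ∃ n ∈ s, 0 < n m₀) (hneg : ∃ n ∈ s, n m₀ < 0) :
    m ∈ zeroOn s := by
  obtain ⟨ν, hν, hν0⟩ := hpos
  refine zeroOn_of_middleCut hm0 hneg hν hν0 ?_
  obtain ⟨b, hb, hb0⟩ := hneg
  have h1 := mul_eq_mul_of_mem_zeroOn_middleCut hm0 hν hb hν0 hb0
  have h2 := hm ν hν
  have h3 := hm b hb
  nlinarith

lemma neg_sides (hpos : ∃ n ∈ s, 0 < n m₀) (hneg : ∃ n ∈ s, n m₀ < 0) :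
    (∃ n ∈ s, 0 < n (-m₀)) ∧ ∃ n ∈ s, n (-m₀) < 0 := by
  simpa using And.intro hneg hpos

/-- Each copy of `m₀` raises the value on a generator strictly above the hyperplane by at least one
and changes nothing on the section. -/
lemma exists_forall_add_mem_posOn_upperCut (hpos : ∃ n ∈ s, 0 < n m₀)
    {m : M} (hm : m ∈ nonnegOn (middleCut s m₀)) :
    ∃ b₀ : ℕ, ∀ b : ℤ, b₀ ≤ b → m + b • m₀ ∈ posOn (upperCut s m₀) := by
  obtain ⟨ν, hν, hν0⟩ := hpos
  have key : ∀ b : ℤ, ((1 + ∑ n ∈ s, (n m).natAbs : ℕ) : ℤ) ≤ b → ∀ n ∈ s, 0 < n m₀ →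
      0 < n (m + b • m₀) := by
    intro b hb n hn hn0
    have h1 : (n m).natAbs ≤ ∑ n ∈ s, (n m).natAbs :=
      Finset.single_le_sum (f := fun n : M →+ ℤ => (n m).natAbs) (fun _ _ => Nat.zero_le _) hn
    have h2 : b * 1 ≤ b * n m₀ := by
      refine mul_le_mul_of_nonneg_left (by omega) (by omega)
    simp only [map_add, map_zsmul, smul_eq_mul]
    omega
  refine ⟨1 + ∑ n ∈ s, (n m).natAbs, fun b hb => ⟨fun n hn => ?_, fun h => ?_⟩⟩
  · rcases mem_upperCut.1 hn with ⟨hn, h0⟩ | hn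
    · rcases h0.eq_or_lt with h0 | h0
      · simp only [map_add, map_zsmul, ← h0, smul_zero, add_zero]
        exact hm n (mem_middleCut.2 (Or.inl ⟨hn, h0.symm⟩))
      · exact (key b hb n hn h0).le
    · have hn' := mem_middleCut.2 (Or.inr hn)
      simp only [map_add, map_zsmul, self_mem_zeroOn_middleCut n hn', smul_zero, add_zero]
      exact hm n hn'
  · exact (key b hb ν hν hν0).ne' (h ν (mem_upperCut.2 (Or.inl ⟨hν, hν0.le⟩)))

/-- Up to a positive multiple, an exponent that is non-negative on the hyperplane section is
non-negative on the cone after a translation by a multiple of `m₀`. -/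
lemma exists_smul_sub_mem_nonnegOn (hpos : ∃ n ∈ s, 0 < n m₀) {m : M}
    (hm : m ∈ nonnegOn (middleCut s m₀)) :
    ∃ c : ℕ, 0 < c ∧ ∃ b : ℤ, c • m - b • m₀ ∈ nonnegOn s := by
  classical
  obtain ⟨ν, hν, hν0⟩ := hpos
  -- Take `a` of least slope `a m / a m₀` among the generators above the hyperplane and subtract
  -- this slope times `m₀`, cleared of denominators. Minimality handles the generators above; those
  -- below are handled by their crossing with `a`.
  obtain ⟨a, ha, hmin⟩ := Finset.exists_min_image (s.filter fun n => 0 < n m₀)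
    (fun n => (n m : ℚ) / n m₀) ⟨ν, by simp [hν, hν0]⟩
  simp only [Finset.mem_filter] at ha hmin
  obtain ⟨c, hc⟩ := Int.eq_ofNat_of_zero_le ha.2.le
  refine ⟨c, by omega, a m, fun n hn => ?_⟩
  simp only [map_sub, map_nsmul, map_zsmul, smul_eq_mul, nsmul_eq_mul]
  rw [show ((c : ℕ) : ℤ) = a m₀ from hc.symm]
  rcases lt_trichotomy (n m₀) 0 with h0 | h0 | h0
  · have := hm _ (mem_middleCut.2 (Or.inr (mem_crossings.2 ⟨a, ha.1, n, hn, ha.2, h0, rfl⟩)))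
    simp only [AddMonoidHom.sub_apply, AddMonoidHom.smul_apply, smul_eq_mul] at this
    linarith
  · rw [h0, mul_zero, sub_zero]
    exact mul_nonneg ha.2.le (hm n (mem_middleCut.2 (Or.inl ⟨hn, h0⟩)))
  · have h := hmin n ⟨hn, h0⟩
    rw [div_le_div_iff₀ (by exact_mod_cast ha.2) (by exact_mod_cast h0)] at h
    have h' : a m * n m₀ ≤ n m * a m₀ := by exact_mod_cast h
    linarith

/-! ### Gordan's lemma -/

/-- With natural-number coordinates for `M` and slack variables for the inequalities, the monoid is
the image of the solutions in natural numbers of a linear system. Such solutions form a subtractive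
monoid, which is finitely generated. -/
lemma nonnegOn_fg [Module.Finite ℤ M] (s : Finset (M →+ ℤ)) : (nonnegOn s).FG := by
  classical
  have hfg : AddMonoid.FG M := AddGroup.fg_iff_addMonoid_fg.1 (Module.Finite.iff_addGroup_fg.1 ‹_›)
  obtain ⟨S, hS⟩ := AddMonoid.fg_def.1 hfg
  let φ : (S → ℕ) →+ M :=
    { toFun := fun a => ∑ i, a i • (i : M)
      map_zero' := by simp
      map_add' := fun a b => by simp [add_smul, Finset.sum_add_distrib] }
  have hφ : ∀ m, ∃ a, φ a = m := by
    intro m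
    have hm : m ∈ AddSubmonoid.closure (S : Set M) := hS ▸ AddSubmonoid.mem_top m
    have hle : AddSubmonoid.closure (S : Set M) ≤ AddMonoidHom.mrange φ := by
      rw [AddSubmonoid.closure_le]
      intro x hx
      exact ⟨Pi.single ⟨x, hx⟩ 1, by simp [φ, Pi.single_apply]⟩
    exact hle hm
  let P : AddSubmonoid ((S → ℕ) × (s → ℕ)) :=
    { carrier := {x | ∀ n : s, n.1 (φ x.1) = x.2 n}
      zero_mem' := by simp
      add_mem' := fun {x y} hx hy n => by simp [hx n, hy n] }
  have hP : P.FG := AddSubmonoid.fg_of_subtractive fun x hx y hxy n => by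
    have h1 := hx n
    have h2 := hxy n
    simp only [Prod.fst_add, map_add, Prod.snd_add, Pi.add_apply, Nat.cast_add] at h2
    rw [h1] at h2
    exact add_left_cancel h2
  have himage : P.map (φ.comp (AddMonoidHom.fst _ _)) = nonnegOn s := by
    ext m
    constructor
    · rintro ⟨x, hx, rfl⟩ n hn
      exact (hx ⟨n, hn⟩).symm ▸ Int.natCast_nonneg _
    · intro hm
      obtain ⟨a, rfl⟩ := hφ m
      exact ⟨(a, fun n => (n.1 (φ a)).toNat), fun n => (Int.toNat_of_nonneg (hm n.1 n.2)).symm, rfl⟩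
  rw [← himage]
  exact hP.map _

/-- The exponents that are non-negative on the hyperplane section form finitely many translates of
`nonnegOn s + ℤ m₀`. -/
lemma exists_finset_middleCut [Module.Finite ℤ M] (hpos : ∃ n ∈ s, 0 < n m₀) :
    ∃ R : Finset M, (∀ r ∈ R, r ∈ nonnegOn (middleCut s m₀)) ∧
      ∀ m ∈ nonnegOn (middleCut s m₀), ∃ r ∈ R, ∃ k ∈ nonnegOn s, ∃ b : ℤ,
        m = k + (r + b • m₀) := by
  classical
  obtain ⟨T, hT⟩ := nonnegOn_fg (middleCut s m₀)
  have hTmem : ∀ t : T, t.1 ∈ nonnegOn (middleCut s m₀) := fun t =>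
    hT ▸ AddSubmonoid.subset_closure t.2
  choose c hc b hcb using fun t : T => exists_smul_sub_mem_nonnegOn hpos (hTmem t)
  -- Divide the multiplicity of each generator `t` by `c t` with remainder. The remainders give the
  -- finite set, and `c t • t` equals an element of `nonnegOn s` plus `b t • m₀`.
  refine ⟨(Fintype.piFinset fun t : T => Finset.range (c t)).image fun a => ∑ t, a t • t.1,
    ?_, ?_⟩
  · intro r hr
    obtain ⟨a, -, rfl⟩ := Finset.mem_image.1 hr
    exact sum_mem fun t _ => nsmul_mem (hTmem t) _
  · intro m hm
    have hle : AddSubmonoid.closure (T : Set M) ≤ AddMonoidHom.mrange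
        ({ toFun := fun a : T → ℕ => ∑ t, a t • t.1
           map_zero' := by simp
           map_add' := fun a b => by simp [add_smul, Finset.sum_add_distrib] } : (T → ℕ) →+ M) := by
      rw [AddSubmonoid.closure_le]
      intro x hx
      exact ⟨Pi.single ⟨x, hx⟩ 1, by simp [Pi.single_apply]⟩
    obtain ⟨a, rfl⟩ := hle (hT.symm ▸ hm)
    refine ⟨_, Finset.mem_image.2 ⟨fun t => a t % c t, by
      simpa using fun t ht => Nat.mod_lt _ (hc ⟨t, ht⟩), rfl⟩,
      ∑ t, (a t / c t) • (c t • t.1 - b t • m₀), sum_mem fun t _ => nsmul_mem (hcb t) _,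
      ∑ t, ((a t / c t : ℕ) : ℤ) * b t, ?_⟩
    rw [Finset.sum_smul]
    simp only [← Finset.sum_add_distrib]
    refine Finset.sum_congr rfl fun t _ => ?_
    conv_lhs => rw [← Nat.div_add_mod' (a t) (c t)]
    rw [smul_sub, mul_smul, natCast_zsmul, ← mul_smul, add_smul]
    abel

end Cut

/-! ### A consequence of the Artin–Rees lemma and Krull's intersection theorem -/

section Krull

/-- The image `P` of `𝔞` in `S ⧸ L` is finitely generated over `R`. By Artin–Rees, high powers of `𝔫
S` meet `𝔞` inside `𝔫 ^ N • 𝔞`, so the class of `p` lies in every `𝔫 ^ N • P`. Krull's theorem then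
gives `r ∈ 𝔫` fixing this class. -/
lemma exists_sub_smul_mem_of_forall_pow {R S : Type} [CommRing R] [CommRing S] [Algebra R S]
    [IsNoetherianRing R] [IsNoetherianRing S] (𝔫 : Ideal R) (𝔞 : Ideal S) (L : Submodule R S)
    {G : Set S} (hG : G.Finite) (hfg : 𝔞.restrictScalars R ≤ L ⊔ Submodule.span R G) {p : S}
    (hp : ∀ N : ℕ, ∃ p' ∈ 𝔞 ⊓ (𝔫.map (algebraMap R S)) ^ N, p - p' ∈ L) :
    ∃ r ∈ 𝔫, p - r • p ∈ L := by
  set P : Submodule R (S ⧸ L) := (𝔞.restrictScalars R).map L.mkQ with hPdef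
  have hPle : P ≤ Submodule.span R (L.mkQ '' G) := by
    rw [← Submodule.map_span]
    refine (Submodule.map_mono hfg).trans ?_
    rw [Submodule.map_sup, Submodule.mkQ_map_self, bot_sup_eq]
  have : IsNoetherian R (Submodule.span R (L.mkQ '' G)) :=
    isNoetherian_span_of_finite R (hG.image _)
  have hPn : IsNoetherian R P := isNoetherian_of_le hPle
  obtain ⟨k, hk⟩ := Ideal.exists_pow_inf_eq_pow_smul (𝔫.map (algebraMap R S))
    (𝔞 : Submodule S S)
  have hpow : ∀ N : ℕ, L.mkQ p ∈ 𝔫 ^ N • P := by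
    intro N
    obtain ⟨p', ⟨h1, h2⟩, h3⟩ := hp (N + k)
    have hmk : L.mkQ p = L.mkQ p' := (Submodule.Quotient.eq L).2 h3
    rw [hmk, hPdef, ← Submodule.map_smul'']
    refine Submodule.mem_map_of_mem ?_
    rw [← Ideal.smul_restrictScalars, Submodule.restrictScalars_mem, Ideal.map_pow]
    have h4 : p' ∈ (𝔫.map (algebraMap R S)) ^ (N + k) • (⊤ : Submodule S S) ⊓ 𝔞 :=
      ⟨by simpa using h2, h1⟩
    rw [hk (N + k) (by omega), Nat.add_sub_cancel] at h4
    exact Submodule.smul_mono le_rfl inf_le_right h4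
  have hpP : L.mkQ p ∈ P := by simpa using hpow 0
  have hmem : (⟨L.mkQ p, hpP⟩ : P) ∈ (⨅ i : ℕ, 𝔫 ^ i • ⊤ : Submodule R P) := by
    rw [Submodule.mem_iInf]
    intro N
    have h := hpow N
    have hmap : (𝔫 ^ N • (⊤ : Submodule R P)).map P.subtype = 𝔫 ^ N • P := by
      rw [Submodule.map_smul'', Submodule.map_top, Submodule.range_subtype]
    rw [← hmap] at h
    obtain ⟨x, hx, hxp⟩ := h
    rwa [show (⟨L.mkQ p, hpP⟩ : P) = x from Subtype.ext hxp.symm]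
  obtain ⟨r, hr⟩ := (Ideal.mem_iInf_smul_pow_eq_bot_iff 𝔫 _).1 hmem
  refine ⟨r, r.2, ?_⟩
  have h := congrArg Subtype.val hr
  rw [← Submodule.Quotient.eq]
  exact h.symm

end Krull

/-! ### The algebra of a monoid of exponents -/

section MonoidSubalgebra

variable {M : Type} [AddCommGroup M]

/-- The Laurent polynomials whose exponents lie in the monoid `D`, as a subalgebra. -/
def monoidSubalgebra (D : AddSubmonoid M) : Subalgebra ℂ (AddMonoidAlgebra ℂ M) where
  carrier := suppIn (D : Set M)
  mul_mem' := fun hf hg => mul_mem_suppIn hf hg fun _ ha _ hb => add_mem ha hb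
  add_mem' := fun hf hg => add_mem hf hg
  algebraMap_mem' := fun c => by
    rw [AddMonoidAlgebra.coe_algebraMap]
    exact single_mem_suppIn (zero_mem D) c

lemma mapDomain_subtype_mem_suppIn (D : AddSubmonoid M) (f : AddMonoidAlgebra ℂ D) :
    AddMonoidAlgebra.mapDomainAlgHom ℂ ℂ D.subtype f ∈ suppIn (D : Set M) := by
  induction f using AddMonoidAlgebra.induction_linear with
  | zero => simp
  | add f g hf hg => rw [map_add]; exact add_mem hf hg
  | single a c =>
    simpa using single_mem_suppIn a.2 c

lemma exists_mapDomain_subtype_eq {D : AddSubmonoid M} {f : AddMonoidAlgebra ℂ M}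
    (hf : f ∈ suppIn (D : Set M)) :
    ∃ g : AddMonoidAlgebra ℂ D, AddMonoidAlgebra.mapDomainAlgHom ℂ ℂ D.subtype g = f := by
  rw [← AlgHom.mem_range, eq_sum_single f]
  refine sum_mem fun m hm => ?_
  have hmD : m ∈ D := hf m (by simpa using hm)
  exact ⟨.single ⟨m, hmD⟩ (f.coeff m), by simp⟩

lemma isNoetherianRing_monoidSubalgebra {D : AddSubmonoid M} (hD : D.FG) :
    IsNoetherianRing (monoidSubalgebra D) := by
  have : AddMonoid.FG D := (AddMonoid.fg_iff_addSubmonoid_fg D).2 hD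
  have : IsNoetherianRing (AddMonoidAlgebra ℂ D) := Algebra.FiniteType.isNoetherianRing ℂ _
  refine isNoetherianRing_of_surjective _ _
    ((AddMonoidAlgebra.mapDomainAlgHom ℂ ℂ D.subtype).codRestrict (monoidSubalgebra D)
      (mapDomain_subtype_mem_suppIn D)).toRingHom ?_
  rintro ⟨f, hf⟩
  obtain ⟨g, hg⟩ := exists_mapDomain_subtype_eq hf
  exact ⟨g, Subtype.ext hg⟩

lemma monoidSubalgebra_mono {D D' : AddSubmonoid M} (h : D ≤ D') :
    monoidSubalgebra D ≤ monoidSubalgebra D' := suppIn_mono h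

end MonoidSubalgebra

/-! ### Lifting generators of the initial ideal -/

section Lifts

variable {M : Type} [AddCommGroup M]

/-- The relative interior of the cone generated by `s`. -/
def relInt (s : Finset (M →+ ℤ)) : Set (M →+ ℝ) :=
  {u | u ∈ PointedCone.hull ℝ (latticeToReal '' (s : Set (M →+ ℤ))) ∧
    ∀ m ∈ nonnegOn s, u m = 0 → m ∈ zeroOn s}

lemma sum_mem_relInt (s : Finset (M →+ ℤ)) : latticeToReal (∑ n ∈ s, n) ∈ relInt s := by
  constructor
  · have : latticeToReal (∑ n ∈ s, n) = ∑ n ∈ s, latticeToReal n := by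
      ext m
      simp [latticeToReal, AddMonoidHom.finsetSum_apply]
    rw [this]
    exact sum_mem fun n hn => Submodule.subset_span ⟨n, hn, rfl⟩
  · intro m hm h
    refine (sum_apply_eq_zero_iff hm).1 ?_
    have h' : (((∑ n ∈ s, n) m : ℤ) : ℝ) = 0 := h
    exact_mod_cast h'

lemma crossings_mem_hull {s : Finset (M →+ ℤ)} {m₀ : M} {n : M →+ ℤ} (hn : n ∈ crossings s m₀) :
    latticeToReal n ∈ PointedCone.hull ℝ (latticeToReal '' (s : Set (M →+ ℤ))) := by
  obtain ⟨a, ha, b, hb, h1, h2, rfl⟩ := mem_crossings.1 hn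
  have h1' : (0 : ℝ) ≤ a m₀ := by exact_mod_cast h1.le
  have h2' : (0 : ℝ) ≤ -b m₀ := by
    rw [neg_nonneg]
    exact_mod_cast h2.le
  have h : latticeToReal (a m₀ • b - b m₀ • a) =
      (⟨_, h1'⟩ : {c : ℝ // 0 ≤ c}) • latticeToReal b +
        (⟨_, h2'⟩ : {c : ℝ // 0 ≤ c}) • latticeToReal a := by
    ext m
    simp [latticeToReal, Nonneg.mk_smul]
    ring
  rw [h]
  exact add_mem (Submodule.smul_mem _ _ (Submodule.subset_span ⟨b, hb, rfl⟩))
    (Submodule.smul_mem _ _ (Submodule.subset_span ⟨a, ha, rfl⟩))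

/-- Together with the next lemma, this transfers constancy of the initial ideal from a cone to the
pieces of a cut. Generators on both sides of the hyperplane are essential, since otherwise a piece
could lie in a proper face. -/
lemma relInt_upperCut_subset {s : Finset (M →+ ℤ)} {m₀ : M} (hpos : ∃ n ∈ s, 0 < n m₀)
    (hneg : ∃ n ∈ s, n m₀ < 0) : relInt (upperCut s m₀) ⊆ relInt s := by
  rintro u ⟨hu, hu'⟩
  refine ⟨?_, fun m hm h => zeroOn_of_upperCut (hu' m (nonnegOn_upperCut hm) h) hpos hneg⟩
  refine Submodule.span_le.2 ?_ hu
  rintro _ ⟨n, hn, rfl⟩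
  rcases mem_upperCut.1 hn with h | h
  · exact Submodule.subset_span ⟨n, h.1, rfl⟩
  · exact crossings_mem_hull h

lemma relInt_middleCut_subset {s : Finset (M →+ ℤ)} {m₀ : M} (hpos : ∃ n ∈ s, 0 < n m₀)
    (hneg : ∃ n ∈ s, n m₀ < 0) : relInt (middleCut s m₀) ⊆ relInt s := by
  rintro u ⟨hu, hu'⟩
  refine ⟨?_, fun m hm h => zeroOn_of_nonnegOn_of_middleCut hm
    (hu' m (nonnegOn_middleCut (nonnegOn_upperCut hm)) h) hpos hneg⟩
  refine Submodule.span_le.2 ?_ hu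
  rintro _ ⟨n, hn, rfl⟩
  rcases mem_middleCut.1 hn with h | h
  · exact Submodule.subset_span ⟨n, h.1, rfl⟩
  · exact crossings_mem_hull h

/-- Every `g i` is the part of lowest order along the cone generated by `s` of an element of `I`. -/
def HasLifts {κ : Type} (I : Ideal (AddMonoidAlgebra ℂ M)) (g : κ → AddMonoidAlgebra ℂ M)
    (s : Finset (M →+ ℤ)) : Prop :=
  ∀ i, ∃ f ∈ I, f - g i ∈ suppIn (posOn s)

variable {κ : Type} [Fintype κ] {I J : Ideal (AddMonoidAlgebra ℂ M)}
  {g : κ → AddMonoidAlgebra ℂ M} {s : Finset (M →+ ℤ)} {m₀ : M}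

/-- Start from any coefficients and truncate them to `S`. The exponents of the `g i` preserve `S`,
so truncation commutes with multiplication by them. -/
lemma exists_coefficients (hJ : J = Ideal.span (Set.range g))
    (hg : ∀ i, g i ∈ suppIn (zeroOn s : Set M)) {S : Set M}
    (hS : ∀ m, ∀ z ∈ zeroOn s, m + z ∈ S ↔ m ∈ S) {q : AddMonoidAlgebra ℂ M} (hq : q ∈ J)
    (hqS : q ∈ suppIn S) :
    ∃ c : κ → AddMonoidAlgebra ℂ M, (∀ i, c i ∈ suppIn S) ∧ q = ∑ i, c i * g i := by
  rw [hJ, Ideal.mem_span_range_iff_exists_fun] at hq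
  obtain ⟨c, hc⟩ := hq
  refine ⟨fun i => part S (c i), fun i =>
    suppIn_mono Set.inter_subset_right (part_mem_suppIn (mem_suppIn_univ (c i))), ?_⟩
  rw [← part_eq_self hqS, ← hc, map_sum]
  exact Finset.sum_congr rfl fun i _ => part_mul (hg i) hS

lemma zeroOn_add_mem_iff {s : Finset (M →+ ℤ)} {m z : M} (hz : z ∈ zeroOn s) :
    m + z ∈ zeroOn s ↔ m ∈ zeroOn s := by
  rw [add_comm]
  exact (zeroOn s).add_mem_cancel_left hz

lemma nonnegOn_add_mem_iff {s : Finset (M →+ ℤ)} {m z : M} (hz : z ∈ zeroOn s) :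
    m + z ∈ nonnegOn s ↔ m ∈ nonnegOn s := by
  simp only [mem_nonnegOn, map_add]
  exact forall₂_congr fun n hn => by rw [hz n hn, add_zero]

/-- The part of lowest order of an element of `I` lies in the common initial ideal. -/
lemma part_level_sum_mem (hconst : ∀ u ∈ relInt s, initialIdeal u I = J) {f : AddMonoidAlgebra ℂ M}
    (hf : f ∈ I) {c : ℤ} (h : ∀ m, f.coeff m ≠ 0 → c ≤ (∑ n ∈ s, n) m) :
    part {m | (∑ n ∈ s, n) m = c} f ∈ J := by
  rw [← hconst _ (sum_mem_relInt s)]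
  have := part_level_mem_initialIdeal (w := latticeToReal (∑ n ∈ s, n)) hf (c := (c : ℝ))
    fun m hm => (Int.cast_le (R := ℝ)).2 (h m hm)
  have hset : {m | (∑ n ∈ s, n) m = c} = {m | latticeToReal (∑ n ∈ s, n) m = (c : ℝ)} := by
    ext m
    exact (Int.cast_inj (α := ℝ)).symm
  rwa [hset]

lemma part_zeroOn_mem (hconst : ∀ u ∈ relInt s, initialIdeal u I = J) {f : AddMonoidAlgebra ℂ M}
    (hf : f ∈ I) (hfs : f ∈ suppIn (nonnegOn s : Set M)) : part (zeroOn s : Set M) f ∈ J := by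
  have h := part_level_sum_mem hconst hf (c := 0) fun m hm => sum_apply_nonneg (hfs m hm)
  rwa [part_congr fun m hm => (sum_apply_eq_zero_iff (hfs m hm)).symm]

/-- Lifts over the upper half of a cone can be chosen so that they also are lifts along the
hyperplane section, if there are lifts over the hyperplane section. -/
lemma exists_lifts_upperCut (hJ : J = Ideal.span (Set.range g))
    (hg : ∀ i, g i ∈ suppIn (zeroOn s : Set M))
    (hconst : ∀ u ∈ relInt (middleCut s m₀), initialIdeal u I = J)
    (hpos : ∃ n ∈ s, 0 < n m₀) (hneg : ∃ n ∈ s, n m₀ < 0)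
    (hup : HasLifts I g (upperCut s m₀)) (hmid : HasLifts I g (middleCut s m₀)) (i : κ) :
    ∃ f ∈ I, f - g i ∈ suppIn {m | m ∈ nonnegOn (upperCut s m₀) ∧ m ∉ zeroOn (middleCut s m₀)} := by
  classical
  obtain ⟨ν, hν, hν0⟩ := id hpos
  have hνup : ν ∈ upperCut s m₀ := mem_upperCut.2 (Or.inl ⟨hν, hν0.le⟩)
  -- The obstruction to being a lift along the section consists of the remaining exponents that
  -- vanish there. By proportionality `ν` measures their height above it, and `E B` requires this
  -- height to be at least `B`.
  let E : ℤ → Set M := fun B => {m | m ∈ posOn (upperCut s m₀) ∧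
    (m ∈ zeroOn (middleCut s m₀) → B ≤ ν m)}
  let S : ℤ → Set M := fun B => E B ∩ zeroOn (middleCut s m₀)
  have hEinv : ∀ B m, ∀ z ∈ zeroOn s, m + z ∈ S B ↔ m ∈ S B := by
    intro B m z hz
    simp only [S, E, posOn, Set.mem_inter_iff, Set.mem_ofPred_eq, SetLike.mem_coe,
      zeroOn_add_mem_iff (zeroOn_upperCut hz), zeroOn_add_mem_iff (zeroOn_middleCut hz),
      nonnegOn_add_mem_iff (zeroOn_upperCut hz), map_add, hz ν hν, add_zero]
  -- The obstructing terms are a lowest-order part along the section minus `g i`. The initial ideal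
  -- along the section is again `J`, so they are a combination of the `g j`.
  have hrem : ∀ B, ∀ f ∈ I, ∀ i, f - g i ∈ suppIn (E B) →
      ∃ c : κ → AddMonoidAlgebra ℂ M, (∀ j, c j ∈ suppIn (S B)) ∧
        part (zeroOn (middleCut s m₀) : Set M) (f - g i) = ∑ j, c j * g j := by
    intro B f hf i hfi
    refine exists_coefficients hJ hg (hEinv B) ?_ (part_mem_suppIn hfi)
    rw [map_sub, part_eq_self (mem_suppIn_of_subset (hg i) fun m hm => zeroOn_middleCut hm)]
    refine sub_mem (part_zeroOn_mem hconst hf ?_) ?_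
    · rw [← sub_add_cancel f (g i)]
      exact add_mem (mem_suppIn_of_subset hfi fun m hm => nonnegOn_middleCut hm.1.1)
        (mem_suppIn_of_subset (hg i) fun m hm => zeroOn_le_nonnegOn (zeroOn_middleCut hm))
    · rw [hJ]
      exact Ideal.subset_span ⟨i, rfl⟩
  -- Height one is automatic, as `ν` is integral and positive on obstructing exponents. Replacing
  -- each `g j` in the obstruction by its current lift leaves products of two exponents of height at
  -- least `B + 1`.
  have hstage : ∀ B : ℕ, ∀ i, ∃ f ∈ I, f - g i ∈ suppIn (E (B + 1)) := by
    intro B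
    induction B with
    | zero =>
      intro i
      obtain ⟨f, hf, hfi⟩ := hup i
      refine ⟨f, hf, mem_suppIn_of_subset hfi fun m hm => ⟨hm, fun h0 => ?_⟩⟩
      have h1 := hm.1 ν hνup
      have h2 : ν m ≠ 0 := fun h => hm.2 (zeroOn_upperCut (zeroOn_of_middleCut h0 hneg hν hν0 h))
      push_cast
      omega
    | succ B ih =>
      intro i
      choose H hHI hH using ih
      obtain ⟨c, hc, hcsum⟩ := hrem _ (H i) (hHI i) i (hH i)
      refine ⟨H i - ∑ j, c j * H j, sub_mem (hHI i)
        (sum_mem fun j _ => I.mul_mem_left _ (hHI j)), ?_⟩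
      have hsplit : H i - ∑ j, c j * H j - g i =
          ((H i - g i) - part (zeroOn (middleCut s m₀) : Set M) (H i - g i)) -
            ∑ j, c j * (H j - g j) := by
        rw [hcsum]
        simp only [mul_sub, Finset.sum_sub_distrib]
        abel
      rw [hsplit]
      refine sub_mem (mem_suppIn_of_subset (sub_part_mem_suppIn (hH i))
        fun m hm => ⟨hm.1.1, fun h => absurd h hm.2⟩) (sum_mem fun j _ => mul_mem_suppIn (hc j) (hH j) ?_)
      rintro a ⟨⟨ha1, ha2⟩, ha3⟩ b ⟨hb1, hb2⟩
      refine ⟨add_mem_posOn ha1.1 hb1, fun h => ?_⟩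
      have h3 := ha2 ha3
      have h4 := hb2 (((zeroOn (middleCut s m₀)).add_mem_cancel_left ha3).1 h)
      rw [map_add]
      push_cast at h3 h4 ⊢
      omega
  choose F hFI hF using hmid
  -- The lifts over the section may be negative on generators above it, but only by a bounded
  -- amount. Coefficients of height beyond this bound absorb it, so a last correction by these lifts
  -- stays non-negative on the upper half and removes the whole obstruction.
  let B : ℕ := ∑ j, ∑ m ∈ (F j - g j).coeff.support, ∑ n ∈ s, (ν m₀ * n m).natAbs
  have hB : ∀ j m, (F j - g j).coeff m ≠ 0 → ∀ n ∈ s, -(ν m₀ * n m) ≤ B := by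
    intro j m hm n hn
    have h1 : (ν m₀ * n m).natAbs ≤ B :=
      (Finset.single_le_sum (f := fun n : M →+ ℤ => (ν m₀ * n m).natAbs)
        (fun _ _ => Nat.zero_le _) hn).trans
      ((Finset.single_le_sum (f := fun m => ∑ n ∈ s, (ν m₀ * n m).natAbs)
        (fun _ _ => Nat.zero_le _) (by simpa using hm)).trans
      (Finset.single_le_sum (f := fun j => ∑ m ∈ (F j - g j).coeff.support,
        ∑ n ∈ s, (ν m₀ * n m).natAbs) (fun _ _ => Nat.zero_le _) (Finset.mem_univ j)))
    omega
  obtain ⟨f, hf, hfi⟩ := hstage B i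
  obtain ⟨c, hc, hcsum⟩ := hrem _ f hf i hfi
  refine ⟨f - ∑ j, c j * F j, sub_mem hf (sum_mem fun j _ => I.mul_mem_left _ (hFI j)), ?_⟩
  have hsplit : f - ∑ j, c j * F j - g i =
      ((f - g i) - part (zeroOn (middleCut s m₀) : Set M) (f - g i)) -
        ∑ j, c j * (F j - g j) := by
    rw [hcsum]
    simp only [mul_sub, Finset.sum_sub_distrib]
    abel
  rw [hsplit]
  refine sub_mem (mem_suppIn_of_subset (sub_part_mem_suppIn hfi) fun m hm => ⟨hm.1.1.1, hm.2⟩)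
    (sum_mem fun j _ => mul_mem_suppIn (hc j)
      (T := {m | (F j - g j).coeff m ≠ 0}) (fun m hm => hm) ?_)
  rintro a ⟨⟨ha1, ha2⟩, ha3⟩ b hb
  have hb' := hF j b hb
  refine ⟨fun n hn => ?_, fun h => hb'.2 (((zeroOn (middleCut s m₀)).add_mem_cancel_left ha3).1 h)⟩
  rcases mem_upperCut.1 hn with ⟨hns, hn0⟩ | hn
  · rcases hn0.eq_or_lt with h0 | h0
    · have hn' := mem_middleCut.2 (Or.inl ⟨hns, h0.symm⟩)
      rw [map_add, ha3 n hn', zero_add]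
      exact hb'.1 n hn'
    · have h1 := mul_eq_mul_of_mem_zeroOn_middleCut' ha3 hneg hν hns hν0 h0
      have h2 := hB j b hb n hns
      have h3 := ha2 ha3
      have h4 : 1 * ν a ≤ n m₀ * ν a := mul_le_mul_of_nonneg_right (by omega) (by omega)
      have h5 : 0 ≤ ν m₀ * (n (a + b)) := by
        rw [map_add, mul_add]
        omega
      exact nonneg_of_mul_nonneg_right h5 hν0
  · have hn' := mem_middleCut.2 (Or.inr hn)
    rw [map_add, ha3 n hn', zero_add]
    exact hb'.1 n hn'

end Lifts

/-! ### Gluing lifts along a hyperplane section -/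

section Glue

variable {M : Type} [AddCommGroup M] {κ : Type} {I J : Ideal (AddMonoidAlgebra ℂ M)}
  {g : κ → AddMonoidAlgebra ℂ M} {s : Finset (M →+ ℤ)} {m₀ : M}

lemma lift_mem_suppIn_upperCut (hg : ∀ i, g i ∈ suppIn (zeroOn s : Set M))
    {F : AddMonoidAlgebra ℂ M} {i : κ} {T : Set M}
    (hF : F - g i ∈ suppIn {m | m ∈ nonnegOn (upperCut s m₀) ∧ m ∈ T}) :
    F ∈ suppIn (nonnegOn (upperCut s m₀) : Set M) := by
  rw [← sub_add_cancel F (g i)]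
  exact add_mem (mem_suppIn_of_subset hF fun m hm => hm.1)
    (mem_suppIn_of_subset (hg i) fun m hm => zeroOn_le_nonnegOn (zeroOn_upperCut hm))

/-- An element of `I` that is non-negative along the hyperplane section is, up to elements of `I` that
are positive on one of the two halves, of arbitrarily high order along the section. -/
lemma exists_reduction [Fintype κ] (hJ : J = Ideal.span (Set.range g))
    (hg : ∀ i, g i ∈ suppIn (zeroOn s : Set M))
    (hconst : ∀ u ∈ relInt (middleCut s m₀), initialIdeal u I = J)
    (hpos : ∃ n ∈ s, 0 < n m₀) (hneg : ∃ n ∈ s, n m₀ < 0)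
    (hup : ∀ i, ∃ f ∈ I, f - g i ∈
      suppIn {m | m ∈ nonnegOn (upperCut s m₀) ∧ m ∉ zeroOn (middleCut s m₀)})
    (hdn : ∀ i, ∃ f ∈ I, f - g i ∈
      suppIn {m | m ∈ nonnegOn (upperCut s (-m₀)) ∧ m ∉ zeroOn (middleCut s m₀)})
    {p : AddMonoidAlgebra ℂ M} (hp : p ∈ I)
    (hps : p ∈ suppIn {m | m ∈ nonnegOn (middleCut s m₀) ∧ m ∉ zeroOn s}) (N : ℕ) :
    ∃ a ∈ I, a ∈ suppIn (posOn (upperCut s m₀)) ∧ ∃ b ∈ I, b ∈ suppIn (posOn (upperCut s (-m₀))) ∧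
      ∃ p' ∈ I, p' ∈ suppIn {m | m ∈ nonnegOn (middleCut s m₀) ∧ m ∉ zeroOn s ∧
        (N : ℤ) ≤ (∑ n ∈ middleCut s m₀, n) m} ∧ p = a + b + p' := by
  classical
  obtain ⟨hpos', hneg'⟩ := neg_sides hpos hneg
  choose F hFI hF using hup
  choose G hGI hG using hdn
  set U := ∑ n ∈ middleCut s m₀, n with hU
  induction N with
  | zero =>
    exact ⟨0, zero_mem _, zero_mem _, 0, zero_mem _, zero_mem _, p, hp,
      mem_suppIn_of_subset hps fun m hm => ⟨hm.1, hm.2, sum_apply_nonneg hm.1⟩, by simp⟩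
  | succ N ih =>
    obtain ⟨a, haI, ha, b, hbI, hb, p', hp'I, hp', rfl⟩ := ih
    -- The level-`N` part of the remainder lies in `J`: it is either zero or an initial form at an
    -- interior point of the section.
    let S : Set M := {m | m ∈ nonnegOn (middleCut s m₀) ∧ m ∉ zeroOn s ∧ U m = N}
    obtain ⟨c, hc, hcsum⟩ : ∃ c : κ → AddMonoidAlgebra ℂ M, (∀ j, c j ∈ suppIn S) ∧
        part {m | U m = N} p' = ∑ j, c j * g j := by
      refine exists_coefficients hJ hg ?_
        (part_level_sum_mem hconst hp'I fun m hm => (hp' m hm).2.2)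
        (mem_suppIn_of_subset (part_mem_suppIn hp') fun m hm => ⟨hm.1.1, hm.1.2.1, hm.2⟩)
      intro m z hz
      have hz0 := zeroOn_middleCut (m₀ := m₀) hz
      simp only [S, Set.mem_ofPred_eq, nonnegOn_add_mem_iff hz0, zeroOn_add_mem_iff hz, map_add,
        (sum_apply_eq_zero_iff (zeroOn_le_nonnegOn hz0)).2 hz0, hU, add_zero]
    -- An exponent non-negative on the section is non-negative on one of the halves, so each
    -- coefficient splits accordingly and is combined with the lifts of that half. Because these
    -- lifts agree with the `g j` along the section, level `N` is cancelled and only higher levels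
    -- appear.
    let c₁ : κ → AddMonoidAlgebra ℂ M := fun j => part (nonnegOn (upperCut s m₀) : Set M) (c j)
    let c₂ : κ → AddMonoidAlgebra ℂ M := fun j => c j - c₁ j
    have hc₁ : ∀ j, c₁ j ∈ suppIn (S ∩ posOn (upperCut s m₀)) := fun j =>
      mem_suppIn_of_subset (part_mem_suppIn (hc j)) fun m hm =>
        ⟨hm.1, hm.2, fun h => hm.1.2.1 (zeroOn_of_upperCut h hpos hneg)⟩
    have hc₂ : ∀ j, c₂ j ∈ suppIn (S ∩ posOn (upperCut s (-m₀))) := fun j =>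
      mem_suppIn_of_subset (sub_part_mem_suppIn (hc j)) fun m hm =>
        ⟨hm.1, (nonnegOn_upperCut_or hm.1.1).resolve_left hm.2,
          fun h => hm.1.2.1 (zeroOn_of_upperCut h hpos' hneg')⟩
    have hstep : ∀ (x : M), x ∈ S → ∀ y, y ∈ nonnegOn (middleCut s m₀) →
        y ∉ zeroOn (middleCut s m₀) →
        x + y ∈ {m | m ∈ nonnegOn (middleCut s m₀) ∧ m ∉ zeroOn s ∧ ((N + 1 : ℕ) : ℤ) ≤ U m} := by
      intro x hx y hy hy0
      have h1 : 0 < U y := (posOn_iff hy).1 hy0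
      have h2 : ((N + 1 : ℕ) : ℤ) ≤ U (x + y) := by
        rw [map_add, hx.2.2]
        push_cast
        omega
      refine ⟨add_mem hx.1 hy, fun h => ?_, h2⟩
      have h3 : U (x + y) = 0 :=
        (sum_apply_eq_zero_iff (add_mem hx.1 hy)).2 (zeroOn_middleCut (m₀ := m₀) h)
      push_cast at h2
      omega
    refine ⟨a + ∑ j, c₁ j * F j, add_mem haI (sum_mem fun j _ => I.mul_mem_left _ (hFI j)),
      add_mem ha (sum_mem fun j _ => mul_mem_suppIn (hc₁ j) (lift_mem_suppIn_upperCut hg (hF j))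
        fun x hx y hy => by rw [add_comm]; exact add_mem_posOn hy hx.2),
      b + ∑ j, c₂ j * G j, add_mem hbI (sum_mem fun j _ => I.mul_mem_left _ (hGI j)),
      add_mem hb (sum_mem fun j _ => mul_mem_suppIn (hc₂ j) (lift_mem_suppIn_upperCut hg (hG j))
        fun x hx y hy => by rw [add_comm]; exact add_mem_posOn hy hx.2),
      p' - (∑ j, c₁ j * F j + ∑ j, c₂ j * G j), sub_mem hp'I (add_mem
        (sum_mem fun j _ => I.mul_mem_left _ (hFI j))
        (sum_mem fun j _ => I.mul_mem_left _ (hGI j))), ?_, by ring⟩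
    have hsplit : p' - (∑ j, c₁ j * F j + ∑ j, c₂ j * G j) =
        (p' - part {m | U m = N} p') -
          (∑ j, c₁ j * (F j - g j) + ∑ j, c₂ j * (G j - g j)) := by
      rw [hcsum]
      simp only [c₂, mul_sub, sub_mul, Finset.sum_sub_distrib]
      abel
    rw [hsplit]
    refine sub_mem (mem_suppIn_of_subset (sub_part_mem_suppIn hp') fun m hm =>
      ⟨hm.1.1, hm.1.2.1, ?_⟩) (add_mem
        (sum_mem fun j _ => mul_mem_suppIn (hc₁ j) (hF j) fun x hx y hy =>
          hstep x hx.1 y (nonnegOn_middleCut hy.1) hy.2)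
        (sum_mem fun j _ => mul_mem_suppIn (hc₂ j) (hG j) fun x hx y hy =>
          hstep x hx.1 y (middleCut_neg (s := s) ▸ nonnegOn_middleCut hy.1) hy.2))
    have h1 := hm.1.2.2
    have h2 : U m ≠ N := hm.2
    push_cast
    omega

variable (s m₀) in
lemma nonnegOn_le_middleCut : nonnegOn s ≤ nonnegOn (middleCut s m₀) :=
  fun _ hm => nonnegOn_middleCut (nonnegOn_upperCut hm)

variable (s) in
/-- The ideal of `ℂ[nonnegOn s]` generated by the exponents that do not vanish on `s`. -/
def posIdeal : Ideal (monoidSubalgebra (nonnegOn s)) where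
  carrier := {f | f.1 ∈ suppIn (posOn s)}
  zero_mem' := zero_mem (suppIn (posOn s))
  add_mem' := fun hf hg => (suppIn (posOn s)).add_mem hf hg
  smul_mem' := fun c _ hf => mul_mem_suppIn c.2 hf fun _ ha _ hb => add_mem_posOn ha hb

lemma mem_posIdeal {f : monoidSubalgebra (nonnegOn s)} :
    f ∈ posIdeal s ↔ f.1 ∈ suppIn (posOn s) := Iff.rfl

/-- The monomial `ξ^m` as an element of the algebra of a monoid of exponents. -/
def monomialIn {D : AddSubmonoid M} {m : M} (hm : m ∈ D) : monoidSubalgebra D :=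
  ⟨.single m 1, single_mem_suppIn hm 1⟩

lemma monomialIn_add {D : AddSubmonoid M} {a b : M} (ha : a ∈ D) (hb : b ∈ D)
    (hab : a + b ∈ D) : monomialIn hab = monomialIn ha * monomialIn hb :=
  Subtype.ext (by simp [monomialIn, AddMonoidAlgebra.single_mul_single])

/-- Monomials of high order along an integral functional that is positive on the positive exponents
lie in a high power of the ideal of positive exponents. -/
lemma exists_monomialIn_mem_posIdeal_pow [Module.Finite ℤ M] (U : M →+ ℤ)
    (hU : ∀ m ∈ zeroOn s, U m = 0) :
    ∃ C : ℕ, ∀ m, ∀ hm : m ∈ nonnegOn s, ∃ j : ℕ,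
      monomialIn hm ∈ posIdeal s ^ j ∧ U m ≤ C * j := by
  classical
  obtain ⟨T, hT⟩ := nonnegOn_fg s
  -- Each monoid generator not in `zeroOn s` contributes one power of the ideal and at most this
  -- constant to `U`; the others contribute nothing to `U`.
  refine ⟨∑ t ∈ T, (U t).natAbs, fun m hm => ?_⟩
  have hm' := hm
  rw [← hT] at hm'
  induction hm' using AddSubmonoid.closure_induction with
  | mem t ht =>
    by_cases h0 : t ∈ zeroOn s
    · exact ⟨0, by simp, by simp [hU t h0]⟩
    · refine ⟨1, ?_, ?_⟩
      · rw [pow_one]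
        exact mem_posIdeal.2 (single_mem_suppIn (show t ∈ posOn s from ⟨hm, h0⟩) 1)
      · have : (U t).natAbs ≤ ∑ t ∈ T, (U t).natAbs :=
          Finset.single_le_sum (f := fun t => (U t).natAbs) (fun _ _ => Nat.zero_le _) ht
        omega
  | zero => exact ⟨0, by simp, by simp⟩
  | add x y hx hy ihx ihy =>
    have hx' : x ∈ nonnegOn s := hT ▸ hx
    have hy' : y ∈ nonnegOn s := hT ▸ hy
    obtain ⟨j, hj, hj'⟩ := ihx hx'
    obtain ⟨k, hk, hk'⟩ := ihy hy'
    refine ⟨j + k, ?_, ?_⟩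
    · rw [monomialIn_add hx' hy', pow_add]
      exact Ideal.mul_mem_mul hj hk
    · rw [map_add]
      push_cast at hj' hk' ⊢
      linarith

end Glue

/-! ### Finiteness modulo the two halves, and merging of lifts -/

section Merge

variable {M : Type} [AddCommGroup M] {κ : Type} {I J : Ideal (AddMonoidAlgebra ℂ M)}
  {g : κ → AddMonoidAlgebra ℂ M} {s : Finset (M →+ ℤ)} {m₀ : M}

lemma mem_of_forall_single_mem {D : AddSubmonoid M} {T : Type} [SetLike T (monoidSubalgebra D)]
    [AddSubmonoidClass T (monoidSubalgebra D)] (W : T) (c : monoidSubalgebra D)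
    (h : ∀ m (hm : m ∈ D), c.1.coeff m ≠ 0 →
      (⟨.single m (c.1.coeff m), single_mem_suppIn hm _⟩ : monoidSubalgebra D) ∈ W) : c ∈ W := by
  have hD : ∀ x : c.1.coeff.support, x.1 ∈ D := fun x => c.2 x.1 (Finsupp.mem_support_iff.1 x.2)
  have hc : c = ∑ x : c.1.coeff.support,
      (⟨.single x.1 (c.1.coeff x.1), single_mem_suppIn (hD x) _⟩ : monoidSubalgebra D) := by
    apply Subtype.ext
    rw [AddSubmonoidClass.coe_finsetSum]
    conv_lhs => rw [eq_sum_single c.1, ← Finset.sum_coe_sort]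
  rw [hc]
  exact sum_mem fun x _ => h _ (hD x) (Finsupp.mem_support_iff.1 x.2)

lemma eventually_single_mul_mem_posOn_upperCut (hpos : ∃ n ∈ s, 0 < n m₀) {r : M}
    (hr : r ∈ nonnegOn (middleCut s m₀)) {p : AddMonoidAlgebra ℂ M}
    (hp : p ∈ suppIn (nonnegOn (middleCut s m₀) : Set M)) :
    ∀ᶠ b : ℤ in Filter.atTop,
      AddMonoidAlgebra.single (r + b • m₀) 1 * p ∈ suppIn (posOn (upperCut s m₀)) := by
  have h : ∀ᶠ b : ℤ in Filter.atTop, ∀ m ∈ p.coeff.support,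
      (r + m) + b • m₀ ∈ posOn (upperCut s m₀) := by
    rw [Filter.eventually_all_finset]
    intro m hm
    obtain ⟨b₀, hb₀⟩ := exists_forall_add_mem_posOn_upperCut hpos
      (add_mem hr (hp m (by simpa using hm)))
    exact Filter.eventually_atTop.2 ⟨b₀, hb₀⟩
  filter_upwards [h] with b hb
  refine mul_mem_suppIn (S := {r + b • m₀}) (T := {m | p.coeff m ≠ 0})
    (single_mem_suppIn (Set.mem_singleton _) 1) (fun m hm => hm) ?_
  rintro _ rfl m hm
  rw [add_right_comm]
  exact hb m (by simpa using hm)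

variable (s m₀) in
instance cutAlgebra : Algebra (monoidSubalgebra (nonnegOn s))
    (monoidSubalgebra (nonnegOn (middleCut s m₀))) :=
  (Subalgebra.inclusion (monoidSubalgebra_mono (nonnegOn_le_middleCut s m₀))).toRingHom.toAlgebra

lemma coe_cut_smul (r : monoidSubalgebra (nonnegOn s))
    (x : monoidSubalgebra (nonnegOn (middleCut s m₀))) : (r • x).1 = r.1 * x.1 := rfl

lemma coe_cut_algebraMap (r : monoidSubalgebra (nonnegOn s)) :
    (algebraMap _ (monoidSubalgebra (nonnegOn (middleCut s m₀))) r).1 = r.1 := rfl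

variable (I s m₀) in
/-- The sums of elements of `I` that are positive on one of the two halves of a cone. -/
def cutSubmodule : Submodule (monoidSubalgebra (nonnegOn s))
    (monoidSubalgebra (nonnegOn (middleCut s m₀))) where
  carrier := {x | ∃ a ∈ I, a ∈ suppIn (posOn (upperCut s m₀)) ∧
    ∃ b ∈ I, b ∈ suppIn (posOn (upperCut s (-m₀))) ∧ x.1 = a + b}
  zero_mem' := ⟨0, zero_mem _, zero_mem _, 0, zero_mem _, zero_mem _, by simp⟩
  add_mem' := by
    rintro x y ⟨a, ha, ha', b, hb, hb', hx⟩ ⟨c, hc, hc', d, hd, hd', hy⟩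
    refine ⟨a + c, add_mem ha hc, add_mem ha' hc', b + d, add_mem hb hd, add_mem hb' hd', ?_⟩
    rw [AddMemClass.coe_add, hx, hy]
    ring
  smul_mem' := by
    rintro r x ⟨a, ha, ha', b, hb, hb', hx⟩
    refine ⟨r.1 * a, I.mul_mem_left _ ha, mul_mem_suppIn r.2 ha' fun x hx y hy =>
      add_mem_posOn (nonnegOn_upperCut hx) hy, r.1 * b, I.mul_mem_left _ hb,
      mul_mem_suppIn r.2 hb' fun x hx y hy => add_mem_posOn (nonnegOn_upperCut hx) hy, ?_⟩
    rw [coe_cut_smul, hx, mul_add]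

lemma mem_cutSubmodule {x : monoidSubalgebra (nonnegOn (middleCut s m₀))} :
    x ∈ cutSubmodule I s m₀ ↔ ∃ a ∈ I, a ∈ suppIn (posOn (upperCut s m₀)) ∧
      ∃ b ∈ I, b ∈ suppIn (posOn (upperCut s (-m₀))) ∧ x.1 = a + b := Iff.rfl

variable (I s m₀) in
/-- The elements of `I` that are non-negative along the hyperplane section. -/
def middleIdeal : Ideal (monoidSubalgebra (nonnegOn (middleCut s m₀))) :=
  I.comap (monoidSubalgebra (nonnegOn (middleCut s m₀))).val

/-- Translation by a large positive multiple of `m₀` makes `p` positive on the upper half, and by a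
large negative one on the lower half. Only finitely many translates remain. -/
lemma exists_monomialIn_mul_mem_cutSubmodule [Module.Finite ℤ M] (hpos : ∃ n ∈ s, 0 < n m₀)
    (hneg : ∃ n ∈ s, n m₀ < 0) {r : M} (hr : r ∈ nonnegOn (middleCut s m₀))
    {p : monoidSubalgebra (nonnegOn (middleCut s m₀))} (hp : p ∈ middleIdeal I s m₀)
    (hb : ∀ b : ℤ, r + b • m₀ ∈ nonnegOn (middleCut s m₀)) :
    ∃ G : Set (monoidSubalgebra (nonnegOn (middleCut s m₀))), G.Finite ∧
      ∀ b : ℤ, monomialIn (hb b) * p ∈ cutSubmodule I s m₀ ∨ monomialIn (hb b) * p ∈ G := by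
  obtain ⟨hpos', hneg'⟩ := neg_sides hpos hneg
  obtain ⟨B, hB⟩ := Filter.eventually_atTop.1
    (eventually_single_mul_mem_posOn_upperCut hpos hr p.2)
  obtain ⟨B', hB'⟩ := Filter.eventually_atTop.1 (eventually_single_mul_mem_posOn_upperCut hpos'
    (by rw [middleCut_neg]; exact hr) (show p.1 ∈ _ by rw [middleCut_neg]; exact p.2))
  refine ⟨(fun b : ℤ => monomialIn (hb b) * p) '' Set.Icc (-B') B, (Set.finite_Icc _ _).image _,
    fun b => ?_⟩
  rcases le_or_gt B b with h | h
  · exact Or.inl (mem_cutSubmodule.2 ⟨_, I.mul_mem_left _ hp, hB b h, 0, zero_mem _, zero_mem _,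
      (add_zero _).symm⟩)
  rcases le_or_gt B' (-b) with h' | h'
  · have := hB' (-b) h'
    rw [neg_smul_neg] at this
    exact Or.inl (mem_cutSubmodule.2 ⟨0, zero_mem _, zero_mem _, _, I.mul_mem_left _ hp, this,
      (zero_add _).symm⟩)
  · exact Or.inr ⟨b, ⟨by omega, h.le⟩, rfl⟩

/-- The larger ring is spanned over the smaller one by the monomials with exponents `r + b • m₀`,
for finitely many `r`. Multiplied by ideal generators, all but finitely many of these fall into
`cutSubmodule`. -/
lemma exists_finite_middleIdeal_le [Module.Finite ℤ M] (hpos : ∃ n ∈ s, 0 < n m₀)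
    (hneg : ∃ n ∈ s, n m₀ < 0) :
    ∃ G : Set (monoidSubalgebra (nonnegOn (middleCut s m₀))), G.Finite ∧
      (middleIdeal I s m₀).restrictScalars (monoidSubalgebra (nonnegOn s)) ≤
        cutSubmodule I s m₀ ⊔ Submodule.span _ G := by
  have := isNoetherianRing_monoidSubalgebra (nonnegOn_fg (middleCut s m₀))
  obtain ⟨P, hP⟩ : (middleIdeal I s m₀).FG := IsNoetherian.noetherian _
  have hPI : ∀ p : P, p.1 ∈ middleIdeal I s m₀ := fun p => hP ▸ Submodule.subset_span p.2
  obtain ⟨R, hR, hRdec⟩ := exists_finset_middleCut hpos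
  have hmult : ∀ (r : R) (b : ℤ), r.1 + b • m₀ ∈ nonnegOn (middleCut s m₀) :=
    fun r b => add_mem (hR r r.2) (zeroOn_le_nonnegOn (zsmul_mem self_mem_zeroOn_middleCut b))
  choose G hGfin hG using fun (r : R) (p : P) =>
    exists_monomialIn_mul_mem_cutSubmodule hpos hneg (hR r r.2) (hPI p) (hmult r)
  refine ⟨⋃ (r : R) (p : P), G r p, Set.finite_iUnion fun r => Set.finite_iUnion (hGfin r), ?_⟩
  set W := cutSubmodule I s m₀ ⊔
    Submodule.span (monoidSubalgebra (nonnegOn s)) (⋃ (r : R) (p : P), G r p) with hW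
  have hgen : ∀ (p : P) (r : R) (b : ℤ), monomialIn (hmult r b) * p.1 ∈ W := by
    intro p r b
    rcases hG r p b with h | h
    · exact Submodule.mem_sup_left h
    · exact Submodule.mem_sup_right
        (Submodule.subset_span (Set.mem_iUnion_of_mem r (Set.mem_iUnion_of_mem p h)))
  intro x hx
  have hx' : x ∈ Submodule.span _ (P : Set (monoidSubalgebra (nonnegOn (middleCut s m₀)))) :=
    hP ▸ hx
  obtain ⟨c, -, rfl⟩ := Submodule.mem_span_finset.1 hx'
  refine sum_mem fun p hp => mem_of_forall_single_mem (W.toAddSubmonoid.comap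
      (AddMonoidHom.mulRight p)) (c p) fun m hm _ => ?_
  generalize (c p).1.coeff m = y
  obtain ⟨r, hr, k, hk, b, rfl⟩ := hRdec m hm
  have hmem := W.smul_mem (⟨.single k y, single_mem_suppIn hk _⟩ : monoidSubalgebra (nonnegOn s))
    (hgen ⟨p, hp⟩ ⟨r, hr⟩ b)
  have heq : (⟨.single (k + (r + b • m₀)) y, single_mem_suppIn hm _⟩ :
      monoidSubalgebra (nonnegOn (middleCut s m₀))) * p =
      (⟨.single k y, single_mem_suppIn hk _⟩ : monoidSubalgebra (nonnegOn s)) •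
        (monomialIn (hmult ⟨r, hr⟩ b) * p) := by
    apply Subtype.ext
    rw [coe_cut_smul]
    simp [monomialIn, ← mul_assoc, AddMonoidAlgebra.single_mul_single]
  change _ * p ∈ W
  rw [heq]
  exact hmem

/-- Elements of high order along the hyperplane section lie in a high power of the ideal of positive
exponents. -/
lemma exists_mem_map_posIdeal_pow [Module.Finite ℤ M] (hpos : ∃ n ∈ s, 0 < n m₀) (N : ℕ) :
    ∃ N' : ℕ, ∀ p : monoidSubalgebra (nonnegOn (middleCut s m₀)),
      (∀ m, p.1.coeff m ≠ 0 → (N' : ℤ) ≤ (∑ n ∈ middleCut s m₀, n) m) →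
      p ∈ (posIdeal s).map (algebraMap _ (monoidSubalgebra (nonnegOn (middleCut s m₀)))) ^ N := by
  obtain ⟨R, hR, hRdec⟩ := exists_finset_middleCut hpos
  obtain ⟨C, hC⟩ := exists_monomialIn_mem_posIdeal_pow (s := s) (∑ n ∈ middleCut s m₀, n)
    fun m hm => (sum_apply_eq_zero_iff (zeroOn_le_nonnegOn (zeroOn_middleCut hm))).2
      (zeroOn_middleCut hm)
  have hUm₀ : (∑ n ∈ middleCut s m₀, n) m₀ = 0 :=
    (sum_apply_eq_zero_iff (zeroOn_le_nonnegOn self_mem_zeroOn_middleCut)).2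
      self_mem_zeroOn_middleCut
  generalize (∑ n ∈ middleCut s m₀, n) = U at hC hUm₀
  have hK : ∀ r ∈ R, U r ≤ (∑ r ∈ R, (U r).natAbs : ℕ) := fun r hr => by
    have : (U r).natAbs ≤ ∑ r ∈ R, (U r).natAbs :=
      Finset.single_le_sum (f := fun r => (U r).natAbs) (fun _ _ => Nat.zero_le _) hr
    omega
  generalize (∑ r ∈ R, (U r).natAbs : ℕ) = K at hK
  -- In `m = k + (r + b • m₀)`, the multiple of `m₀` has order zero and `r` has order at most `K`.
  -- Thus `k` has order above `C * N`, which forces more than `N` factors in the ideal.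
  refine ⟨C * N + K + 1, fun p hp => mem_of_forall_single_mem _ _ fun m hm hm0 => ?_⟩
  have hm2 := hp m hm0
  generalize p.1.coeff m = y
  obtain ⟨r, hr, k, hk, b, rfl⟩ := hRdec m hm
  have hrb : r + b • m₀ ∈ nonnegOn (middleCut s m₀) :=
    add_mem (hR r hr) (zeroOn_le_nonnegOn (zsmul_mem self_mem_zeroOn_middleCut b))
  obtain ⟨j, hj, hj'⟩ := hC k hk
  rw [map_add, map_add, map_zsmul, hUm₀, smul_zero, add_zero] at hm2
  have h1 := hK r hr
  have h2 : (C : ℤ) * N < C * j := by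
    push_cast at hm2 hj'
    linarith
  have h3 : N < j := by
    have := lt_of_mul_lt_mul_left h2 (by positivity)
    exact_mod_cast this
  have heq : (⟨.single (k + (r + b • m₀)) y, single_mem_suppIn hm _⟩ :
      monoidSubalgebra (nonnegOn (middleCut s m₀))) =
      algebraMap _ (monoidSubalgebra (nonnegOn (middleCut s m₀))) (monomialIn hk) *
        ⟨.single (r + b • m₀) y, single_mem_suppIn hrb _⟩ := by
    apply Subtype.ext
    rw [MulMemClass.coe_mul, coe_cut_algebraMap]
    simp [monomialIn, AddMonoidAlgebra.single_mul_single]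
  rw [heq, ← Ideal.map_pow]
  exact Ideal.mul_mem_right _ _ (Ideal.mem_map_of_mem _ (Ideal.pow_le_pow_right h3.le hj))

/-- If the generators of the initial ideal lift over the two halves of a cone, and over the
hyperplane section, then they lift over the cone. -/
theorem HasLifts.of_cut [Module.Finite ℤ M] [Fintype κ] (hJ : J = Ideal.span (Set.range g))
    (hg : ∀ i, g i ∈ suppIn (zeroOn s : Set M))
    (hconst : ∀ u ∈ relInt (middleCut s m₀), initialIdeal u I = J)
    (hpos : ∃ n ∈ s, 0 < n m₀) (hneg : ∃ n ∈ s, n m₀ < 0)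
    (hup : HasLifts I g (upperCut s m₀)) (hdn : HasLifts I g (upperCut s (-m₀)))
    (hmid : HasLifts I g (middleCut s m₀)) : HasLifts I g s := by
  classical
  obtain ⟨hpos', hneg'⟩ := neg_sides hpos hneg
  have hup' := exists_lifts_upperCut hJ hg hconst hpos hneg hup hmid
  have hdn' := exists_lifts_upperCut (m₀ := -m₀) hJ hg (by rwa [middleCut_neg]) hpos' hneg' hdn
    (by rwa [middleCut_neg])
  rw [middleCut_neg] at hdn'
  intro i
  obtain ⟨f₁, hf₁I, hf₁⟩ := hup' i
  obtain ⟨f₂, hf₂I, hf₂⟩ := hdn' i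
  have hmid₁ : ∀ m ∈ nonnegOn (upperCut s m₀), m ∈ nonnegOn (middleCut s m₀) :=
    fun m hm => nonnegOn_middleCut hm
  have hmid₂ : ∀ m ∈ nonnegOn (upperCut s (-m₀)), m ∈ nonnegOn (middleCut s m₀) :=
    fun m hm => middleCut_neg (s := s) ▸ nonnegOn_middleCut hm
  have hp : f₁ - f₂ ∈ suppIn {m | m ∈ nonnegOn (middleCut s m₀) ∧ m ∉ zeroOn s} := by
    rw [← sub_sub_sub_cancel_right f₁ f₂ (g i)]
    exact sub_mem
      (mem_suppIn_of_subset hf₁ fun m hm => ⟨hmid₁ m hm.1, fun h => hm.2 (zeroOn_middleCut h)⟩)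
      (mem_suppIn_of_subset hf₂ fun m hm => ⟨hmid₂ m hm.1, fun h => hm.2 (zeroOn_middleCut h)⟩)
  have hred := exists_reduction hJ hg hconst hpos hneg hup' hdn' (sub_mem hf₁I hf₂I) hp
  have := isNoetherianRing_monoidSubalgebra (nonnegOn_fg s)
  have := isNoetherianRing_monoidSubalgebra (nonnegOn_fg (middleCut s m₀))
  obtain ⟨G, hGfin, hG⟩ := exists_finite_middleIdeal_le (I := I) hpos hneg
  -- The two lifts differ by an element of `I` that is arbitrarily close to `cutSubmodule`; Krull's
  -- theorem gives exact membership after multiplication by `1 - r`.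
  obtain ⟨r, hr, hrL⟩ := exists_sub_smul_mem_of_forall_pow (posIdeal s) _ _ hGfin hG
    (p := ⟨f₁ - f₂, mem_suppIn_of_subset hp fun m hm => hm.1⟩) fun N => by
      obtain ⟨N', hN'⟩ := exists_mem_map_posIdeal_pow hpos N
      obtain ⟨a, haI, ha, b, hbI, hb, p', hp'I, hp', h⟩ := hred N'
      refine ⟨⟨p', mem_suppIn_of_subset hp' fun m hm => hm.1⟩,
        ⟨hp'I, hN' _ fun m hm => (hp' m hm).2.2⟩, mem_cutSubmodule.2 ⟨a, haI, ha, b, hbI, hb, ?_⟩⟩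
      change f₁ - f₂ - p' = a + b
      rw [h]
      ring
  obtain ⟨a, haI, ha, b, hbI, hb, hab⟩ := mem_cutSubmodule.1 hrL
  have hab : (f₁ - f₂) - r.1 * (f₁ - f₂) = a + b := hab
  have hrpos : r.1 ∈ suppIn (posOn s) := hr
  have hf₁s : f₁ ∈ suppIn (nonnegOn (upperCut s m₀) : Set M) := lift_mem_suppIn_upperCut hg hf₁
  have hf₂s : f₂ ∈ suppIn (nonnegOn (upperCut s (-m₀)) : Set M) := lift_mem_suppIn_upperCut hg hf₂
  have key : ∀ (m' : M) (f h : AddMonoidAlgebra ℂ M), (∃ n ∈ s, 0 < n m') → (∃ n ∈ s, n m' < 0) →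
      f ∈ suppIn (nonnegOn (upperCut s m') : Set M) →
      f - g i ∈ suppIn {m | m ∈ nonnegOn (upperCut s m') ∧ m ∉ zeroOn (middleCut s m₀)} →
      h ∈ suppIn (posOn (upperCut s m')) → f - r.1 * f - h - g i ∈ suppIn (posOn (upperCut s m')) := by
    intro m' f h hp' hn' hf hfg hh
    rw [show f - r.1 * f - h - g i = (f - g i) - r.1 * f - h by ring]
    refine sub_mem (sub_mem (mem_suppIn_of_subset hfg fun m hm => ⟨hm.1, fun h0 => hm.2
      (zeroOn_middleCut (zeroOn_of_upperCut h0 hp' hn'))⟩)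
      (mul_mem_suppIn hrpos hf fun x hx y hy => ?_)) hh
    rw [add_comm]
    exact add_mem_posOn hy ⟨nonnegOn_upperCut hx.1, fun h0 => hx.2 (zeroOn_of_upperCut h0 hp' hn')⟩
  have h1 := key m₀ f₁ a hpos hneg hf₁s hf₁ ha
  have h2 := key (-m₀) f₂ (-b) hpos' hneg' hf₂s hf₂ (neg_mem hb)
  -- This equals `f₂ - r * f₂ + b`, so it is a lift over both halves. The factor `1 - r` is
  -- harmless, as `r` is positive on the cone.
  refine ⟨f₁ - r.1 * f₁ - a, sub_mem (sub_mem hf₁I (I.mul_mem_left _ hf₁I)) haI, ?_⟩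
  rw [show f₂ - r.1 * f₂ - -b - g i = f₁ - r.1 * f₁ - a - g i by linear_combination -hab] at h2
  exact fun m hm => ⟨nonnegOn_of_upperCut (h1 m hm).1 (h2 m hm).1,
    fun h0 => (h1 m hm).2 (zeroOn_upperCut h0)⟩

end Merge

/-! ### Existence of lifts -/

section Existence

variable {M : Type} [AddCommGroup M] {κ : Type} {I J : Ideal (AddMonoidAlgebra ℂ M)}
  {g : κ → AddMonoidAlgebra ℂ M} {s : Finset (M →+ ℤ)} {m₀ : M}

/-- The exponent `m` does not change sign on the cone generated by `s`. -/
def ConstSign (s : Finset (M →+ ℤ)) (m : M) : Prop := m ∈ nonnegOn s ∨ -m ∈ nonnegOn s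

/-- Divide `f` by a monomial of minimal order at the interior point `∑ n ∈ s, n`. As differences of
exponents do not change sign on the cone, this monomial is minimal on the whole cone. -/
lemma exists_shift {f : AddMonoidAlgebra ℂ M} (hf : f ∈ I)
    (hsign : ∀ m m', f.coeff m ≠ 0 → f.coeff m' ≠ 0 → ConstSign s (m - m')) :
    ∃ f' ∈ I, f' ∈ suppIn (nonnegOn s : Set M) ∧
      initialForm (latticeToReal (∑ n ∈ s, n)) f ∈
        Ideal.span {part (zeroOn s : Set M) f'} := by
  rcases eq_or_ne f 0 with rfl | hf0
  · exact ⟨0, zero_mem _, zero_mem _, by rw [initialForm_zero]; exact zero_mem _⟩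
  obtain ⟨m₁, hm₁, hmin, hin⟩ := exists_initialForm_eq_part (latticeToReal (∑ n ∈ s, n)) hf0
  have hsupp : AddMonoidAlgebra.single (-m₁) 1 * f ∈ suppIn (nonnegOn s : Set M) := by
    intro m hm
    rw [coeff_single_mul, one_mul, sub_neg_eq_add] at hm
    rcases hsign _ _ hm hm₁ with h | h
    · simpa using h
    · rw [add_sub_cancel_right] at h
      have h1 : (∑ n ∈ s, n) m₁ ≤ (∑ n ∈ s, n) (m + m₁) := 
        (Int.cast_le (R := ℝ)).1 (hmin _ hm)
      have h2 := sum_apply_nonneg h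
      rw [map_add] at h1
      rw [map_neg] at h2
      have h3 := (sum_apply_eq_zero_iff h).1 (by rw [map_neg]; omega)
      exact zeroOn_le_nonnegOn ((zeroOn s).neg_mem_iff.1 h3)
  refine ⟨_, I.mul_mem_left _ hf, hsupp, ?_⟩
  rw [Ideal.mem_span_singleton]
  refine ⟨.single m₁ 1, ?_⟩
  ext m
  classical
  rw [mul_comm, coeff_single_mul, one_mul, hin, coeff_part, coeff_part, coeff_single_mul, one_mul,
    sub_neg_eq_add, sub_add_cancel]
  by_cases hm : f.coeff m = 0
  · simp [hm]
  refine if_congr ?_ rfl rfl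
  have hm' : m - m₁ ∈ nonnegOn s := hsupp _ (by
    rw [coeff_single_mul, one_mul, sub_neg_eq_add, sub_add_cancel]
    exact hm)
  rw [SetLike.mem_coe, ← sum_apply_eq_zero_iff hm', map_sub, sub_eq_zero]
  exact Int.cast_inj

/-- Lifts exist over a cone on which the differences of exponents of a universal basis do not change
sign. -/
lemma hasLifts_of_constSign {U : Finset (AddMonoidAlgebra ℂ M)}
    (hUI : (U : Set (AddMonoidAlgebra ℂ M)) ⊆ I)
    (hU : ∀ w : M →+ ℝ, initialIdeal w I =
      Ideal.span (initialForm w '' (U : Set (AddMonoidAlgebra ℂ M))))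
    (hconst : ∀ u ∈ relInt s, initialIdeal u I = J)
    (hg : ∀ i, g i ∈ suppIn (zeroOn s : Set M)) (hgJ : ∀ i, g i ∈ J)
    (hsign : ∀ f ∈ U, ∀ m m', f.coeff m ≠ 0 → f.coeff m' ≠ 0 → ConstSign s (m - m')) :
    HasLifts I g s := by
  choose F hFI hFs hF using fun f : U => exists_shift (hUI f.2) (hsign f f.2)
  -- The lowest parts of the shifted universal basis generate `J`. Writing `g i` with coefficients
  -- supported on `zeroOn s` and replacing these parts by the full elements gives the lift.
  have hJ : J = Ideal.span (Set.range fun f : U => part (zeroOn s : Set M) (F f)) := by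
    apply le_antisymm
    · rw [← hconst _ (sum_mem_relInt s), hU, Ideal.span_le]
      rintro _ ⟨f, hf, rfl⟩
      exact Ideal.span_mono (Set.singleton_subset_iff.2 (Set.mem_range_self (⟨f, hf⟩ : U)))
        (hF ⟨f, hf⟩)
    · rw [Ideal.span_le]
      rintro _ ⟨f, rfl⟩
      exact part_zeroOn_mem hconst (hFI f) (hFs f)
  intro i
  obtain ⟨c, hc, hsum⟩ := exists_coefficients hJ
    (fun f => suppIn_mono Set.inter_subset_right (part_mem_suppIn (hFs f)))
    (S := zeroOn s) (fun m z hz => zeroOn_add_mem_iff hz) (hgJ i) (hg i)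
  refine ⟨∑ f, c f * F f, sum_mem fun f _ => I.mul_mem_left _ (hFI f), ?_⟩
  rw [hsum, ← Finset.sum_sub_distrib]
  refine sum_mem fun f _ => ?_
  rw [← mul_sub]
  exact mul_mem_suppIn (hc f) (sub_part_mem_suppIn (hFs f))
    fun a ha b hb => add_mem_posOn (zeroOn_le_nonnegOn ha) hb

lemma self_mem_nonnegOn_upperCut : m₀ ∈ nonnegOn (upperCut s m₀) := by
  intro n hn
  rcases mem_upperCut.1 hn with h | h
  · exact h.2
  · exact (self_mem_zeroOn_middleCut n (mem_middleCut.2 (Or.inr h))).ge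

lemma ConstSign.upperCut {m : M} (h : ConstSign s m) : ConstSign (upperCut s m₀) m :=
  h.imp nonnegOn_upperCut nonnegOn_upperCut

lemma ConstSign.middleCut {m : M} (h : ConstSign s m) : ConstSign (middleCut s m₀) m :=
  h.imp (fun h => nonnegOn_middleCut (nonnegOn_upperCut h))
    fun h => nonnegOn_middleCut (nonnegOn_upperCut h)

/-- The list holds the hyperplanes still to be cut along. Cutting along its head fixes the sign of
the head on all three pieces and keeps the signs already fixed, so the induction hypothesis applies
to each piece. -/
lemma hasLifts_of_list [Fintype κ] [Module.Finite ℤ M] {U : Finset (AddMonoidAlgebra ℂ M)}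
    (hUI : (U : Set (AddMonoidAlgebra ℂ M)) ⊆ I)
    (hU : ∀ w : M →+ ℝ, initialIdeal w I =
      Ideal.span (initialForm w '' (U : Set (AddMonoidAlgebra ℂ M))))
    (hJ : J = Ideal.span (Set.range g)) (H : List M) (s : Finset (M →+ ℤ))
    (hconst : ∀ u ∈ relInt s, initialIdeal u I = J)
    (hg : ∀ i, g i ∈ suppIn (zeroOn s : Set M))
    (hsign : ∀ f ∈ U, ∀ m m', f.coeff m ≠ 0 → f.coeff m' ≠ 0 →
      m - m' ∈ H ∨ ConstSign s (m - m')) :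
    HasLifts I g s := by
  induction H generalizing s with
  | nil =>
    exact hasLifts_of_constSign hUI hU hconst hg (fun i => hJ ▸ Ideal.subset_span ⟨i, rfl⟩)
      fun f hf m m' hm hm' => (hsign f hf m m' hm hm').resolve_left (by simp)
  | cons h H ih =>
    by_cases hs : ConstSign s h
    · refine ih s hconst hg fun f hf m m' hm hm' => ?_
      rcases hsign f hf m m' hm hm' with h' | h'
      · rcases List.mem_cons.1 h' with h' | h'
        · exact Or.inr (h' ▸ hs)
        · exact Or.inl h'
      · exact Or.inr h'
    have hpos : ∃ n ∈ s, 0 < n h := by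
      by_contra! hcon
      exact hs (Or.inr fun n hn => by simpa using hcon n hn)
    have hneg : ∃ n ∈ s, n h < 0 := by
      by_contra! hcon
      exact hs (Or.inl hcon)
    obtain ⟨hpos', hneg'⟩ := neg_sides hpos hneg
    have key : ∀ s', ConstSign s' h → (∀ m, ConstSign s m → ConstSign s' m) →
        ∀ f ∈ U, ∀ m m', f.coeff m ≠ 0 → f.coeff m' ≠ 0 → m - m' ∈ H ∨ ConstSign s' (m - m') := by
      intro s' h1 h2 f hf m m' hm hm'
      rcases hsign f hf m m' hm hm' with h' | h'
      · rcases List.mem_cons.1 h' with h' | h'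
        · exact Or.inr (h' ▸ h1)
        · exact Or.inl h'
      · exact Or.inr (h2 _ h')
    refine HasLifts.of_cut (m₀ := h) hJ hg
      (fun u hu => hconst u (relInt_middleCut_subset hpos hneg hu)) hpos hneg ?_ ?_ ?_
    · exact ih _ (fun u hu => hconst u (relInt_upperCut_subset hpos hneg hu))
        (fun i => mem_suppIn_of_subset (hg i) fun m hm => zeroOn_upperCut hm)
        (key _ (Or.inl self_mem_nonnegOn_upperCut) fun m hm => hm.upperCut)
    · exact ih _ (fun u hu => hconst u (relInt_upperCut_subset hpos' hneg' hu))
        (fun i => mem_suppIn_of_subset (hg i) fun m hm => zeroOn_upperCut hm)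
        (key _ (Or.inr self_mem_nonnegOn_upperCut) fun m hm => hm.upperCut)
    · exact ih _ (fun u hu => hconst u (relInt_middleCut_subset hpos hneg hu))
        (fun i => mem_suppIn_of_subset (hg i) fun m hm => zeroOn_middleCut hm)
        (key _ (Or.inl (zeroOn_le_nonnegOn self_mem_zeroOn_middleCut)) fun m hm => hm.middleCut)

/-- Unlike the sum of the generators, this point separates exponents modulo `zeroOn s`. Hence the
exponents of an initial form at this point lie in a single coset, and one monomial moves them all
into `zeroOn s`. -/
lemma exists_mem_relInt_generic (s : Finset (M →+ ℤ)) :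
    ∃ u ∈ relInt s, ∀ m, u m = 0 → m ∈ zeroOn s := by
  obtain ⟨c, hc, h⟩ := exists_generic_combination s
  have hval : ∀ m, (∑ n ∈ s, c n • latticeToReal n) m = ∑ n ∈ s, c n * n m := by
    intro m
    rw [AddMonoidHom.finsetSum_apply]
    rfl
  have hu : ∀ m, (∑ n ∈ s, c n • latticeToReal n) m = 0 → m ∈ zeroOn s := fun m hm =>
    h m (by rw [← hval, hm])
  refine ⟨∑ n ∈ s, c n • latticeToReal n, ⟨sum_mem fun n hn => ?_, fun m _ => hu m⟩, hu⟩
  exact Submodule.smul_mem _ (⟨c n, (hc n).le⟩ : {c : ℝ // 0 ≤ c})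
    (Submodule.subset_span ⟨n, hn, rfl⟩)

/-- The initial ideal along a cone is generated by Laurent polynomials whose exponents vanish on the
cone. -/
lemma exists_generators_zeroOn {U : Finset (AddMonoidAlgebra ℂ M)}
    (hU : ∀ w : M →+ ℝ, initialIdeal w I =
      Ideal.span (initialForm w '' (U : Set (AddMonoidAlgebra ℂ M))))
    (hconst : ∀ u ∈ relInt s, initialIdeal u I = J) :
    ∃ g : U → AddMonoidAlgebra ℂ M, (∀ i, g i ∈ suppIn (zeroOn s : Set M)) ∧
      J = Ideal.span (Set.range g) := by
  obtain ⟨u, hu, hu0⟩ := exists_mem_relInt_generic s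
  have key : ∀ f : AddMonoidAlgebra ℂ M, ∃ g ∈ suppIn (zeroOn s : Set M), ∃ m : M,
      AddMonoidAlgebra.single (-m) 1 * initialForm u f = g := by
    intro f
    rcases eq_or_ne f 0 with rfl | hf0
    · exact ⟨0, zero_mem _, 0, by rw [initialForm_zero, mul_zero]⟩
    obtain ⟨m₁, hm₁, hmin, hin⟩ := exists_initialForm_eq_part u hf0
    refine ⟨_, fun m hm => ?_, m₁, rfl⟩
    rw [coeff_single_mul, one_mul, sub_neg_eq_add, hin] at hm
    have : u (m + m₁) = u m₁ := (coeff_part_ne_zero.1 hm).1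
    exact hu0 m (by simpa using this)
  choose g hg m hm using key
  refine ⟨fun f => g f, fun f => hg f, ?_⟩
  rw [← hconst u hu, hU]
  apply le_antisymm
  · rw [Ideal.span_le]
    rintro _ ⟨f, hf, rfl⟩
    have : initialForm u f = .single (m f) 1 * g f := by
      rw [← hm, ← mul_assoc, AddMonoidAlgebra.single_mul_single, add_neg_cancel, mul_one,
        ← AddMonoidAlgebra.one_def, one_mul]
    rw [this]
    exact Ideal.mul_mem_left _ _ (Ideal.subset_span ⟨⟨f, hf⟩, rfl⟩)
  · rw [Ideal.span_le]
    rintro _ ⟨f, rfl⟩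
    change g f ∈ _
    rw [← hm]
    exact Ideal.mul_mem_left _ _ (Ideal.subset_span ⟨f.1, f.2, rfl⟩)

/-- If the initial ideal is constant on the relative interior of a cone, then it is generated by the
parts of lowest order of the elements of the ideal that are non-negative on the cone. -/
theorem initialIdeal_eq_span_part [Module.Free ℤ M] [Module.Finite ℤ M]
    (hconst : ∀ u ∈ relInt s, initialIdeal u I = J) :
    J = Ideal.span (part (zeroOn s : Set M) '' {f | f ∈ I ∧ f ∈ suppIn (nonnegOn s : Set M)}) := by
  classical
  obtain ⟨U, hUI, hU⟩ := exists_universal_basis I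
  obtain ⟨g, hg, hJ⟩ := exists_generators_zeroOn hU hconst
  let H : Finset M := U.biUnion fun f =>
    (f.coeff.support ×ˢ f.coeff.support).image fun x => x.1 - x.2
  have hH : ∀ f ∈ U, ∀ m m', f.coeff m ≠ 0 → f.coeff m' ≠ 0 → m - m' ∈ H.toList := by
    intro f hf m m' hm hm'
    rw [Finset.mem_toList]
    refine Finset.mem_biUnion.2 ⟨f, hf, Finset.mem_image.2 ⟨(m, m'), ?_, rfl⟩⟩
    simp [hm, hm']
  have hlift := hasLifts_of_list hUI hU hJ H.toList s hconst hg
    fun f hf m m' hm hm' => Or.inl (hH f hf m m' hm hm')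
  apply le_antisymm
  · rw [hJ, Ideal.span_le]
    rintro _ ⟨i, rfl⟩
    obtain ⟨f, hf, hfi⟩ := hlift i
    refine Ideal.subset_span ⟨f, ⟨hf, ?_⟩, ?_⟩
    · rw [← sub_add_cancel f (g i)]
      exact add_mem (mem_suppIn_of_subset hfi fun m hm => hm.1)
        (mem_suppIn_of_subset (hg i) fun m hm => zeroOn_le_nonnegOn hm)
    · have h1 := part_eq_self (hg i)
      have h2 := part_eq_zero (S := (zeroOn s : Set M)) hfi fun m hm => hm.2
      rw [map_sub, h1, sub_eq_zero] at h2
      exact h2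
  · rw [Ideal.span_le]
    rintro _ ⟨f, ⟨hf, hfs⟩, rfl⟩
    exact part_zeroOn_mem hconst hf hfs

end Existence

/-! ### The initial ideal along a rational cone -/

section Cone

variable {M : Type} [AddCommGroup M] {s : Finset (M →+ ℤ)}

lemma latticeToReal_mem_hull {n : M →+ ℤ} (hn : n ∈ s) :
    latticeToReal n ∈ PointedCone.hull ℝ (latticeToReal '' (s : Set (M →+ ℤ))) :=
  Submodule.subset_span ⟨n, hn, rfl⟩

lemma dualMonoid_hull :
    dualMonoid (PointedCone.hull ℝ (latticeToReal '' (s : Set (M →+ ℤ)))) = nonnegOn s := by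
  ext m
  refine ⟨fun h n hn => ?_, fun h => mem_dualMonoid_hull _ _ h⟩
  have := h _ (latticeToReal_mem_hull hn)
  simpa [latticeToReal] using this

lemma mem_perp_iff {σ : PointedCone ℝ (M →+ ℝ)} {m : M} :
    m ∈ perp σ ↔ m ∈ dualMonoid σ ∧ -m ∈ dualMonoid σ := by
  constructor
  · exact fun h => ⟨fun w hw => (h w hw).ge, fun w hw => by rw [map_neg, h w hw, neg_zero]⟩
  · rintro ⟨h, h'⟩ w hw
    have h1 := h w hw
    have h2 := h' w hw
    rw [map_neg] at h2
    linarith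

lemma perp_hull :
    perp (PointedCone.hull ℝ (latticeToReal '' (s : Set (M →+ ℤ)))) = zeroOn s := by
  ext m
  rw [mem_perp_iff, dualMonoid_hull]
  constructor
  · rintro ⟨h, h'⟩ n hn
    have h1 := h n hn
    have h2 := h' n hn
    rw [map_neg] at h2
    omega
  · exact fun h => ⟨zeroOn_le_nonnegOn h, zeroOn_le_nonnegOn (neg_mem h)⟩

/-- Only this inclusion is needed, to restrict the constancy hypothesis. -/
lemma relInt_subset_relInterior :
    relInt s ⊆ relInterior (PointedCone.hull ℝ (latticeToReal '' (s : Set (M →+ ℤ)))) := by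
  rintro u ⟨hu, hu0⟩
  refine ⟨hu, ?_⟩
  rintro τ ⟨m, hm, hτ⟩ huτ
  rw [dualMonoid_hull] at hm
  have h0 : m ∈ zeroOn s := hu0 m hm ((hτ u).1 huτ).2
  rw [← perp_hull] at h0
  ext w
  rw [hτ]
  exact ⟨fun h => h.1, fun h => ⟨h, h0 w h⟩⟩

/-- The ideal of `X̄ ∩ V_σ` in `V_σ`. -/
def chartIdeal (σ : PointedCone ℝ (M →+ ℝ)) (I : Ideal (AddMonoidAlgebra ℂ M)) :
    Ideal (AddMonoidAlgebra ℂ (dualMonoid σ)) :=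
  I.comap (AddMonoidAlgebra.mapDomainAlgHom ℂ ℂ (dualMonoid σ).subtype)

open Classical in
lemma orbitRingMap_single (σ : PointedCone ℝ (M →+ ℝ)) (m : dualMonoid σ) (c : ℂ) :
    orbitRingMap σ (.single m c) =
      if h : (m : M) ∈ perp σ then .single ⟨m, h⟩ c else 0 := by
  rw [orbitRingMap, AddMonoidAlgebra.lift_single]
  by_cases h : (m : M) ∈ perp σ <;> simp [h]

/-- This links geometry and combinatorics: restricting a function on the chart to the orbit is
truncation to σ^⊥. -/
lemma mapDomain_orbitRingMap (σ : PointedCone ℝ (M →+ ℝ)) (f : AddMonoidAlgebra ℂ (dualMonoid σ)) :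
    AddMonoidAlgebra.mapDomainAlgHom ℂ ℂ (perp σ).subtype (orbitRingMap σ f) =
      part (perp σ : Set M) (AddMonoidAlgebra.mapDomainAlgHom ℂ ℂ (dualMonoid σ).subtype f) := by
  induction f using AddMonoidAlgebra.induction_linear with
  | zero => simp
  | add f g hf hg => simp only [map_add, hf, hg]
  | single m c =>
    rw [orbitRingMap_single]
    split_ifs with h
    · rw [part_eq_self]
      · simp
      · simpa using single_mem_suppIn (S := (perp σ : Set M)) h c
    · rw [map_zero, part_eq_zero (T := {m.1})]
      · simpa using single_mem_suppIn (S := {m.1}) (Set.mem_singleton m.1) c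
      · rintro _ rfl
        exact h

/-- The initial ideal is generated by the ideal of the intersection of `X̄` with the orbit. -/
theorem initialIdeal_eq_map [Module.Free ℤ M] [Module.Finite ℤ M]
    {I : Ideal (AddMonoidAlgebra ℂ M)} {σ : PointedCone ℝ (M →+ ℝ)} (hσ : IsRationalPolyhedral σ)
    {w : M →+ ℝ} (h : ∀ u ∈ relInterior σ, initialIdeal u I = initialIdeal w I) :
    initialIdeal w I = ((chartIdeal σ I).map (orbitRingMap σ)).map
      (AddMonoidAlgebra.mapDomainAlgHom ℂ ℂ (perp σ).subtype) := by
  obtain ⟨s, hs⟩ := hσ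
  have hdual : dualMonoid σ = nonnegOn s := by rw [hs, dualMonoid_hull]
  have hperp : perp σ = zeroOn s := by rw [hs, perp_hull]
  rw [initialIdeal_eq_span_part (s := s) fun u hu => h u (hs ▸ relInt_subset_relInterior hu),
    ← hdual, ← hperp]
  change _ = Ideal.map (AddMonoidAlgebra.mapDomainAlgHom ℂ ℂ (perp σ).subtype).toRingHom
    (Ideal.map (orbitRingMap σ).toRingHom (chartIdeal σ I))
  rw [Ideal.map_map]
  refine congrArg Ideal.span (Set.ext fun x => ⟨?_, ?_⟩)
  · rintro ⟨f, ⟨hf, hfs⟩, rfl⟩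
    obtain ⟨f', rfl⟩ := exists_mapDomain_subtype_eq hfs
    exact ⟨f', hf, mapDomain_orbitRingMap σ f'⟩
  · rintro ⟨f, hf, rfl⟩
    exact ⟨_, ⟨hf, mapDomain_subtype_mem_suppIn _ f⟩, (mapDomain_orbitRingMap σ f).symm⟩

end Cone

/-! ### Splitting off the lattice spanned by a cone -/

section Splitting

variable {M : Type} [AddCommGroup M] {σ : PointedCone ℝ (M →+ ℝ)}

lemma restrictSpan_apply (m : M) (n : latticeSpan σ) : restrictSpan σ m n = n.1 m := rfl

/-- Rationality matters here: the lattice points of `σ` generate it as a cone, so an exponent that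
vanishes on them vanishes on `σ`. -/
lemma restrictSpan_eq_zero_iff (hσ : IsRationalPolyhedral σ) {m : M} :
    restrictSpan σ m = 0 ↔ m ∈ perp σ := by
  constructor
  · intro h
    obtain ⟨s, rfl⟩ := hσ
    rw [perp_hull]
    intro n hn
    exact DFunLike.congr_fun h ⟨n, AddSubgroup.subset_closure (latticeToReal_mem_hull hn)⟩
  · intro h
    ext ⟨n, hn⟩
    rw [restrictSpan_apply, AddMonoidHom.zero_apply]
    refine AddSubgroup.closure_induction (p := fun n _ => n m = 0) ?_ ?_ ?_ ?_ hn
    · intro n hn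
      have h1 : ((n m : ℤ) : ℝ) = 0 := h _ hn
      exact_mod_cast h1
    · simp
    · intro x y _ _ hx hy
      simp [hx, hy]
    · intro x _ hx
      simp [hx]

lemma latticeToReal_add (a b : M →+ ℤ) :
    latticeToReal (a + b) = latticeToReal a + latticeToReal b := by
  ext m
  simp [latticeToReal]

lemma latticeToReal_nsmul (k : ℕ) (a : M →+ ℤ) :
    latticeToReal (k • a) = (k : ℝ) • latticeToReal a := by
  ext m
  simp [latticeToReal]

lemma exists_sub_of_mem_latticeSpan {n : M →+ ℤ} (hn : n ∈ latticeSpan σ) :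
    ∃ a b, latticeToReal a ∈ σ ∧ latticeToReal b ∈ σ ∧ n = a - b := by
  have h0 : latticeToReal (0 : M →+ ℤ) = 0 := by
    ext
    simp [latticeToReal]
  refine AddSubgroup.closure_induction (p := fun n _ => ∃ a b, latticeToReal a ∈ σ ∧
    latticeToReal b ∈ σ ∧ n = a - b) ?_ ?_ ?_ ?_ hn
  · exact fun x hx => ⟨x, 0, hx, by rw [h0]; exact zero_mem σ, by simp⟩
  · exact ⟨0, 0, by rw [h0]; exact zero_mem σ, by rw [h0]; exact zero_mem σ, by simp⟩
  · rintro _ _ _ _ ⟨a, b, ha, hb, rfl⟩ ⟨c, d, hc, hd, rfl⟩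
    exact ⟨a + c, b + d, by rw [latticeToReal_add]; exact add_mem ha hc,
      by rw [latticeToReal_add]; exact add_mem hb hd, by abel⟩
  · rintro _ _ ⟨a, b, ha, hb, rfl⟩
    exact ⟨b, a, hb, ha, by abel⟩

/-- The lattice spanned by a cone is saturated. -/
lemma mem_latticeSpan_of_nsmul_mem {k : ℕ} (hk : k ≠ 0) {n : M →+ ℤ}
    (h : k • n ∈ latticeSpan σ) : n ∈ latticeSpan σ := by
  obtain ⟨a, b, ha, hb, hab⟩ := exists_sub_of_mem_latticeSpan h
  obtain ⟨l, rfl⟩ := Nat.exists_eq_succ_of_ne_zero hk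
  have h1 : latticeToReal ((l + 1) • (n + b)) ∈ σ := by
    -- With `(l + 1) • n = a - b`, adding `(l + 1) • b` leaves a combination of points of the cone.
    -- Dividing by `l + 1` puts `n + b` in `σ`.
    have : (l + 1) • (n + b) = a + l • b := by
      rw [smul_add, hab, succ_nsmul]
      abel
    rw [this, latticeToReal_add, latticeToReal_nsmul]
    exact add_mem ha (σ.smul_mem l.cast_nonneg hb)
  rw [latticeToReal_nsmul] at h1
  have h2 : latticeToReal (n + b) ∈ σ := by
    have := σ.smul_mem (inv_nonneg.2 (l + 1).cast_nonneg) h1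
    rwa [smul_smul, inv_mul_cancel₀ (by positivity), one_smul] at this
  rw [← add_sub_cancel_right n b]
  exact sub_mem (AddSubgroup.subset_closure h2) (AddSubgroup.subset_closure hb)

-- Saturation makes the quotient of `N` by `⟨σ⟩` torsion-free, hence free, so the quotient map
-- splits.
variable (σ) in
lemma exists_retraction_latticeSpan [Module.Free ℤ M] [Module.Finite ℤ M] :
    ∃ p : (M →+ ℤ) →+ latticeSpan σ, ∀ n : latticeSpan σ, p n = n := by
  let L : Submodule ℤ (M →+ ℤ) := AddSubgroup.toIntSubmodule (latticeSpan σ)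
  have e : (M →+ ℤ) ≃ₗ[ℤ] (M →ₗ[ℤ] ℤ) := addMonoidHomLequivInt ℤ
  have : Module.Finite ℤ (M →+ ℤ) := Module.Finite.equiv e.symm
  have htf : Module.IsTorsionFree ℤ ((M →+ ℤ) ⧸ L) := by
    refine Module.isTorsionFree_int_iff_isAddTorsionFree.2 ⟨fun k hk a b hab => ?_⟩
    obtain ⟨a, rfl⟩ := L.mkQ_surjective a
    obtain ⟨b, rfl⟩ := L.mkQ_surjective b
    refine (Submodule.Quotient.eq L).2 (mem_latticeSpan_of_nsmul_mem (σ := σ) hk ?_)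
    rw [smul_sub]
    exact (Submodule.Quotient.eq L).1 hab
  have : Module.Free ℤ ((M →+ ℤ) ⧸ L) := inferInstance
  obtain ⟨q, hq⟩ := Module.projective_lifting_property L.mkQ LinearMap.id L.mkQ_surjective
  have hmem : ∀ n, n - q (L.mkQ n) ∈ latticeSpan σ := by
    intro n
    have : L.mkQ (n - q (L.mkQ n)) = 0 := by
      rw [map_sub, sub_eq_zero]
      exact (LinearMap.congr_fun hq (L.mkQ n)).symm
    exact (Submodule.Quotient.mk_eq_zero L).1 this
  refine ⟨(AddMonoidHom.id _ - (q.comp L.mkQ).toAddMonoidHom).codRestrict _ hmem, fun n => ?_⟩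
  have : L.mkQ n.1 = 0 := (Submodule.Quotient.mk_eq_zero L).2 n.2
  apply Subtype.ext
  change n.1 - q (L.mkQ n.1) = n.1
  rw [this, map_zero, sub_zero]

-- Dualize the retraction of `N` onto `⟨σ⟩` and identify `M` with its bidual.
variable (σ) in
lemma exists_section_restrictSpan [Module.Free ℤ M] [Module.Finite ℤ M] :
    ∃ r : (latticeSpan σ →+ ℤ) →+ M, ∀ φ, restrictSpan σ (r φ) = φ := by
  obtain ⟨p, hp⟩ := exists_retraction_latticeSpan σ
  let e := Module.evalEquiv ℤ M
  have he : ∀ (d : Module.Dual ℤ (Module.Dual ℤ M)) (n : Module.Dual ℤ M), n (e.symm d) = d n := by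
    intro d n
    conv_rhs => rw [← e.apply_symm_apply d]
    rfl
  refine ⟨AddMonoidHom.mk' (fun φ => e.symm
    ((φ.comp (p.comp (addMonoidHomLequivInt ℤ (A := M) (B := ℤ)).symm.toAddMonoidHom)).toIntLinearMap))
    fun a b => ?_, fun φ => ?_⟩
  · rw [← map_add]
    rfl
  · ext n
    rw [restrictSpan_apply]
    have := he ((φ.comp (p.comp
      (addMonoidHomLequivInt ℤ (A := M) (B := ℤ)).symm.toAddMonoidHom)).toIntLinearMap)
      n.1.toIntLinearMap
    refine this.trans ?_
    exact congrArg φ (hp n)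

end Splitting

/-! ### Translation actions and their quotients -/

section Sections

variable {C : Type*} [Category C] {T O X Q : C} {π : T ⟶ O} {k : X ⟶ T} {j : Q ⟶ O} {q : X ⟶ Q}
  {s : O ⟶ T}

/-- The section of `X → Q` given by a section of `T → O`. -/
def pullbackSection (h : IsPullback q k j π) (hsπ : s ≫ π = 𝟙 O) : Q ⟶ X :=
  h.lift (𝟙 Q) (j ≫ s) (by rw [Category.assoc, hsπ, Category.id_comp, Category.comp_id])

lemma pullbackSection_comp (h : IsPullback q k j π) (hsπ : s ≫ π = 𝟙 O) :
    pullbackSection h hsπ ≫ q = 𝟙 Q := h.lift_fst _ _ _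

/-- A morphism with a section is the coequalizer of its kernel pair. -/
lemma isColimit_of_section {P : C} {a b : P ⟶ X} (h : IsPullback a b q q) {e : Q ⟶ X}
    (he : e ≫ q = 𝟙 Q) : Nonempty (IsColimit (Cofork.ofπ q h.w)) := by
  refine ⟨Cofork.IsColimit.mk _ (fun c => e ≫ c.π) (fun c => ?_) fun c m hm => ?_⟩
  · have h1 := h.lift_fst (q ≫ e) (𝟙 X) (by rw [Category.assoc, he, Category.comp_id,
      Category.id_comp])
    have h2 := h.lift_snd (q ≫ e) (𝟙 X) (by rw [Category.assoc, he, Category.comp_id,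
      Category.id_comp])
    change q ≫ e ≫ c.π = c.π
    rw [← Category.assoc, ← h1, Category.assoc, c.condition, ← Category.assoc, h2,
      Category.id_comp]
  · rw [← hm]
    exact (reassoc_of% he) m |>.symm

end Sections

/-! ### Translation by a subgroup on preimages under a quotient map -/

section Translation

open scoped MonObj

variable {C : Type*} [Category C] [CartesianMonoidalCategory C] {G T O X Q : C}
  [GrpObj T] [GrpObj O] {i : G ⟶ T} {π : T ⟶ O} [IsMonHom π] {k : X ⟶ T} {j : Q ⟶ O}
  {q : X ⟶ Q}

lemma translation_comp (hiπ : i ≫ π = 1) {S : C} (a : S ⟶ G) (b : S ⟶ T) :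
    ((a ≫ i) * b) ≫ π = b ≫ π := by
  rw [MonObj.mul_comp, Category.assoc, hiπ, MonObj.comp_one, one_mul]

/-- Translation by `G` on the preimage `X ⊆ T` of `Q ⊆ O`, if `G` maps to the kernel of `T → O`. -/
def translation (h : IsPullback q k j π) (hiπ : i ≫ π = 1) : G ⊗ X ⟶ X :=
  h.lift (snd G X ≫ q) ((fst G X ≫ i) * (snd G X ≫ k))
    (by rw [translation_comp hiπ, Category.assoc, Category.assoc, h.w])

lemma lift_translation_comp (h : IsPullback q k j π) (hiπ : i ≫ π = 1) {S : C} (a : S ⟶ G)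
    (b : S ⟶ X) : lift a b ≫ translation h hiπ ≫ k = (a ≫ i) * (b ≫ k) := by
  rw [translation, h.lift_snd, MonObj.comp_mul, lift_fst_assoc, lift_snd_assoc]

lemma translation_comp_quotient (h : IsPullback q k j π) (hiπ : i ≫ π = 1) :
    translation h hiπ ≫ q = snd G X ≫ q := h.lift_fst _ _ _

/-- The action by translation. -/
abbrev translationAction [GrpObj G] [IsMonHom i] [Mono k] (h : IsPullback q k j π) (hiπ : i ≫ π = 1) : ModObj G X where
  smul := translation h hiπ
  one_smul := by
    change η ▷ X ≫ translation h hiπ = (λ_ X).hom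
    -- As `k` is a monomorphism, the action axioms can be checked in the groups of morphisms into
    -- `T`.
    rw [← cancel_mono k, Category.assoc,
      show η ▷ X = lift (fst _ _ ≫ (η : _ ⟶ G)) (snd _ _) by ext <;> simp,
      lift_translation_comp, MonObj.one_eq_one, MonObj.comp_one, MonObj.one_comp, one_mul,
      leftUnitor_hom]
  mul_smul := by
    change μ ▷ X ≫ translation h hiπ = (α_ G G X).hom ≫ G ◁ translation h hiπ ≫ translation h hiπ
    have h1 : (μ : G ⊗ G ⟶ G) ▷ X = lift ((fst _ _ ≫ fst _ _) * (fst _ _ ≫ snd _ _)) (snd _ _) := by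
      ext
      · rw [whiskerRight_fst, lift_fst, ← MonObj.comp_mul, Hom.mul_def, lift_fst_snd,
          Category.id_comp]
      · simp
    have h2 : (α_ G G X).hom ≫ G ◁ translation h hiπ = lift (fst _ _ ≫ fst _ _)
        (lift (fst _ _ ≫ snd _ _) (snd _ _) ≫ translation h hiπ) := by
      ext
      · simp
      · simp only [Category.assoc, whiskerLeft_snd, lift_snd]
        rw [← Category.assoc]
        congr 1
        ext <;> simp
    rw [← cancel_mono k, Category.assoc, h1, lift_translation_comp, ← Category.assoc, h2,
      Category.assoc, lift_translation_comp]
    simp only [Category.assoc, lift_translation_comp, MonObj.mul_comp, mul_assoc]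

variable {t : T ⟶ G} {s : O ⟶ T}

/-- For a split extension, `G × X = X ×_Q X`. -/
lemma isPullback_translation [IsMonHom s] [Mono k] (h : IsPullback q k j π) (hiπ : i ≫ π = 1)
    (hit : i ≫ t = 𝟙 G) (hsplit : (t ≫ i) * (π ≫ s) = 𝟙 T) :
    IsPullback (translation h hiπ) (snd G X) q q := by
  refine ⟨⟨translation_comp_quotient h hiπ⟩, ⟨PullbackCone.IsLimit.mk _
    -- Two points with the same image in `Q` differ by an element of the kernel of `π`. The
    -- splitting shows that this element comes from `G` and that `t` recovers it.
    (fun c => lift (((c.fst ≫ k) * (c.snd ≫ k)⁻¹) ≫ t) c.snd) ?_ ?_ ?_⟩⟩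
  · intro c
    rw [← cancel_mono k, Category.assoc, lift_translation_comp]
    have h1 : ((c.fst ≫ k) * (c.snd ≫ k)⁻¹) ≫ π = 1 := by
      rw [MonObj.mul_comp, GrpObj.inv_comp, Category.assoc, Category.assoc, ← h.w,
        c.condition_assoc, mul_inv_cancel]
    have h2 : ((c.fst ≫ k) * (c.snd ≫ k)⁻¹) ≫ t ≫ i = (c.fst ≫ k) * (c.snd ≫ k)⁻¹ := by
      have := congrArg (fun x => ((c.fst ≫ k) * (c.snd ≫ k)⁻¹) ≫ x) hsplit
      rwa [MonObj.comp_mul, reassoc_of% h1, MonObj.one_comp, mul_one, Category.comp_id] at this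
    rw [Category.assoc, h2, inv_mul_cancel_right]
  · intro c
    exact lift_snd _ _
  · intro c m h1 h2
    ext
    · rw [lift_fst]
      have h3 := lift_translation_comp h hiπ (m ≫ fst _ _) (m ≫ snd _ _)
      rw [← comp_lift, lift_fst_snd, Category.comp_id, reassoc_of% h1, h2] at h3
      rw [h3, mul_inv_cancel_right, Category.assoc, Category.assoc, hit, Category.comp_id]
    · rw [lift_snd, h2]

/-- The trivialization `X ≅ G × Q` of the torsor `X → Q` given by a splitting. -/
lemma isIso_lift_of_split [GrpObj G] [IsMonHom t] [Mono k] (h : IsPullback q k j π)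
    (hiπ : i ≫ π = 1) (hit : i ≫ t = 𝟙 G) (hsπ : s ≫ π = 𝟙 O) (hst : s ≫ t = 1)
    (hsplit : (t ≫ i) * (π ≫ s) = 𝟙 T) : IsIso (lift (k ≫ t) q) := by
  have hw : snd G Q ≫ j = ((fst G Q ≫ i) * (snd G Q ≫ j ≫ s)) ≫ π := by
    rw [translation_comp hiπ, Category.assoc, Category.assoc, hsπ, Category.comp_id]
  refine ⟨h.lift (snd G Q) ((fst G Q ≫ i) * (snd G Q ≫ j ≫ s)) hw, ?_, ?_⟩
  · rw [← cancel_mono k, Category.assoc, h.lift_snd, MonObj.comp_mul, lift_fst_assoc,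
      lift_snd_assoc, ← Category.assoc q, h.w, Category.id_comp, Category.assoc, Category.assoc,
      ← MonObj.comp_mul, hsplit, Category.comp_id]
  · ext
    · rw [Category.assoc, lift_fst, Category.id_comp, ← Category.assoc, h.lift_snd,
        MonObj.mul_comp, Category.assoc, hit, Category.comp_id, Category.assoc, Category.assoc,
        hst, MonObj.comp_one, MonObj.comp_one, mul_one]
    · rw [Category.assoc, lift_snd, Category.id_comp, h.lift_fst]

/-- The kernel pair of `q` is the preimage of the diagonal. -/
lemma isPullback_lift_diagonal {P : C} {a b : P ⟶ X} (h : IsPullback a b q q) :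
    IsPullback (lift a b) (b ≫ q) (q ⊗ₘ q) (lift (𝟙 Q) (𝟙 Q)) := by
  refine ⟨⟨?_⟩, ⟨PullbackCone.IsLimit.mk _
    (fun c => h.lift (c.fst ≫ fst _ _) (c.fst ≫ snd _ _) ?_) ?_ ?_ ?_⟩⟩
  · ext <;> simp [h.w]
  · have h1 := congrArg (· ≫ fst _ _) c.condition
    have h2 := congrArg (· ≫ snd _ _) c.condition
    simp only [Category.assoc, tensorHom_fst, tensorHom_snd, lift_fst, lift_snd,
      Category.comp_id] at h1 h2
    rw [Category.assoc, Category.assoc, h1, h2]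
  · intro c
    ext <;> simp
  · intro c
    have h2 := congrArg (· ≫ snd _ _) c.condition
    simp only [Category.assoc, tensorHom_snd, lift_snd, Category.comp_id] at h2
    rw [← Category.assoc, h.lift_snd, Category.assoc, h2]
  · intro c m h1 h2
    apply h.hom_ext
    · rw [h.lift_fst, ← h1, Category.assoc, lift_fst]
    · rw [h.lift_snd, ← h1, Category.assoc, lift_snd]

end Translation

/-! ### Free quotients from split extensions of group schemes over ℂ -/

section OverBase

open scoped MonObj

/-- A split extension of group schemes `G → T → O` acts on the preimage of a separated subscheme `Q`
of `O` by translation, freely and with quotient `Q`. -/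
theorem exists_isFreeQuotient {G T O X Q : Over base} [GrpObj G] [GrpObj T] [GrpObj O]
    {i : G ⟶ T} [IsMonHom i] {π : T ⟶ O} [IsMonHom π] {t : T ⟶ G} [IsMonHom t] {s : O ⟶ T}
    [IsMonHom s] {k : X ⟶ T} {j : Q ⟶ O} {q : X ⟶ Q} [Mono k] [Flat G.hom] [QuasiCompact G.hom]
    [IsSeparated Q.hom] (h : IsPullback q k j π) (hiπ : i ≫ π = 1) (hit : i ≫ t = 𝟙 G)
    (hsπ : s ≫ π = 𝟙 O) (hst : s ≫ t = 1) (hsplit : (t ≫ i) * (π ≫ s) = 𝟙 T) :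
    ∃ _ : ModObj G X, actionMap G X ≫ k = (i ⊗ₘ k) ≫ MonObj.mul ∧ IsFreeAction G X ∧
      IsFreeQuotient G q := by
  have hP := isPullback_translation h hiπ hit hsplit
  have hiso := isIso_lift_of_split h hiπ hit hsπ hst hsplit
  -- Up to the trivialization, `q` is the projection `G × Q → Q`, so flatness and quasi-compactness
  -- come from `G` by base change.
  have hfac : q.left = (lift (k ≫ t) q).left ≫ (snd G Q).left := by
    rw [← Over.comp_left, lift_snd]
  have hsnd : IsPullback (fst G Q).left (snd G Q).left G.hom Q.hom := by
    exact IsPullback.of_hasPullback _ _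
  have : IsIso (lift (k ≫ t) q).left :=
    inferInstanceAs (IsIso ((Over.forget base).map (lift (k ≫ t) q)))
  let act := translationAction h hiπ
  refine ⟨act, ?_, ?_, ⟨?_, ?_, ?_, hP, isColimit_of_section hP (pullbackSection_comp h hsπ)⟩⟩
  · have := lift_translation_comp h hiπ (fst G X) (snd G X)
    rw [lift_fst_snd, Category.id_comp] at this
    refine this.trans ?_
    rw [Hom.mul_def]
    rfl
  -- The morphism `(g, x) ↦ (g x, x)` is a base change of the diagonal of `Q`, which is a closed
  -- immersion because `Q` is separated.
  · have hd := (isPullback_lift_diagonal hP).map (Over.forget base)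
    have : IsClosedImmersion (lift (𝟙 Q) (𝟙 Q)).left :=
      IsSeparated.isClosedImmersion_diagonal (f := Q.hom)
    exact MorphismProperty.of_isPullback hd.flip this
  · rw [hfac]
    have : Flat (snd G Q).left := MorphismProperty.of_isPullback hsnd ‹_›
    infer_instance
  · have : Surjective ((pullbackSection h hsπ).left ≫ q.left) := by
      rw [← Over.comp_left, pullbackSection_comp]
      exact inferInstanceAs (Surjective (𝟙 Q.left))
    exact Surjective.of_comp (pullbackSection h hsπ).left _
  · rw [hfac]
    have : QuasiCompact (snd G Q).left := MorphismProperty.of_isPullback hsnd ‹_›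
    infer_instance

end OverBase

/-! ### Homomorphisms of tori -/

section Tori

open scoped MonObj

variable {L L' L'' : Type} [AddCommGroup L] [AddCommGroup L'] [AddCommGroup L'']

lemma torusMap_id : torusMap (AddMonoidHom.id L) = 𝟙 (torus L) := by
  ext1
  change Spec.map (CommRingCat.ofHom _) = 𝟙 _
  rw [show AddMonoidAlgebra.mapDomainAlgHom ℂ ℂ (AddMonoidHom.id L) = AlgHom.id ℂ _ from
    AddMonoidAlgebra.mapDomainAlgHom_id ..]
  exact Spec.map_id _

lemma torusMap_comp (f : L →+ L') (g : L' →+ L'') :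
    torusMap (g.comp f) = torusMap g ≫ torusMap f := by
  ext1
  change Spec.map (CommRingCat.ofHom _) = Spec.map _ ≫ Spec.map _
  rw [← Spec.map_comp, ← CommRingCat.ofHom_comp,
    show AddMonoidAlgebra.mapDomainAlgHom ℂ ℂ (g.comp f) = _ from
    AddMonoidAlgebra.mapDomainAlgHom_comp (R := ℂ) (A := ℂ) f g]
  rfl

/-- Multiplication of morphisms corresponds to convolution of algebra maps. Monomials are
group-like, so convolution multiplies their images, that is, adds exponents. -/
lemma torusMap_mul (f g : L →+ L') : torusMap f * torusMap g = torusMap (f + g) := by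
  have h := (Spec.mapMulEquiv (R := ℂ) (S := AddMonoidAlgebra ℂ L)
    (T := AddMonoidAlgebra ℂ L')).map_mul
    (WithConv.toConv (AddMonoidAlgebra.mapDomainAlgHom ℂ ℂ f))
    (WithConv.toConv (AddMonoidAlgebra.mapDomainAlgHom ℂ ℂ g))
  refine h.symm.trans (congrArg _ ?_)
  apply WithConv.ofConv_injective
  ext m
  simp [AlgHom.convMul_def]

lemma torusMap_zero : torusMap (0 : L →+ L') = 1 := by
  have := torusMap_mul (0 : L →+ L') 0
  rwa [add_zero, mul_eq_left] at this

instance (f : L →+ L') : IsMonHom (torusMap f) :=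
  inferInstanceAs (IsMonHom ((bialgSpec (.of ℂ)).map (.op (CommBialgCat.ofHom
    (AddMonoidAlgebra.mapDomainBialgHom ℂ f)))).hom)

end Tori

/-! ### Kernels of morphisms of affine schemes -/

section Kernels

/-- On an affine target the kernel ideal sheaf is determined by global sections. Hence a morphism
can be replaced by the closed immersion defined by the kernel of its ring map. -/
lemma ker_specMap_congr {A B B' : CommRingCat.{0}} (φ : A ⟶ B) (φ' : A ⟶ B')
    (h : RingHom.ker φ.hom = RingHom.ker φ'.hom) : (Spec.map φ).ker = (Spec.map φ').ker := by
  have key : ∀ {B : CommRingCat.{0}} (φ : A ⟶ B), RingHom.ker (Spec.map φ).appTop.hom =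
      (RingHom.ker φ.hom).comap (Scheme.ΓSpecIso A).hom.hom := by
    intro B φ
    ext x
    have hn := congrArg (fun f => f.hom x) (Scheme.ΓSpecIso_naturality φ)
    rw [Ideal.mem_comap, RingHom.mem_ker, RingHom.mem_ker]
    refine Iff.trans ?_ (Eq.congr_left hn)
    exact (map_eq_zero_iff _ (ConcreteCategory.bijective_of_isIso (Scheme.ΓSpecIso B).hom).1).symm
  rw [Scheme.ker_of_isAffine, Scheme.ker_of_isAffine, key, key, h]

lemma isPushout_quotient {A C : Type} [CommRing A] [CommRing C] (ψ : A →+* C) (I : Ideal A) :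
    IsPushout (CommRingCat.ofHom ψ) (CommRingCat.ofHom (Ideal.Quotient.mk I))
      (CommRingCat.ofHom (Ideal.Quotient.mk (I.map ψ)))
      (CommRingCat.ofHom (Ideal.quotientMap (I.map ψ) ψ Ideal.le_comap_map)) := by
  refine ⟨⟨?_⟩, ⟨PushoutCocone.IsColimit.mk _
    (fun c => CommRingCat.ofHom (Ideal.Quotient.lift (I.map ψ) c.inl.hom ?_)) ?_ ?_ ?_⟩⟩
  · ext x
    simp
  · intro x hx
    have hle : I.map ψ ≤ RingHom.ker c.inl.hom := by
      rw [Ideal.map_le_iff_le_comap]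
      intro y hy
      have h := congrArg (fun f => f.hom y) c.condition
      have h0 : Ideal.Quotient.mk I y = 0 := Ideal.Quotient.eq_zero_iff_mem.2 hy
      rw [Ideal.mem_comap, RingHom.mem_ker]
      refine h.trans ?_
      change c.inr.hom (Ideal.Quotient.mk I y) = 0
      rw [h0, map_zero]
    exact hle hx
  · intro c
    ext x
    rfl
  · intro c
    ext x
    exact congrArg (fun f => f.hom x) c.condition
  · intro c m h1 h2
    ext x
    exact congrArg (fun f => f.hom x) h1

lemma isClosedImmersion_specMap_mk {A : Type} [CommRing A] (I : Ideal A) :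
    IsClosedImmersion (Spec.map (CommRingCat.ofHom (Ideal.Quotient.mk I))) :=
  IsClosedImmersion.spec_of_surjective _ Ideal.Quotient.mk_surjective

/-- The preimage of the scheme-theoretic image of a morphism of affine schemes. -/
lemma comap_ker_specMap {A B C : Type} [CommRing A] [CommRing B] [CommRing C] (φ : A →+* B)
    (ψ : A →+* C) : (Spec.map (CommRingCat.ofHom φ)).ker.comap (Spec.map (CommRingCat.ofHom ψ)) =
      (Spec.map (CommRingCat.ofHom (Ideal.Quotient.mk ((RingHom.ker φ).map ψ)))).ker := by
  have := isClosedImmersion_specMap_mk (RingHom.ker φ)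
  have hP := isPullback_SpecMap_of_isPushout _ _ _ _ (isPushout_quotient ψ (RingHom.ker φ))
  rw [ker_specMap_congr (CommRingCat.ofHom φ)
    (CommRingCat.ofHom (Ideal.Quotient.mk (RingHom.ker φ))) (by simp [Ideal.mk_ker]),
    ← Scheme.IdealSheafData.ker_fst_of_isClosedImmersion, ← hP.isoPullback_hom_fst,
    Scheme.Hom.ker_comp_of_isIso]

/-- Scheme-theoretic images are compatible with restriction to open subschemes. -/
lemma comap_ker_comp_of_isOpenImmersion {X V Y : Scheme.{0}} (f : X ⟶ V) (c : V ⟶ Y)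
    [IsOpenImmersion c] [QuasiCompact (f ≫ c)] : (f ≫ c).ker.comap c = f.ker := by
  have hP : IsPullback f (𝟙 X) c (f ≫ c) := by
    refine ⟨⟨by simp⟩, ⟨PullbackCone.IsLimit.mk _ (fun s => s.snd) ?_ ?_ ?_⟩⟩
    · intro s
      rw [← cancel_mono c, s.condition, Category.assoc]
    · intro s
      exact Category.comp_id _
    · intro s m _ h
      rw [← h, Category.comp_id]
  ext1
  funext U
  rw [Scheme.IdealSheafData.ideal_comap_of_isOpenImmersion,
    Scheme.ker_ideal_of_isPullback_of_isOpenImmersion _ _ _ _ hP]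

lemma comap_ker_specMap_comp {A B C : Type} [CommRing A] [CommRing B] [CommRing C] (φ : A →+* B)
    (ψ : A →+* C) {Y : Scheme.{0}} (c : Spec (.of A) ⟶ Y) [IsOpenImmersion c]
    (_ : QuasiCompact (Spec.map (CommRingCat.ofHom φ) ≫ c)) :
    (Spec.map (CommRingCat.ofHom φ) ≫ c).ker.comap (Spec.map (CommRingCat.ofHom ψ) ≫ c) =
      (Spec.map (CommRingCat.ofHom (Ideal.Quotient.mk ((RingHom.ker φ).map ψ)))).ker := by
  rw [Scheme.IdealSheafData.comap_comp, comap_ker_comp_of_isOpenImmersion, comap_ker_specMap]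

end Kernels

/-! ### The closure in the toric variety -/

section Closure

variable {M : Type} [AddCommGroup M]

instance (F : Fan M) (σ : F.cones) : IsOpenImmersion (chartToToric F σ) :=
  inferInstanceAs (IsOpenImmersion (colimit.ι (chartDiagram F) σ))

/-- The torus embeds through every chart, compatibly with the gluing, so near `O_σ` the closure can
be computed in `V_σ` alone. -/
lemma torusToToric_eq (F : Fan M) (σ : F.cones) :
    torusToToric F = Spec.map (CommRingCat.ofHom (AddMonoidAlgebra.mapDomainAlgHom ℂ ℂ
      (dualMonoid σ.1).subtype).toRingHom) ≫ chartToToric F σ := by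
  have h : (⟨⊥, F.zero_mem⟩ : F.cones) ≤ σ := show (⊥ : PointedCone ℝ (M →+ ℝ)) ≤ σ.1 from bot_le
  have hw : chartMap (show (⊥ : PointedCone ℝ (M →+ ℝ)) ≤ σ.1 from bot_le) ≫ chartToToric F σ =
      chartToToric F ⟨⊥, F.zero_mem⟩ := colimit.w (chartDiagram F) (homOfLE h)
  have he : Spec.map (CommRingCat.ofHom (AddMonoidAlgebra.mapDomainAlgHom ℂ ℂ
      (dualMonoid (⊥ : PointedCone ℝ (M →+ ℝ))).subtype).toRingHom) ≫
      chartMap (show (⊥ : PointedCone ℝ (M →+ ℝ)) ≤ σ.1 from bot_le) =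
      Spec.map (CommRingCat.ofHom (AddMonoidAlgebra.mapDomainAlgHom ℂ ℂ
        (dualMonoid σ.1).subtype).toRingHom) := by
    rw [chartMap, ← Spec.map_comp, ← CommRingCat.ofHom_comp]
    congr 2
    exact congrArg AlgHom.toRingHom (AddMonoidAlgebra.mapDomainAlgHom_comp (R := ℂ) (A := ℂ)
      (AddSubmonoid.inclusion
        (dualMonoid_anti (show (⊥ : PointedCone ℝ (M →+ ℝ)) ≤ σ.1 from bot_le)))
      (dualMonoid (⊥ : PointedCone ℝ (M →+ ℝ))).subtype).symm
  exact (congrArg (Spec.map _ ≫ ·) hw).symm.trans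
    ((Category.assoc _ _ _).symm.trans (congrArg (· ≫ chartToToric F σ) he))

lemma subschemeToToric_eq (F : Fan M) (I : Ideal (AddMonoidAlgebra ℂ M)) (σ : F.cones) :
    subschemeToToric F I = Spec.map (CommRingCat.ofHom ((Ideal.Quotient.mk I).comp
      (AddMonoidAlgebra.mapDomainAlgHom ℂ ℂ (dualMonoid σ.1).subtype).toRingHom)) ≫
        chartToToric F σ := by
  rw [CommRingCat.ofHom_comp, Spec.map_comp, Category.assoc]
  exact congrArg ((subschemeι I).left ≫ ·) (torusToToric_eq F σ)

instance (F : Fan M) (I : Ideal (AddMonoidAlgebra ℂ M)) : IsClosedImmersion (toricClosureι F I) :=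
  inferInstanceAs (IsClosedImmersion (subschemeToToric F I).imageι)

instance (F : Fan M) (I : Ideal (AddMonoidAlgebra ℂ M)) (σ : F.cones) :
    IsClosedImmersion (closureInterOrbitι F I σ).left :=
  inferInstanceAs (IsClosedImmersion (pullback.snd (toricClosureι F I) (orbitToToric F σ)))

/-- Needed because scheme-theoretic images restrict well to open subschemes for quasi-compact
morphisms; here the source is noetherian. -/
lemma quasiCompact_subschemeToToric [Module.Finite ℤ M] (F : Fan M)
    (I : Ideal (AddMonoidAlgebra ℂ M)) : QuasiCompact (subschemeToToric F I) := by
  have : AddMonoid.FG M := AddGroup.fg_iff_addMonoid_fg.1 (Module.Finite.iff_addGroup_fg.1 ‹_›)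
  have : IsNoetherianRing (AddMonoidAlgebra ℂ M) := Algebra.FiniteType.isNoetherianRing ℂ _
  have : IsNoetherianRing (CommRingCat.of (AddMonoidAlgebra ℂ M ⧸ I)) :=
    inferInstanceAs (IsNoetherianRing (AddMonoidAlgebra ℂ M ⧸ I))
  have : IsNoetherian (subscheme I).left :=
    inferInstanceAs (IsNoetherian (Spec (CommRingCat.of (AddMonoidAlgebra ℂ M ⧸ I))))
  infer_instance

/-- In `V_σ` the closure is cut out by the kernel of ℂ[σ^∨] → ℂ[M]/I, which is `chartIdeal`;
intersecting with the orbit extends this ideal along `orbitRingMap`. -/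
lemma ker_closureInterOrbitι [Module.Finite ℤ M] (F : Fan M)
    (I : Ideal (AddMonoidAlgebra ℂ M)) (σ : F.cones) :
    (closureInterOrbitι F I σ).left.ker = (Spec.map (CommRingCat.ofHom
      (Ideal.Quotient.mk ((chartIdeal σ.1 I).map (orbitRingMap σ.1).toRingHom)))).ker := by
  have := quasiCompact_subschemeToToric F I
  have h1 : (closureInterOrbitι F I σ).left.ker =
      (toricClosureι F I).ker.comap (orbitToToric F σ) := by
    rw [← Scheme.IdealSheafData.ker_fst_of_isClosedImmersion,
      ← Scheme.Hom.ker_comp_of_isIso (pullbackSymmetry _ _).hom, pullbackSymmetry_hom_comp_fst]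
    rfl
  have h2 : (toricClosureι F I).ker = (subschemeToToric F I).ker :=
    Scheme.IdealSheafData.ker_subschemeι _
  have h3 : chartIdeal σ.1 I = RingHom.ker ((Ideal.Quotient.mk I).comp
      (AddMonoidAlgebra.mapDomainAlgHom ℂ ℂ (dualMonoid σ.1).subtype).toRingHom) := by
    rw [← RingHom.comap_ker, Ideal.mk_ker]
    rfl
  rw [subschemeToToric_eq F I σ] at h2 this
  rw [h1, h2, h3]
  exact comap_ker_specMap_comp _ _ _ this

instance (I : Ideal (AddMonoidAlgebra ℂ M)) : IsClosedImmersion (subschemeι I).left :=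
  isClosedImmersion_specMap_mk I

instance (I : Ideal (AddMonoidAlgebra ℂ M)) : Mono (subschemeι I) :=
  (Over.forget base).mono_of_mono_map (inferInstanceAs (Mono (subschemeι I).left))

lemma comap_ker_closureInterOrbitι [Module.Finite ℤ M] (F : Fan M)
    (I : Ideal (AddMonoidAlgebra ℂ M)) (σ : F.cones) {J : Ideal (AddMonoidAlgebra ℂ M)}
    (hJ : J = ((chartIdeal σ.1 I).map (orbitRingMap σ.1)).map
      (AddMonoidAlgebra.mapDomainAlgHom ℂ ℂ (perp σ.1).subtype)) :
    (closureInterOrbitι F I σ).left.ker.comap (torusToOrbit σ.1).left = (subschemeι J).left.ker := by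
  rw [ker_closureInterOrbitι]
  refine (comap_ker_specMap _ _).trans ?_
  rw [Ideal.mk_ker, hJ]
  rfl

/-- If the ideal `J` is generated by the ideal of `X̄ ∩ O_σ`, then the subscheme that it defines is
the preimage of `X̄ ∩ O_σ`. -/
lemma exists_isPullback_closureInterOrbit [Module.Finite ℤ M] (F : Fan M)
    (I : Ideal (AddMonoidAlgebra ℂ M)) (σ : F.cones) {J : Ideal (AddMonoidAlgebra ℂ M)}
    (hJ : J = ((chartIdeal σ.1 I).map (orbitRingMap σ.1)).map
      (AddMonoidAlgebra.mapDomainAlgHom ℂ ℂ (perp σ.1).subtype)) :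
    ∃ q : subscheme J ⟶ closureInterOrbit F I σ,
      IsPullback q (subschemeι J) (closureInterOrbitι F I σ) (torusToOrbit σ.1) := by
  have hker := comap_ker_closureInterOrbitι F I σ hJ
  have hle : (closureInterOrbitι F I σ).left.ker ≤
      ((subschemeι J).left ≫ (torusToOrbit σ.1).left).ker := by
    rw [← Scheme.IdealSheafData.map_ker, Scheme.IdealSheafData.le_map_iff_comap_le, hker]
  have hfac := IsClosedImmersion.lift_fac _ _ hle
  have hP := isPullback_of_isClosedImmersion (subschemeι J).left (closureInterOrbitι F I σ).left
    (IsClosedImmersion.lift _ _ hle) (torusToOrbit σ.1).left hfac.symm hker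
  let q : subscheme J ⟶ closureInterOrbit F I σ := Over.homMk (IsClosedImmersion.lift _ _ hle) (by
    rw [← Over.w (closureInterOrbitι F I σ), reassoc_of% hfac, Over.w, Over.w])
  refine ⟨q, IsPullback.of_map (Over.forget base) ?_ hP.flip⟩
  ext1
  exact hfac

end Closure

/-! ### The quotient by the subtorus of a cone -/

section Quotient

open scoped MonObj

variable {M : Type} [AddCommGroup M] {σ : PointedCone ℝ (M →+ ℝ)}

/-- The group `σ^⊥` is a direct summand of `M`, with complement `Hom(⟨σ⟩, ℤ)`. -/
lemma exists_splitting [Module.Free ℤ M] [Module.Finite ℤ M] (hσ : IsRationalPolyhedral σ) :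
    ∃ (r : (latticeSpan σ →+ ℤ) →+ M) (ρ : M →+ perp σ),
      (restrictSpan σ).comp r = AddMonoidHom.id _ ∧ ρ.comp (perp σ).subtype = AddMonoidHom.id _ ∧
      ρ.comp r = 0 ∧ r.comp (restrictSpan σ) + (perp σ).subtype.comp ρ = AddMonoidHom.id M := by
  obtain ⟨r, hr⟩ := exists_section_restrictSpan σ
  have hmem : ∀ m, m - r (restrictSpan σ m) ∈ perp σ := fun m =>
    (restrictSpan_eq_zero_iff hσ).1 (by rw [map_sub, hr, sub_self])
  refine ⟨r, (AddMonoidHom.id M - r.comp (restrictSpan σ)).codRestrict (perp σ) hmem,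
    AddMonoidHom.ext hr, ?_, ?_, ?_⟩
  · ext m
    change m.1 - r (restrictSpan σ m.1) = m.1
    rw [(restrictSpan_eq_zero_iff hσ).2 m.2, map_zero, sub_zero]
  · ext φ
    change r φ - r (restrictSpan σ (r φ)) = 0
    rw [hr, sub_self]
  · ext m
    change r (restrictSpan σ m) + (m - r (restrictSpan σ m)) = m
    abel

lemma restrictSpan_comp_subtype (hσ : IsRationalPolyhedral σ) :
    (restrictSpan σ).comp (perp σ).subtype = 0 :=
  AddMonoidHom.ext fun m => (restrictSpan_eq_zero_iff hσ).2 m.2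

instance (σ : PointedCone ℝ (M →+ ℝ)) : IsMonHom (subtorusι σ) :=
  inferInstanceAs (IsMonHom (torusMap (restrictSpan σ)))

instance (σ : PointedCone ℝ (M →+ ℝ)) : IsMonHom (torusToOrbit σ) :=
  inferInstanceAs (IsMonHom (torusMap (perp σ).subtype))

instance (A : Type) [CommRing A] [Algebra ℂ A] : IsAffineHom (affine A).hom :=
  inferInstanceAs (IsAffineHom (Spec.map (CommRingCat.ofHom (algebraMap ℂ A))))

instance (A : Type) [CommRing A] [Algebra ℂ A] : Flat (affine A).hom :=
  Flat.SpecMap_iff.2 (RingHom.flat_algebraMap_iff.2 inferInstance)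

/-- The splitting of `M` makes the extension of tori split, and `Q` is separated because it is
closed in the affine orbit. -/
theorem exists_isFreeQuotient_of_isPullback [Module.Free ℤ M] [Module.Finite ℤ M]
    (hσ : IsRationalPolyhedral σ) {X Q : Over base} {k : X ⟶ torus M} {j : Q ⟶ orbit σ}
    {q : X ⟶ Q} [Mono k] [IsClosedImmersion j.left] (h : IsPullback q k j (torusToOrbit σ)) :
    ∃ _ : ModObj (subtorus σ) X, actionMap (subtorus σ) X ≫ k = (subtorusι σ ⊗ₘ k) ≫ MonObj.mul ∧
      IsFreeAction (subtorus σ) X ∧ IsFreeQuotient (subtorus σ) q := by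
  obtain ⟨r, ρ, h1, h2, h3, h4⟩ := exists_splitting hσ
  have : IsSeparated Q.hom := by
    rw [← Over.w j]
    infer_instance
  refine exists_isFreeQuotient (t := torusMap r) (s := torusMap ρ) h ?_ ?_ ?_ ?_ ?_
  · rw [subtorusι, torusToOrbit, ← torusMap_comp, restrictSpan_comp_subtype hσ, torusMap_zero]
  · rw [subtorusι, ← torusMap_comp, h1, torusMap_id]
  · rw [torusToOrbit, ← torusMap_comp, h2, torusMap_id]
  · rw [← torusMap_comp, h3, torusMap_zero]
  · rw [subtorusι, torusToOrbit, ← torusMap_comp, ← torusMap_comp, torusMap_mul, h4, torusMap_id]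

end Quotient

end TropicalToric

end

theorem corollaryC {M : Type} [AddCommGroup M] [Module.Free ℤ M] [Module.Finite ℤ M]
    (I : Ideal (AddMonoidAlgebra ℂ M)) (F : Fan M)
    (hF : ∀ σ ∈ F.cones, ∀ u ∈ relInterior σ, ∀ w ∈ relInterior σ,
      initialIdeal u I = initialIdeal w I)
    (σ : F.cones) (w : M →+ ℝ) (hw : w ∈ relInterior σ.1) :
    ∃ (_ : ModObj (subtorus σ.1) (initialScheme w I))
      (q : initialScheme w I ⟶ closureInterOrbit F I σ),
      actionMap (subtorus σ.1) (initialScheme w I) ≫ subschemeι (initialIdeal w I) =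
        (subtorusι σ.1 ⊗ₘ subschemeι (initialIdeal w I)) ≫ MonObj.mul (X := torus M) ∧
      IsFreeAction (subtorus σ.1) (initialScheme w I) ∧
      q ≫ closureInterOrbitι F I σ = subschemeι (initialIdeal w I) ≫ torusToOrbit σ.1 ∧
      IsFreeQuotient (subtorus σ.1) q := by
  obtain ⟨q, hq⟩ := exists_isPullback_closureInterOrbit F I σ
    (initialIdeal_eq_map (F.rational σ σ.2) fun u hu => hF σ σ.2 u hu w hw)
  obtain ⟨act, h1, h2, h3⟩ := exists_isFreeQuotient_of_isPullback (F.rational σ σ.2) hq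
  exact ⟨act, q, h1, h2, hq.w, h3⟩
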